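/- Let $\Sigma=\{0,\dots,\sigma-1\}$ be an alphabet of size $\sigma$. A *minimal absent palindromic word* (MAPW) of a string $x$ is a palindrome $w$ such that $w$ does not occur in $x$ but $w[1..|w|-2]$ (the string $w$ without its first and last character; empty if $|w|\le 2$) occurs in $x$. Let $S\in\Sigma^*$ be a string of length $n>0$, and consider any sequence of nonempty windows $S[i_t..j_t]$, $t=0,1,\dots,T$, inside $S$, each of length at most $d$, with $(i_0,j_0)=(0,0)$, in which every window arises from the previous one by deleting its leftmost character or by appending the next character of $S$ at its right end. **Corollary (MAPWs for a sliding window).** The set of MAPWs of the window can be maintained in $O(n+d\sigma)$ total time and $O(d\sigma)$ space, on top of the array-based eertree of the window. Precisely: there are a fixed word-RAM algorithm (one program each for initialisation, append and delete) and an absolute constant $C$ such that for all $\sigma$, $d$, $S$ and all such sequences of windows, on a machine with $C d\sigma$ memory words of arbitrary initial content (and constantly many registers), whose words hold the integers below $W$ for any $W\ge C(n+d\sigma)$, the algorithm, which is given $d$, $\sigma$ and $S[0]$ at the start and after that only the operations one by one (an append together with the appended character), has the following properties. * After each time $t$ the memory holds the eertree of $S[i_t..j_t]$: a $(-1)$-node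 of length $-1$, a $0$-node for the empty string, and one node for each nonempty palindromic substring. Each node $v$, with palindrome $\mathrm{pal}(v)$, has an array of size $\sigma$ of pointers to its children (the child of $v$ along the edge labelled $c$ is the node of $c\,\mathrm{pal}(v)\,c$, or of the one-letter word $c$ if $v$ is the $(-1)$-node; the pointer is null if that word does not occur in the window), its length, its suffix link, its parent and the label of the edge from its parent (the last two for nonempty palindromes only). The suffix link of the node of a nonempty palindrome points to the node of its longest palindromic proper suffix, and those of the $0$-node and the $(-1)$-node point to the $(-1)$-node. * Each node $v$ also has an array $M_v$ of size $\sigma$, and after each time $t$ the set of words marked by these arrays, i.e. of the words $c\,\mathrm{pal}(v)\,c$ (the word $c$ for the $(-1)$-node) with $M_v[c]=1$, is exactly the set of all MAPWs of $S[i_t..j_t]$. * The total running time, including initialisation, is at most $C(n+d\sigma)$. -/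

import Mathlib

open scoped BigOperators

namespace SlidingMAPW

/-! ### Strings, minimal absent palindromic words, windows -/

section Strings

variable {α : Type*}

/-- The string `w[1..|w|-2]` (empty if `|w| ≤ 2`). -/
def inner (w : List α) : List α := w.tail.dropLast

/-- `w` is a minimal absent palindromic word of `x`: `w` is a palindrome, `w` does not occur
in `x`, and `w[1..|w|-2]` occurs in `x`. -/
def IsMAPW (x w : List α) : Prop :=
  w.Palindrome ∧ ¬ w <:+: x ∧ inner w <:+: x

/-- The set of all minimal absent palindromic words of `x`. -/
def mapws (x : List α) : Set (List α) := {w | IsMAPW x w}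

/-- The substring `S[i..j]`, both ends included, positions counted from `0`. -/
def substr (S : List α) (i j : ℕ) : List α := (S.drop i).take (j + 1 - i)

/-- The windows `S[i_t..j_t]`, `t = 0, …, T`, over a string of length `n`: the first one is
`S[0..0]`, and each next one arises by deleting the leftmost character or by appending one
character at the right end; windows are never empty. -/
structure IsWindowSequence (n T : ℕ) (i j : ℕ → ℕ) : Prop where
  start : i 0 = 0 ∧ j 0 = 0
  inside : ∀ t ≤ T, i t ≤ j t ∧ j t < n
  step : ∀ t < T,
    (i (t + 1) = i t + 1 ∧ j (t + 1) = j t) ∨ (i (t + 1) = i t ∧ j (t + 1) = j t + 1)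

end Strings

/-! ### Eertrees -/

/-- Possible nodes of an eertree: the `-1`-node, and a node for each string `p`
(`word []` is the `0`-node). -/
inductive ENode (α : Type*) where
  | negOne : ENode α
  | word (p : List α) : ENode α

namespace ENode

variable {α : Type*}

/-- The string of a node; the `0`-node and the `-1`-node both have the empty string. -/
def str : ENode α → List α
  | negOne => []
  | word p => p

/-- The length of a node; the `-1`-node has length `-1`. -/
def len : ENode α → ℤ
  | negOne => -1
  | word p => p.length

/-- The word `c·pal(u)·c` of length `len u + 2` (for the `-1`-node this is the one-letter
word `c`). -/
def wrap (c : α) : ENode α → List α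
  | negOne => [c]
  | word p => c :: (p ++ [c])

end ENode

section Eertree

variable {α : Type*}

/-- The nodes of the eertree of `x`: the two auxiliary nodes and one node for each nonempty
palindromic substring of `x`. -/
def eertreeNodes (x : List α) : Set (ENode α) :=
  {u | match u with
    | .negOne => True
    | .word p => p.Palindrome ∧ p <:+: x}

/-- There is an edge from `u` to `v` labelled `c`. -/
def IsEdge (u : ENode α) (c : α) (v : ENode α) : Prop :=
  u.len + 2 = v.len ∧ u.str = inner v.str ∧ v.str.head? = some c

/-- The suffix link of `u` points to `v`: the suffix link of a nonempty palindrome is its longest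
palindromic proper suffix (for a one-letter word this is the `0`-node), and the suffix links of
the `0`-node and of the `-1`-node point to the `-1`-node. -/
def IsSuffixLink : ENode α → ENode α → Prop
  | .negOne, v => v = .negOne
  | .word [], v => v = .negOne
  | .word (a :: p), v => ∃ q : List α, v = .word q ∧
      (q.Palindrome ∧ q <:+ a :: p ∧ q ≠ a :: p) ∧
      ∀ q' : List α, q'.Palindrome → q' <:+ a :: p → q' ≠ a :: p → q'.length ≤ q.length

end Eertree

/-! ### The machine: a word RAM

A machine has `M` memory words with addresses `0, …, M - 1` and finitely many registers (those
that its program names). Registers and memory words hold integers in `{0, …, W - 1}`.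
A computation that overflows a word or leaves the memory has no result. -/

/-- The contents of the registers and of the memory. -/
structure State where
  reg : ℕ → ℕ
  mem : ℕ → ℕ

/-- Write a register. -/
def State.setReg (s : State) (r v : ℕ) : State := { s with reg := Function.update s.reg r v }

/-- Write a memory word. -/
def State.setMem (s : State) (a v : ℕ) : State := { s with mem := Function.update s.mem a v }

/-- All contents are words. -/
def State.Words (W : ℕ) (s : State) : Prop := (∀ r, s.reg r < W) ∧ ∀ a, s.mem a < W

/-- Arithmetic expressions; `sub` is truncated subtraction, `load e` reads the memory word whose
address is the value of `e`. -/
inductive Expr where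
  | const (k : ℕ) : Expr
  | reg (r : ℕ) : Expr
  | load (e : Expr) : Expr
  | add (e f : Expr) : Expr
  | sub (e f : Expr) : Expr
  | mul (e f : Expr) : Expr

namespace Expr

/-- The value. -/
def eval (s : State) : Expr → ℕ
  | const k => k
  | reg r => s.reg r
  | load e => s.mem (e.eval s)
  | add e f => e.eval s + f.eval s
  | sub e f => e.eval s - f.eval s
  | mul e f => e.eval s * f.eval s

/-- All intermediate results are words, and all addresses lie in the memory. -/
def Ok (M W : ℕ) (s : State) : Expr → Prop
  | const k => k < W
  | reg r => s.reg r < W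
  | load e => e.Ok M W s ∧ e.eval s < M ∧ s.mem (e.eval s) < W
  | add e f => e.Ok M W s ∧ f.Ok M W s ∧ e.eval s + f.eval s < W
  | sub e f => e.Ok M W s ∧ f.Ok M W s
  | mul e f => e.Ok M W s ∧ f.Ok M W s ∧ e.eval s * f.eval s < W

/-- One time unit for each operation and each operand. -/
def cost : Expr → ℕ
  | const _ => 1
  | reg _ => 1
  | load e => e.cost + 1
  | add e f => e.cost + f.cost + 1
  | sub e f => e.cost + f.cost + 1
  | mul e f => e.cost + f.cost + 1

end Expr

/-- Conditions. -/
inductive Cond where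
  | eq (e f : Expr) : Cond
  | lt (e f : Expr) : Cond
  | not (b : Cond) : Cond
  | and (b b' : Cond) : Cond

namespace Cond

/-- The truth value. -/
def Holds (s : State) : Cond → Prop
  | eq e f => e.eval s = f.eval s
  | lt e f => e.eval s < f.eval s
  | not b => ¬ b.Holds s
  | and b b' => b.Holds s ∧ b'.Holds s

/-- All expressions can be evaluated. -/
def Ok (M W : ℕ) (s : State) : Cond → Prop
  | eq e f => e.Ok M W s ∧ f.Ok M W s
  | lt e f => e.Ok M W s ∧ f.Ok M W s
  | not b => b.Ok M W s
  | and b b' => b.Ok M W s ∧ b'.Ok M W s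

/-- One time unit for each operation and each operand. -/
def cost : Cond → ℕ
  | eq e f => e.cost + f.cost + 1
  | lt e f => e.cost + f.cost + 1
  | not b => b.cost + 1
  | and b b' => b.cost + b'.cost + 1

end Cond

/-- Programs. `assign r e` writes the value of `e` into register `r`, and `store a e` writes the
value of `e` into the memory word whose address is the value of `a`. -/
inductive Prog where
  | skip : Prog
  | assign (r : ℕ) (e : Expr) : Prog
  | store (a e : Expr) : Prog
  | seq (p q : Prog) : Prog
  | ite (b : Cond) (p q : Prog) : Prog
  | while (b : Cond) (p : Prog) : Prog

/-- `Exec M W p s k s'`: with `M` memory words of values below `W`, the program `p`, started in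
state `s`, halts after `k` time units in state `s'`. -/
inductive Exec (M W : ℕ) : Prog → State → ℕ → State → Prop where
  | skip (s : State) : Exec M W Prog.skip s 1 s
  | assign (r : ℕ) (e : Expr) (s : State) (h : e.Ok M W s) :
      Exec M W (Prog.assign r e) s (e.cost + 1) (s.setReg r (e.eval s))
  | store (a e : Expr) (s : State) (ha : a.Ok M W s) (he : e.Ok M W s) (hM : a.eval s < M) :
      Exec M W (Prog.store a e) s (a.cost + e.cost + 1) (s.setMem (a.eval s) (e.eval s))
  | seq {p q : Prog} {s s₁ s₂ : State} {k₁ k₂ : ℕ}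
      (hp : Exec M W p s k₁ s₁) (hq : Exec M W q s₁ k₂ s₂) :
      Exec M W (Prog.seq p q) s (k₁ + k₂) s₂
  | ite_true {b : Cond} {p q : Prog} {s s' : State} {k : ℕ} (hok : b.Ok M W s) (hb : b.Holds s)
      (hp : Exec M W p s k s') : Exec M W (Prog.ite b p q) s (b.cost + 1 + k) s'
  | ite_false {b : Cond} {p q : Prog} {s s' : State} {k : ℕ} (hok : b.Ok M W s)
      (hb : ¬ b.Holds s) (hq : Exec M W q s k s') :
      Exec M W (Prog.ite b p q) s (b.cost + 1 + k) s'
  | while_true {b : Cond} {p : Prog} {s s₁ s₂ : State} {k₁ k₂ : ℕ} (hok : b.Ok M W s)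
      (hb : b.Holds s) (hp : Exec M W p s k₁ s₁) (hw : Exec M W (Prog.while b p) s₁ k₂ s₂) :
      Exec M W (Prog.while b p) s (b.cost + 1 + k₁ + k₂) s₂
  | while_false {b : Cond} {p : Prog} {s : State} (hok : b.Ok M W s) (hb : ¬ b.Holds s) :
      Exec M W (Prog.while b p) s (b.cost + 1) s

/-! ### Sliding-window algorithms

Characters are the numbers `0, …, σ - 1`. The algorithm is told `d` (register `0`), `σ`
(register `1`) and the first character (register `2`) at the start, and the appended character
(register `2`) with each append operation; it never sees later characters of the string. -/

/-- One program for each kind of event. -/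
structure WindowAlgorithm where
  init : Prog
  append : Prog
  delete : Prog

/-- The `k`-th character of `S`, as a number (`0` outside of `S`, which is never used). -/
def charAt {σ : ℕ} (S : List (Fin σ)) (k : ℕ) : ℕ := (S.map Fin.val).getD k 0

/-- The computation of `A` on the windows `S[i_t..j_t]`, `t = 0, …, T`, from the machine contents
`s₀`: `run t` are the contents when the window at time `t` has been processed, and `τ t` is the
time spent at time `t`. -/
structure WindowAlgorithm.Runs (A : WindowAlgorithm) (M W : ℕ) {σ : ℕ} (d : ℕ) (S : List (Fin σ))
    (T : ℕ) (i j : ℕ → ℕ) (s₀ : State) (run : ℕ → State) (τ : ℕ → ℕ) : Prop where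
  init : Exec M W A.init
    (((s₀.setReg 0 d).setReg 1 σ).setReg 2 (charAt S 0)) (τ 0) (run 0)
  append : ∀ t < T, i (t + 1) = i t → j (t + 1) = j t + 1 →
    Exec M W A.append ((run t).setReg 2 (charAt S (j (t + 1)))) (τ (t + 1)) (run (t + 1))
  delete : ∀ t < T, i (t + 1) = i t + 1 → j (t + 1) = j t →
    Exec M W A.delete (run t) (τ (t + 1)) (run (t + 1))

/-! ### The array-based eertree in memory

Register `3` points to the `-1`-node and register `4` to the `0`-node. The object of a node `v`
at address `a` consists of
* the words `a + c`, `c < σ`: a pointer to the child along the edge labelled `c`, or `0`;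
* the words `a + σ + c`, `c < σ`: the array `M_v[c]`;
* the word `a + 2σ`: `len v + 1`;
* the word `a + 2σ + 1`: a pointer to the node of the suffix link of `v`;
* the words `a + 2σ + 2` and `a + 2σ + 3`: a pointer to the parent of `v` and the label of the
  edge from the parent (without meaning for the two auxiliary nodes). -/

/-- The memory of `s` holds the eertree of `x`. -/
def StoresEertree (M : ℕ) {σ : ℕ} (s : State) (x : List (Fin σ)) : Prop :=
  ∃ addr : ENode (Fin σ) → ℕ,
    Set.InjOn addr (eertreeNodes x) ∧
    (∀ u ∈ eertreeNodes x, addr u ≠ 0 ∧ addr u + (2 * σ + 4) ≤ M) ∧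
    s.reg 3 = addr .negOne ∧ s.reg 4 = addr (.word []) ∧
    (∀ u ∈ eertreeNodes x, ∀ c : Fin σ, ∀ v ∈ eertreeNodes x, IsEdge u c v →
      s.mem (addr u + c) = addr v ∧
      s.mem (addr v + 2 * σ + 2) = addr u ∧ s.mem (addr v + 2 * σ + 3) = c) ∧
    (∀ u ∈ eertreeNodes x, ∀ c : Fin σ, (¬ ∃ v ∈ eertreeNodes x, IsEdge u c v) →
      s.mem (addr u + c) = 0) ∧
    (∀ u ∈ eertreeNodes x, (s.mem (addr u + 2 * σ) : ℤ) = u.len + 1) ∧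
    (∀ u ∈ eertreeNodes x, ∀ v ∈ eertreeNodes x, IsSuffixLink u v →
      s.mem (addr u + 2 * σ + 1) = addr v)

/-- `ReadsNode s a u`: starting at the two auxiliary nodes and following child pointers in the
memory of `s`, one gets to address `a`, and the labels read on the way spell the node `u`. -/
inductive ReadsNode {σ : ℕ} (s : State) : ℕ → ENode (Fin σ) → Prop where
  | negOne : ReadsNode s (s.reg 3) .negOne
  | zero : ReadsNode s (s.reg 4) (.word [])
  | child {a : ℕ} {u : ENode (Fin σ)} (c : Fin σ) (h : ReadsNode s a u)
      (hc : s.mem (a + c) ≠ 0) : ReadsNode s (s.mem (a + c)) (.word (u.wrap c))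

/-- The set of words that the arrays `M_v` in the memory of `s` mark: the words `c·pal(v)·c` with
`M_v[c] = 1`. It is read off from the machine contents alone. -/
def storedWords (σ : ℕ) (s : State) : Set (List (Fin σ)) :=
  {w | ∃ (a : ℕ) (u : ENode (Fin σ)) (c : Fin σ),
    ReadsNode s a u ∧ s.mem (a + σ + c) = 1 ∧ w = u.wrap c}

end SlidingMAPW

namespace SlidingMAPW

/-! ### Palindromic suffixes and prefixes -/

section Palindromes

variable {α : Type*}

/-! The marks come for free with the eertree: an absent palindrome whose inner part occurs is
exactly a word c·pal(v)·c for a node v that has no child along c. So M_v is kept as the complement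
of the child array of v (`TreeInv.storedWords`), and the problem is to maintain the eertree in
amortised constant time per operation after an initialisation of cost O(dσ).

Extending a string by one letter creates at most one new palindromic substring: the longest
palindromic suffix when appending (`palsF_concat`), the longest palindromic prefix when prepending
(`mem_palsF`). Hence d + 2 node objects suffice, an append inserts at most one node, and a deletion
removes at most one, that of the longest palindromic prefix v.

Append. The nonempty palindromic suffixes of xc are the words cuc where u is a palindromic suffix of
x or the (-1)-node. Following suffix links from the longest palindromic suffix of x until the
preceding letter is c yields the new longest one; continuing the search from the next link yields
the suffix link of a new node (`wp_findLoop`). Every step shortens the current node, and the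
potential |s| + |s'|, with s the longest palindromic suffix and s' its longest palindromic proper
suffix, pays for both searches: it grows by at most 4 in an append and never grows in a deletion
(`potential_concat`, `wp_append`, `potential_tail`).

Delete. It has to be decided in constant time whether v occurs a second time. For each position of
the window one palindrome starting there is recorded, and the record contains every surface, that
is, every occurrence that is the longest palindrome both at its start and at its end. The counter of
a node is the number of its recorded occurrences plus the number of suffix links into it. A second
occurrence of v is either a surface, hence recorded, or it begins or ends a longer palindrome, and
then some suffix link leads to v; so v survives iff its counter exceeds 1 (`lpp_mem_palsF_iff`). One
change of the record per operation keeps all surfaces in it (`preOk_preAppend`, `preOk_preDelete`).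

A removed node is a leaf without incoming suffix links. Its child array is all null and its marks
are all 1, which is what a new node needs, so nodes are recycled through a free list and no array is
ever cleared after the initialisation (`TreeInv.insert_node`, `TreeInv.erase_node`).

On the machine, memory is viewed as a family of pairwise distinct cells (`Loc.adr_inj`). Loop-free
code is executed symbolically with `wpf`, and only the suffix-link search and the initialisation
need the loop rule `Wp.while`. -/

theorem _root_.List.Palindrome.prefix_of_suffix {p q : List α} (hp : p.Palindrome)
    (hq : q.Palindrome) (h : q <:+ p) : q <+: p := by
  rw [← List.reverse_suffix, hp.reverse_eq, hq.reverse_eq]; exact h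

theorem _root_.List.Palindrome.suffix_of_prefix {p q : List α} (hp : p.Palindrome)
    (hq : q.Palindrome) (h : q <+: p) : q <:+ p := by
  rw [← List.reverse_prefix, hp.reverse_eq, hq.reverse_eq]; exact h

theorem _root_.List.IsSuffix.of_length_lt {p q : List α} (h : q <:+ p)
    (hl : q.length < p.length) : q <:+ p.tail := by
  cases p with
  | nil => simp at hl
  | cons a p =>
    rcases List.suffix_cons_iff.1 h with rfl | h
    · simp at hl
    · exact h

theorem _root_.List.IsPrefix.of_length_lt {p q : List α} (h : q <+: p)
    (hl : q.length < p.length) : q <+: p.dropLast := by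
  rw [← List.reverse_suffix] at h ⊢
  have := h.of_length_lt (by simpa using hl)
  simpa using this

theorem _root_.List.Palindrome.trim {v : List α} (h : v.Palindrome) (r : ℕ) :
    ((v.drop r).take (v.length - 2 * r)).Palindrome := by
  apply List.Palindrome.of_reverse_eq
  apply List.ext_getElem
  · simp
  · intro n h1 h2
    simp only [List.length_reverse, List.length_take, List.length_drop] at h1 h2
    simp only [List.getElem_reverse, List.getElem_take, List.getElem_drop, List.length_take,
      List.length_drop]
    have h3 : ∀ m (hm : m < v.length), v[m] = v[v.length - 1 - m] := by
      intro m hm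
      conv_lhs => rw [List.getElem_of_eq h.reverse_eq.symm hm]
      rw [List.getElem_reverse]
    rw [h3 _ (by omega)]
    congr 1
    omega

/-- The palindrome `p` occurs in `x` at position `k`, and it is the longest palindrome that starts
there and the longest palindrome that ends at the same place. -/
def IsSurface (x : List α) (k : ℕ) (p : List α) : Prop :=
  p.Palindrome ∧ p ≠ [] ∧ p <+: x.drop k ∧
    (∀ q : List α, q.Palindrome → q <+: x.drop k → q.length ≤ p.length) ∧
    ∀ q : List α, q.Palindrome → q <:+ x.take (k + p.length) → q.length ≤ p.length

/-- `pre k` is a palindrome that occurs in `x` at position `k`; all surfaces are recorded. -/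
structure PreOk (x : List α) (pre : ℕ → List α) : Prop where
  pal : ∀ k < x.length, (pre k).Palindrome
  occ : ∀ k < x.length, pre k <+: x.drop k
  surf : ∀ k p, IsSurface x k p → pre k = p

theorem IsSurface.lt {x : List α} {k : ℕ} {p : List α} (h : IsSurface x k p) :
    k + p.length ≤ x.length ∧ k < x.length := by
  have h1 := h.2.2.1.length_le
  have := List.length_pos_iff.2 h.2.1
  simp at h1; omega

theorem preOk_nil (pre : ℕ → List α) : PreOk [] pre where
  pal := by simp
  occ := by simp
  surf k p h := by have := h.lt; simp at this

/-- A proper suffix of a prefix of `x` does not start at position 0, so it survives the deletion of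
the first letter. -/
theorem infix_tail_of_prefix {x v p : List α} (hvx : v <+: x)
    (hpv : p <:+ v) (hl : p.length < v.length) : p <:+: x.tail := by
  have h1 : p <:+ v.tail := hpv.of_length_lt hl
  obtain ⟨z, rfl⟩ := hvx
  cases v with
  | nil => simp at hl
  | cons b v => exact h1.isInfix.trans (by simpa using List.infix_append_left)

variable [DecidableEq α]

/-- The longest palindromic suffix. -/
def lps : List α → List α
  | [] => []
  | a :: x => if (a :: x).Palindrome then a :: x else lps x

/-- The longest palindromic prefix. -/
def lpp (x : List α) : List α := lps x.reverse

theorem lps_of_palindrome {x : List α} (h : x.Palindrome) : lps x = x := by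
  cases x with
  | nil => rfl
  | cons a x => simp [lps, h]

theorem palindrome_lps (x : List α) : (lps x).Palindrome := by
  induction x with
  | nil => exact .nil
  | cons a x ih => unfold lps; split_ifs with h <;> assumption

theorem lps_suffix (x : List α) : lps x <:+ x := by
  induction x with
  | nil => simp [lps]
  | cons a x ih =>
    unfold lps; split_ifs with h
    · exact List.suffix_rfl
    · exact ih.trans (List.suffix_cons a x)

theorem lps_max {x q : List α} (hq : q.Palindrome) (h : q <:+ x) : q <:+ lps x := by
  induction x with
  | nil => simpa [lps] using h
  | cons a x ih =>
    unfold lps; split_ifs with hp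
    · exact h
    · rcases List.suffix_cons_iff.1 h with rfl | h
      · exact absurd hq hp
      · exact ih h

theorem eq_lps {x q : List α} (hq : q.Palindrome) (h : q <:+ x)
    (hmax : ∀ p : List α, p.Palindrome → p <:+ x → p.length ≤ q.length) : q = lps x :=
  (lps_max hq h).eq_of_length_le (hmax _ (palindrome_lps x) (lps_suffix x))

theorem length_lps_le (x : List α) : (lps x).length ≤ x.length := (lps_suffix x).length_le

theorem lps_tail_length_lt {p : List α} (hp : p ≠ []) : (lps p.tail).length < p.length := by
  have h := length_lps_le p.tail
  have := List.length_pos_iff.2 hp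
  rw [List.length_tail] at h; omega

theorem lps_tail_suffix (p : List α) : lps p.tail <:+ p :=
  (lps_suffix _).trans (List.tail_suffix p)

theorem palindrome_lpp (x : List α) : (lpp x).Palindrome := palindrome_lps _

theorem lpp_prefix (x : List α) : lpp x <+: x := by
  rw [← List.reverse_suffix, (palindrome_lpp x).reverse_eq]; exact lps_suffix _

theorem lpp_max {x q : List α} (hq : q.Palindrome) (h : q <+: x) : q <+: lpp x := by
  have := lps_max (x := x.reverse) hq (by rw [← hq.reverse_eq]; exact List.reverse_suffix.2 h)
  exact (palindrome_lps _).prefix_of_suffix hq this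

theorem lps_ne_nil {x : List α} (h : x ≠ []) : lps x ≠ [] := by
  intro h0
  obtain ⟨y, b, rfl⟩ := (List.eq_nil_or_concat x).resolve_left h
  have := lps_max (x := y ++ [b]) (q := [b]) (.singleton b) (List.suffix_append _ _)
  rw [← List.concat_eq_append, h0] at this
  simp at this

theorem lpp_ne_nil {x : List α} (h : x ≠ []) : lpp x ≠ [] := lps_ne_nil (by simpa using h)

/-! ### The set of palindromic substrings -/

/-- The palindromic substrings, the empty one included. -/
def palsF : List α → Finset (List α)
  | [] => {[]}
  | a :: x => insert (lpp (a :: x)) (palsF x)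

/-- A palindromic prefix shorter than the longest one is, by reflection inside the longest one, also
a proper suffix of it, so it already occurs one place or more to the right. Only the longest
palindromic prefix can be new. -/
theorem mem_palsF {x p : List α} : p ∈ palsF x ↔ p.Palindrome ∧ p <:+: x := by
  induction x with
  | nil =>
    simp only [palsF, Finset.mem_singleton, List.infix_nil]
    exact ⟨fun h => ⟨h ▸ .nil, h⟩, fun h => h.2⟩
  | cons a x ih =>
    rw [palsF, Finset.mem_insert, ih, List.infix_cons_iff]
    constructor
    · rintro (rfl | ⟨h1, h2⟩)
      · exact ⟨palindrome_lpp _, Or.inl (lpp_prefix _)⟩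
      · exact ⟨h1, Or.inr h2⟩
    · rintro ⟨h1, h2 | h2⟩
      · have h3 := lpp_max h1 h2
        rcases h3.length_le.lt_or_eq with hl | hl
        · exact Or.inr ⟨h1, infix_tail_of_prefix (lpp_prefix _)
            ((palindrome_lpp _).suffix_of_prefix h1 h3) hl⟩
        · exact Or.inl (h3.eq_of_length hl)
      · exact Or.inr ⟨h1, h2⟩

theorem nil_mem_palsF (x : List α) : [] ∈ palsF x := mem_palsF.2 ⟨.nil, List.nil_infix⟩

theorem card_palsF_le (x : List α) : (palsF x).card ≤ x.length + 1 := by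
  induction x with
  | nil => simp [palsF]
  | cons a x ih =>
    rw [palsF]
    exact (Finset.card_insert_le _ _).trans (by simpa using ih)

/-- The mirror image of the recursion: a shorter palindromic suffix is also a proper prefix of the
longest one and therefore occurs in `x`. -/
theorem palsF_concat (x : List α) (c : α) :
    palsF (x ++ [c]) = insert (lps (x ++ [c])) (palsF x) := by
  ext p
  rw [Finset.mem_insert, mem_palsF, mem_palsF, List.infix_concat_iff]
  constructor
  · rintro ⟨h1, h2 | h2⟩
    · have h3 := lps_max h1 h2
      rcases h3.length_le.lt_or_eq with hl | hl
      · refine Or.inr ⟨h1, ?_⟩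
        have h4 := ((palindrome_lps _).prefix_of_suffix h1 h3).of_length_lt hl
        refine h4.isInfix.trans ?_
        have h5 : (lps (x ++ [c])).dropLast <:+ (x ++ [c]).dropLast := by
          obtain ⟨z, hz⟩ := lps_suffix (x ++ [c])
          have hne : lps (x ++ [c]) ≠ [] := lps_ne_nil (by simp)
          refine ⟨z, ?_⟩
          rw [← List.dropLast_append_of_ne_nil hne, hz]
        simpa using h5.isInfix
      · exact Or.inl (h3.eq_of_length hl)
    · exact Or.inr ⟨h1, h2⟩
  · rintro (rfl | ⟨h1, h2⟩)
    · exact ⟨palindrome_lps _, Or.inl (lps_suffix _)⟩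
    · exact ⟨h1, Or.inr h2⟩

theorem palsF_of_infix {x p q : List α} (hp : p ∈ palsF x) (hq : q.Palindrome) (h : q <:+: p) :
    q ∈ palsF x := mem_palsF.2 ⟨hq, h.trans (mem_palsF.1 hp).2⟩

theorem lps_tail_mem_palsF {x p : List α} (hp : p ∈ palsF x) : lps p.tail ∈ palsF x :=
  palsF_of_infix hp (palindrome_lps _) (lps_tail_suffix p).isInfix

/-- The suffix links below a palindrome lead to each of its palindromic proper suffixes. -/
theorem exists_lps_tail_eq {x v : List α} (hv : v.Palindrome) :
    ∀ (n : ℕ) (q : List α), q.length = n → q ∈ palsF x → v <:+ q → v.length < q.length →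
      ∃ q' ∈ palsF x, q' ≠ [] ∧ lps q'.tail = v := by
  intro n
  induction n using Nat.strong_induction_on with
  | _ n ih =>
    rintro q rfl hq hvq hl
    have hne : q ≠ [] := by rintro rfl; simp at hl
    have h1 : v <:+ lps q.tail := lps_max hv (hvq.of_length_lt hl)
    rcases h1.length_le.lt_or_eq with h2 | h2
    · exact ih _ (lps_tail_length_lt hne) _ rfl (lps_tail_mem_palsF hq) h1 h2
    · exact ⟨q, hq, hne, (h1.eq_of_length h2).symm⟩

/-! ### Recorded occurrences -/

theorem isSurface_lpp {x : List α} (h : x ≠ []) : IsSurface x 0 (lpp x) := by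
  refine ⟨palindrome_lpp x, lpp_ne_nil h, by simpa using lpp_prefix x, ?_, ?_⟩
  · intro q hq h; exact (lpp_max hq (by simpa using h)).length_le
  · intro q hq h
    have := h.length_le
    simp at this; omega

/-- This is how a deletion finds the longest palindromic prefix without searching: it is the entry
recorded at the left end. -/
theorem PreOk.zero {x : List α} {pre : ℕ → List α} (h : PreOk x pre) (hx : x ≠ []) :
    pre 0 = lpp x := h.surf _ _ (isSurface_lpp hx)

theorem PreOk.mem_palsF {x : List α} {pre : ℕ → List α} (h : PreOk x pre) {k : ℕ}
    (hk : k < x.length) : pre k ∈ palsF x :=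
  SlidingMAPW.mem_palsF.2 ⟨h.pal k hk, (h.occ k hk).isInfix.trans (List.drop_suffix _ _).isInfix⟩

/-- The recorded occurrences after appending `c` to `x`. -/
def preAppend (x : List α) (c : α) (pre : ℕ → List α) : ℕ → List α :=
  Function.update (Function.update pre x.length [])
    (x.length + 1 - (lps (x ++ [c])).length) (lps (x ++ [c]))

/-- A surface of the new string that ends before the last letter is a surface of `x`, and it does
not start where the new longest palindromic suffix starts, because it would not be longest there; so
its entry is not overwritten. A surface that ends at the last letter is the longest palindromic
suffix itself. -/
theorem preOk_preAppend {x : List α} {pre : ℕ → List α} (h : PreOk x pre) (c : α) :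
    PreOk (x ++ [c]) (preAppend x c pre) := by
  set v := lps (x ++ [c]) with hv
  have hvs : v <:+ x ++ [c] := lps_suffix _
  have hvd := List.suffix_iff_eq_drop.1 hvs
  have hvn : v ≠ [] := lps_ne_nil (by simp)
  have hvl := hvs.length_le
  have hvp := List.length_pos_iff.2 hvn
  simp only [List.length_append, List.length_singleton] at hvd hvl
  refine ⟨?_, ?_, ?_⟩
  · intro k hk
    simp only [List.length_append, List.length_singleton] at hk
    by_cases h1 : k = x.length + 1 - v.length
    · subst h1; simp only [preAppend, ← hv, Function.update_self]; exact palindrome_lps _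
    · simp only [preAppend, ← hv, Function.update_of_ne h1]
      by_cases h2 : k = x.length
      · subst h2; simp only [Function.update_self]; exact .nil
      · simp only [Function.update_of_ne h2]; exact h.pal k (by omega)
  · intro k hk
    simp only [List.length_append, List.length_singleton] at hk
    by_cases h1 : k = x.length + 1 - v.length
    · subst h1; simp only [preAppend, ← hv, Function.update_self]; rw [← hvd]
    · simp only [preAppend, ← hv, Function.update_of_ne h1]
      by_cases h2 : k = x.length
      · subst h2; simp only [Function.update_self]; exact List.nil_prefix
      · simp only [Function.update_of_ne h2]
        rw [List.drop_append_of_le_length (by omega)]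
        exact (h.occ k (by omega)).trans (List.prefix_append _ _)
  · intro k p hs
    have hlt := hs.lt
    obtain ⟨hp, hpn, hpo, hs1, hs2⟩ := hs
    simp only [List.length_append, List.length_singleton] at hlt
    have hpp := List.length_pos_iff.2 hpn
    rcases hlt.1.lt_or_eq with hl | hl
    · have h1 : k ≠ x.length + 1 - v.length := by
        rintro rfl
        have := hs1 v (palindrome_lps _) (by rw [← hvd])
        omega
      have h2 : k ≠ x.length := by omega
      simp only [preAppend, ← hv, Function.update_of_ne h1, Function.update_of_ne h2]
      have hd : (x ++ [c]).drop k = x.drop k ++ [c] := List.drop_append_of_le_length (by omega)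
      apply h.surf
      refine ⟨hp, hpn, ?_, ?_, ?_⟩
      · rw [hd] at hpo
        exact List.prefix_of_prefix_length_le hpo (List.prefix_append _ _) (by simp; omega)
      · intro q hq hqo
        exact hs1 q hq (by rw [hd]; exact hqo.trans (List.prefix_append _ _))
      · intro q hq hqo
        exact hs2 q hq (by rw [List.take_append_of_le_length (by omega)]; exact hqo)
    · have hpe : p = v := by
        refine eq_lps hp ?_ ?_
        · have h1 := List.prefix_iff_eq_take.1 hpo
          have h2 : p = (x ++ [c]).drop k := by
            rw [h1]; apply List.take_of_length_le; simp; omega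
          rw [h2]; exact List.drop_suffix _ _
        · intro q hq hqs
          exact hs2 q hq (by rw [List.take_of_length_le (by simp; omega)]; exact hqs)
      have hk : k = x.length + 1 - v.length := by rw [← hpe]; omega
      rw [hpe, hk]
      simp only [preAppend, ← hv, Function.update_self]

/-- If `q` is a palindromic proper prefix of the palindrome `v`, then the longest palindromic
proper suffix of this occurrence of `q` is not the longest palindrome starting at its place. -/
theorem exists_longer_of_proper_prefix {v q : List α} (hv : v.Palindrome) (hq : q.Palindrome)
    (hqv : q <+: v) (hl : q.length < v.length) (hqn : q ≠ []) :
    ∃ w : List α, w.Palindrome ∧ w <+: v.drop (q.length - (lps q.tail).length) ∧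
      (lps q.tail).length < w.length := by
  set p := lps q.tail with hp
  have hpl : p.length < q.length := lps_tail_length_lt hqn
  set r := q.length - p.length with hr
  set t := v.length - q.length with ht
  have hvt : v.drop t = q := (List.suffix_iff_eq_drop.1 (hv.suffix_of_prefix hq hqv)).symm
  rcases lt_trichotomy r t with h | h | h
  -- Cutting `r` letters off both ends of `v` leaves a palindrome of length |v| - 2r, and this
  -- exceeds |q| - r = |p| because r < t.
  · refine ⟨_, hv.trim r, List.take_prefix _ _, ?_⟩
    simp; omega
  · refine ⟨q, hq, by rw [h, hvt], hpl⟩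
  -- Here the prefix and the suffix copies of `q` in `v` overlap in `q.drop t`, which is both a
  -- prefix and a suffix of the palindrome `q`, hence a palindrome; it is longer than `p`, the
  -- longest palindromic proper suffix.
  · exfalso
    have hs : q.drop t <:+ q := List.drop_suffix _ _
    have hpre : q.drop t <+: q := by
      obtain ⟨z, hz⟩ := hqv
      have : v.drop t = q.drop t ++ z := by
        rw [← hz, List.drop_append_of_le_length (by omega)]
      rw [hvt] at this
      exact ⟨z, this.symm⟩
    have hpal : (q.drop t).Palindrome := by
      apply List.Palindrome.of_reverse_eq
      have h1 : (q.drop t).reverse <+: q := by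
        rw [← hq.reverse_eq, List.reverse_prefix, hq.reverse_eq]; exact hs
      exact (List.prefix_of_prefix_length_le h1 hpre (by simp)).eq_of_length (by simp)
    have h1 : q.drop t <:+ q.tail := hs.of_length_lt (by simp; omega)
    have h2 := (lps_max hpal h1).length_le
    rw [← hp] at h2
    simp at h2; omega

/-- The recorded occurrences after deleting the first character of `x`. -/
def preDelete (x : List α) (pre : ℕ → List α) : ℕ → List α :=
  let v := lpp x
  let u := lps v.tail
  fun k => if u ≠ [] ∧ (pre (v.length - u.length)).length < u.length ∧
    k + 1 = v.length - u.length then u else pre (k + 1)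

theorem lps_tail_lpp_occ (x : List α) :
    lps (lpp x).tail <+: x.drop ((lpp x).length - (lps (lpp x).tail).length) := by
  have h1 := (lpp_prefix x).drop ((lpp x).length - (lps (lpp x).tail).length)
  rwa [← List.suffix_iff_eq_drop.1 (lps_tail_suffix (lpp x))] at h1

/-- A surface `p` of `y` that was no surface of `x` was spoiled by a longer palindrome `q` with the
same end, which must start at the deleted letter; then `p` is the longest palindromic proper suffix
of `q`. If `q` were shorter than the longest palindromic prefix `v`,
`exists_longer_of_proper_prefix` would give a longer palindrome at the start of `p`. So `q = v`, and
the only surface that can appear is the one that `preDelete` records. -/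
theorem preOk_preDelete {a : α} {y : List α} {pre : ℕ → List α} (h : PreOk (a :: y) pre) :
    PreOk y (preDelete (a :: y) pre) := by
  set x := a :: y with hx
  set v := lpp x with hv
  set u := lps v.tail with hu
  have hvn : v ≠ [] := lpp_ne_nil (by simp [hx])
  have hul : u.length < v.length := lps_tail_length_lt hvn
  have huo : u <+: x.drop (v.length - u.length) := lps_tail_lpp_occ x
  have hd : ∀ k, x.drop (k + 1) = y.drop k := fun k => by simp [hx]
  have hxl : x.length = y.length + 1 := by simp [hx]
  refine ⟨?_, ?_, ?_⟩
  · intro k hk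
    unfold preDelete
    split_ifs
    · exact palindrome_lps _
    · exact h.pal _ (by omega)
  · intro k hk
    unfold preDelete
    split_ifs with hc
    · rw [← hd, hc.2.2]; exact huo
    · rw [← hd]; exact h.occ _ (by omega)
  · intro k p hs
    have hlt := hs.lt
    obtain ⟨hp, hpn, hpo, hs1, hs2⟩ := hs
    rw [← hd] at hpo hs1
    by_cases hsx : IsSurface x (k + 1) p
    · have h1 := h.surf _ _ hsx
      unfold preDelete
      rw [← hv, ← hu]
      split_ifs with hc
      · exfalso
        have h2 := hs1 u (palindrome_lps _) (by rw [hc.2.2]; exact huo)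
        rw [← hc.2.2, h1] at hc
        omega
      · exact h1
    · have h1 : ∃ q : List α, q.Palindrome ∧ q <:+ x.take (k + 1 + p.length) ∧
          p.length < q.length := by
        by_contra hcon
        push Not at hcon
        exact hsx ⟨hp, hpn, hpo, hs1, hcon⟩
      obtain ⟨q, hq, hqs, hql⟩ := h1
      have htk : x.take (k + 1 + p.length) = a :: y.take (k + p.length) := by
        rw [hx, show k + 1 + p.length = k + p.length + 1 by omega, List.take_succ_cons]
      rw [htk] at hqs
      have hqe : q = a :: y.take (k + p.length) := by
        rcases List.suffix_cons_iff.1 hqs with hqs | hqs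
        · exact hqs
        · have := hs2 q hq hqs
          omega
      have hqx : q <+: x := by rw [hqe, ← htk]; exact List.take_prefix _ _
      have hqn : q ≠ [] := by simp [hqe]
      have hqlen : q.length = k + 1 + p.length := by
        rw [hqe]; simp; omega
      have hps : p <:+ q.tail := by
        rw [hqe, List.tail_cons]
        have e1 : p = (y.drop k).take p.length := by
          rw [hd] at hpo; exact List.prefix_iff_eq_take.1 hpo
        rw [List.take_drop] at e1
        rw [e1]
        simp only [List.length_drop, List.length_take]
        have : min (p.length + k) y.length - k = p.length := by omega
        have e2 : k + (min (k + p.length) y.length - k) = k + p.length := by omega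
        rw [e2]
        exact List.drop_suffix _ _
      have hpe : p = lps q.tail := by
        refine eq_lps hp hps ?_
        intro w hw hws
        refine hs2 w hw ?_
        rw [hqe] at hws; simpa using hws
      have hqv : q <+: v := lpp_max hq hqx
      rcases hqv.length_le.lt_or_eq with hlq | hlq
      · exfalso
        obtain ⟨w, hw, hwo, hwl⟩ := exists_longer_of_proper_prefix (palindrome_lpp x) hq hqv hlq hqn
        rw [← hpe] at hwo hwl
        have e : q.length - p.length = k + 1 := by omega
        rw [e] at hwo
        have hvx : v.drop (k + 1) <+: x.drop (k + 1) := (lpp_prefix x).drop _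
        have := hs1 w hw (hwo.trans hvx)
        omega
      · have hqv' : q = v := hqv.eq_of_length hlq
        have hpu : p = u := by rw [hpe, hqv', ← hu]
        have hk : k + 1 = v.length - u.length := by rw [← hpu, ← hqv']; omega
        unfold preDelete
        rw [← hv, ← hu]
        split_ifs with hc
        · exact hpu.symm
        -- When the guard refuses to overwrite, the present entry is at least as long as `u`; since
        -- `p = u` is longest at this place, the entry is `u` already.
        · have hc' : u.length ≤ (pre (k + 1)).length := by
            by_contra hcon
            exact hc ⟨by rw [← hpu]; exact hpn, by rw [← hk]; omega, hk⟩
          have h2 := h.occ (k + 1) (by omega)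
          have h3 := hs1 _ (h.pal (k + 1) (by omega)) h2
          rw [← hpu] at hc'
          exact (List.prefix_of_prefix_length_le h2 hpo h3).eq_of_length (by omega)

/-- The number of recorded occurrences of `p`. -/
def occCount (n : ℕ) (pre : ℕ → List α) (p : List α) : ℕ :=
  ((Finset.range n).filter (fun k => pre k = p)).card

/-- The number of palindromes in `P` whose suffix link leads to `p`. -/
def linkCount (P : Finset (List α)) (p : List α) : ℕ :=
  (P.filter (fun q => lps q.tail = p)).card

/-- The longest palindromic prefix occurs a second time iff the counts see it. -/
theorem lpp_mem_palsF_iff {a : α} {y : List α} {pre : ℕ → List α} (h : PreOk (a :: y) pre) :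
    lpp (a :: y) ∈ palsF y ↔ 1 < occCount (a :: y).length pre (lpp (a :: y)) +
      linkCount (palsF (a :: y)) (lpp (a :: y)) := by
  set x := a :: y with hx
  set v := lpp x with hv
  have hvn : v ≠ [] := lpp_ne_nil (by simp [hx])
  have hvp : v.Palindrome := palindrome_lpp x
  have hxl : x.length = y.length + 1 := by simp [hx]
  have h0 : (0 : ℕ) ∈ (Finset.range x.length).filter (fun k => pre k = v) := by
    simp [hxl, h.zero (x := x) (by simp [hx]), ← hv]
  have hpos : 1 ≤ occCount x.length pre v := Finset.card_pos.2 ⟨0, h0⟩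
  constructor
  · intro hmem
    rw [mem_palsF] at hmem
    by_cases hlk : 0 < linkCount (palsF x) v
    · omega
    -- Without a suffix link into `v`, no longer palindrome of the window ends with `v`, nor starts
    -- with it, since a palindromic prefix of a palindrome is also a suffix.
    have hno : ∀ q ∈ palsF x, v <:+ q → q.length ≤ v.length := by
      intro q hq hvq
      by_contra hcon
      obtain ⟨q', h1, h2, h3⟩ := exists_lps_tail_eq hvp _ q rfl hq hvq (by omega)
      exact hlk (Finset.card_pos.2 ⟨q', by simp [h1, h3]⟩)
    obtain ⟨s, t, hst⟩ := hmem.2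
    -- Hence the second occurrence is a surface, so it is recorded and counted in addition to the
    -- one at position 0.
    have hsurf : IsSurface x (s.length + 1) v := by
      have hd : x.drop (s.length + 1) = v ++ t := by
        rw [hx, List.drop_succ_cons, ← hst]; simp
      refine ⟨hvp, hvn, by rw [hd]; exact List.prefix_append _ _, ?_, ?_⟩
      · intro q hq hqo
        by_contra hcon
        have h1 : v <+: q := List.prefix_of_prefix_length_le
          (by rw [hd]; exact List.prefix_append _ _) hqo (by omega)
        have := hno q (mem_palsF.2 ⟨hq, hqo.isInfix.trans (List.drop_suffix _ _).isInfix⟩)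
          (hq.suffix_of_prefix hvp h1)
        omega
      · intro q hq hqo
        by_contra hcon
        have htk : x.take (s.length + 1 + v.length) = a :: (s ++ v) := by
          rw [hx, show s.length + 1 + v.length = (s ++ v).length + 1 by simp; omega,
            List.take_succ_cons, ← hst, List.take_left]
        have h1 : v <:+ q := List.suffix_of_suffix_length_le
          (by rw [htk]; exact (List.suffix_append s v).trans (List.suffix_cons _ _)) hqo (by omega)
        have := hno q (mem_palsF.2 ⟨hq, hqo.isInfix.trans (List.take_prefix _ _).isInfix⟩) h1
        omega
    have h1 := h.surf _ _ hsurf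
    have : 2 ≤ occCount x.length pre v := by
      have hsub : ({0, s.length + 1} : Finset ℕ) ⊆
          (Finset.range x.length).filter (fun k => pre k = v) := by
        intro k hk
        rw [Finset.mem_insert, Finset.mem_singleton] at hk
        rcases hk with rfl | rfl
        · exact h0
        · simp [h1, hsurf.lt.2]
      have := Finset.card_le_card hsub
      rw [Finset.card_pair (by omega)] at this
      exact this
    omega
  · intro hcnt
    rw [mem_palsF]
    refine ⟨hvp, ?_⟩
    by_cases hlk : 0 < linkCount (palsF x) v
    · obtain ⟨q, hq⟩ := Finset.card_pos.1 hlk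
      rw [Finset.mem_filter, mem_palsF] at hq
      obtain ⟨⟨hqp, hqi⟩, hqv⟩ := hq
      have hqn : q ≠ [] := by rintro rfl; exact hvn (by rw [← hqv]; rfl)
      have hsuf : v <:+ q := hqv ▸ lps_tail_suffix q
      have hlt : v.length < q.length := hqv ▸ lps_tail_length_lt hqn
      rw [hx, List.infix_cons_iff] at hqi
      rcases hqi with h1 | h1
      · simpa using infix_tail_of_prefix h1 hsuf hlt
      · exact hsuf.isInfix.trans h1
    -- Two recorded occurrences, so one of them starts at a nonzero position and remains in `y`.
    · have h2 : 1 < occCount x.length pre v := by omega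
      obtain ⟨k, hk, hk0⟩ := Finset.exists_mem_ne h2 0
      rw [Finset.mem_filter, Finset.mem_range] at hk
      obtain ⟨k, rfl⟩ := Nat.exists_eq_succ_of_ne_zero hk0
      have := h.occ _ hk.1
      rw [hk.2, hx, Nat.succ_eq_add_one, List.drop_succ_cons] at this
      exact this.isInfix.trans (List.drop_suffix _ _).isInfix

end Palindromes

/-! ### Total correctness of programs -/

section Programs

variable {M W : ℕ}

/-- `e` can be evaluated in a state that contains words only. -/
def Expr.Safe (M W : ℕ) (s : State) : Expr → Prop
  | const k => k < W
  | reg _ => True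
  | load e => e.Safe M W s ∧ e.eval s < M
  | add e f => e.Safe M W s ∧ f.Safe M W s ∧ e.eval s + f.eval s < W
  | sub e f => e.Safe M W s ∧ f.Safe M W s
  | mul e f => e.Safe M W s ∧ f.Safe M W s ∧ e.eval s * f.eval s < W

theorem Expr.Safe.ok {s : State} (hs : s.Words W) : ∀ {e : Expr}, e.Safe M W s → e.Ok M W s
  | const _, h => h
  | reg r, _ => hs.1 r
  | load _, h => ⟨h.1.ok hs, h.2, hs.2 _⟩
  | add _ _, h => ⟨h.1.ok hs, h.2.1.ok hs, h.2.2⟩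
  | sub _ _, h => ⟨h.1.ok hs, h.2.ok hs⟩
  | mul _ _, h => ⟨h.1.ok hs, h.2.1.ok hs, h.2.2⟩

theorem Expr.Ok.eval_lt {s : State} : ∀ {e : Expr}, e.Ok M W s → e.eval s < W
  | const _, h => h
  | reg _, h => h
  | load _, h => h.2.2
  | add _ _, h => h.2.2
  | sub _ _, h => (Nat.sub_le _ _).trans_lt h.1.eval_lt
  | mul _ _, h => h.2.2

/-- `b` can be evaluated in a state that contains words only. -/
def Cond.Safe (M W : ℕ) (s : State) : Cond → Prop
  | eq e f => e.Safe M W s ∧ f.Safe M W s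
  | lt e f => e.Safe M W s ∧ f.Safe M W s
  | not b => b.Safe M W s
  | and b b' => b.Safe M W s ∧ b'.Safe M W s

theorem Cond.Safe.ok {s : State} (hs : s.Words W) {b : Cond} (h : b.Safe M W s) :
    b.Ok M W s := by
  induction b with
  | eq _ _ => exact ⟨h.1.ok hs, h.2.ok hs⟩
  | lt _ _ => exact ⟨h.1.ok hs, h.2.ok hs⟩
  | not _ ih => exact ih h
  | and _ _ ih ih' => exact ⟨ih h.1, ih' h.2⟩

theorem State.Words.setReg {s : State} (hs : s.Words W) {r v : ℕ} (hv : v < W) :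
    (s.setReg r v).Words W := by
  refine ⟨fun r' => ?_, hs.2⟩
  by_cases h : r' = r
  · subst h; simpa [State.setReg] using hv
  · simpa [State.setReg, h] using hs.1 r'

theorem State.Words.setMem {s : State} (hs : s.Words W) {a v : ℕ} (hv : v < W) :
    (s.setMem a v).Words W := by
  refine ⟨hs.1, fun a' => ?_⟩
  by_cases h : a' = a
  · subst h; simpa [State.setMem] using hv
  · simpa [State.setMem, h] using hs.2 a'

/-- Started in `s`, the program `p` halts within `N` time units in a state with property `Q`. -/
def Wp (M W : ℕ) (p : Prog) (s : State) (N : ℕ) (Q : State → Prop) : Prop :=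
  s.Words W → ∃ k s', Exec M W p s k s' ∧ k ≤ N ∧ s'.Words W ∧ Q s'

theorem Wp.mono {p : Prog} {s : State} {N N' : ℕ} {Q Q' : State → Prop}
    (h : Wp M W p s N Q) (hN : N ≤ N') (hQ : ∀ s', Q s' → Q' s') : Wp M W p s N' Q' := by
  intro hs
  obtain ⟨k, s', h1, h2, h3, h4⟩ := h hs
  exact ⟨k, s', h1, h2.trans hN, h3, hQ _ h4⟩

theorem Wp.seq {p q : Prog} {s : State} {N N' : ℕ} {Q : State → Prop}
    (h : Wp M W p s N (fun s' => Wp M W q s' N' Q)) : Wp M W (.seq p q) s (N + N') Q := by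
  intro hs
  obtain ⟨k, s', h1, h2, h3, h4⟩ := h hs
  obtain ⟨k', s'', h1', h2', h3', h4'⟩ := h4 h3
  exact ⟨_, s'', .seq h1 h1', by omega, h3', h4'⟩

theorem Wp.ite {b : Cond} {p q : Prog} {s : State} {N : ℕ} {Q : State → Prop}
    (hb : b.Safe M W s) (hp : b.Holds s → Wp M W p s N Q) (hq : ¬ b.Holds s → Wp M W q s N Q) :
    Wp M W (.ite b p q) s (b.cost + 1 + N) Q := by
  intro hs
  by_cases h : b.Holds s
  · obtain ⟨k, s', h1, h2, h3, h4⟩ := hp h hs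
    exact ⟨_, s', .ite_true (hb.ok hs) h h1, by omega, h3, h4⟩
  · obtain ⟨k, s', h1, h2, h3, h4⟩ := hq h hs
    exact ⟨_, s', .ite_false (hb.ok hs) h h1, by omega, h3, h4⟩

/-- A loop with invariant `I` and variant `n`: each iteration decreases the variant. -/
theorem Wp.while {b : Cond} {p : Prog} {N : ℕ} {I : ℕ → State → Prop}
    (hb : ∀ n s, I n s → b.Safe M W s)
    (hp : ∀ n s, I n s → b.Holds s → Wp M W p s N (fun s' => ∃ m < n, I m s')) :
    ∀ n s, I n s → s.Words W →
      ∃ k s' m, Exec M W (.while b p) s k s' ∧ s'.Words W ∧ I m s' ∧ ¬ b.Holds s' ∧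
        m ≤ n ∧ k ≤ (b.cost + 1 + N) * (n - m + 1) := by
  intro n
  induction n using Nat.strong_induction_on with
  | _ n ih =>
    intro s hI hs
    by_cases h : b.Holds s
    · obtain ⟨k, s', h1, h2, h3, m, hm, h4⟩ := hp n s hI h hs
      obtain ⟨k', s'', m', h1', h3', h4', h5', h6', h7'⟩ := ih m hm s' h4 h3
      refine ⟨_, s'', m', .while_true ((hb n s hI).ok hs) h h1 h1', h3', h4', h5', by omega, ?_⟩
      -- Each iteration lowers the variant by at least one, and the `+ 1` in the bound pays for the
      -- last, failing test. Keeping the final value `m'` in the bound lets the cost telescope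
      -- later.
      have h8 : (b.cost + 1 + N) * (m - m' + 1) + (b.cost + 1 + N) ≤
          (b.cost + 1 + N) * (n - m' + 1) := by
        rw [← Nat.mul_succ]
        exact Nat.mul_le_mul_left _ (by omega)
      omega
    · refine ⟨_, s, n, .while_false ((hb n s hI).ok hs) h, hs, hI, h, le_rfl, ?_⟩
      simp

/-- Weakest preconditions of loop-free programs. -/
def wpf (M W : ℕ) : Prog → State → (State → Prop) → Prop
  | .skip, s, Q => Q s
  | .assign r e, s, Q => e.Safe M W s ∧ Q (s.setReg r (e.eval s))
  | .store a e, s, Q => a.Safe M W s ∧ e.Safe M W s ∧ a.eval s < M ∧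
      Q (s.setMem (a.eval s) (e.eval s))
  | .seq p q, s, Q => wpf M W p s (fun s' => wpf M W q s' Q)
  | .ite b p q, s, Q => b.Safe M W s ∧ (b.Holds s → wpf M W p s Q) ∧
      (¬ b.Holds s → wpf M W q s Q)
  | .while _ _, _, _ => False

/-- A time bound for loop-free programs. -/
def bnd : Prog → ℕ
  | .skip => 1
  | .assign _ e => e.cost + 1
  | .store a e => a.cost + e.cost + 1
  | .seq p q => bnd p + bnd q
  | .ite b p q => b.cost + 1 + (bnd p + bnd q)
  | .while _ _ => 0

/-- Loop-free code is thus verified by symbolic execution, with a time bound that depends on the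
program text only and so contributes just to the absolute constant. -/
theorem wpf.wp {p : Prog} : ∀ {s : State} {Q : State → Prop}, wpf M W p s Q →
    Wp M W p s (bnd p) Q := by
  induction p with
  | skip => exact fun h hs => ⟨_, _, .skip _, le_rfl, hs, h⟩
  | assign r e =>
    exact fun h hs => ⟨_, _, .assign r e _ (h.1.ok hs), le_rfl,
      hs.setReg (h.1.ok hs).eval_lt, h.2⟩
  | store a e =>
    exact fun h hs => ⟨_, _, .store a e _ (h.1.ok hs) (h.2.1.ok hs) h.2.2.1, le_rfl,
      hs.setMem (h.2.1.ok hs).eval_lt, h.2.2.2⟩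
  | seq p q ihp ihq =>
    exact fun h => Wp.seq ((ihp h).mono le_rfl fun s' h' => ihq h')
  | ite b p q ihp ihq =>
    exact fun h => Wp.ite h.1 (fun hb => (ihp (h.2.1 hb)).mono (by omega) fun _ h => h)
      (fun hb => (ihq (h.2.2 hb)).mono (by omega) fun _ h => h)
  | _ => exact fun h => h.elim

end Programs

/-! ### Memory layout -/

/-- The memory cells in use: child pointers and marks of the nodes, five more fields of each node
(length, suffix link, parent, label, counter), and two circular buffers. -/
inductive Loc (σ d : ℕ) where
  | child (k : Fin (d + 2)) (c : Fin σ) : Loc σ d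
  | mark (k : Fin (d + 2)) (c : Fin σ) : Loc σ d
  | fld (k : Fin (d + 2)) (n : Fin 5) : Loc σ d
  | buf (b : Fin 2) (p : Fin d) : Loc σ d
  deriving DecidableEq

/-- The address of the `k`-th node. -/
def nodeAddr (σ k : ℕ) : ℕ := 1 + k * (2 * σ + 5)

/-- The number of memory words in use. -/
def memSize (σ d : ℕ) : ℕ := nodeAddr σ (d + 2) + 2 * d

section Layout

variable {σ d : ℕ}

/-- The address of a cell. -/
def Loc.adr : Loc σ d → ℕ
  | child k c => nodeAddr σ k + c
  | mark k c => nodeAddr σ k + σ + c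
  | fld k n => nodeAddr σ k + 2 * σ + n
  | buf b p => nodeAddr σ (d + 2) + b * d + p

theorem nodeAddr_add_le {k l : ℕ} (h : k < l) : nodeAddr σ k + (2 * σ + 5) ≤ nodeAddr σ l := by
  have : (k + 1) * (2 * σ + 5) ≤ l * (2 * σ + 5) := Nat.mul_le_mul_right _ h
  rw [Nat.succ_mul] at this
  unfold nodeAddr; omega

/-- Nodes start at address 1 because 0 serves as the null pointer. -/
theorem nodeAddr_pos (k : ℕ) : 0 < nodeAddr σ k := by unfold nodeAddr; omega

theorem nodeAddr_fin (k : Fin (d + 2)) :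
    nodeAddr σ k + (2 * σ + 5) ≤ nodeAddr σ (d + 2) := nodeAddr_add_le k.2

theorem nodeAddr_add_inj {k l i j : ℕ} (hi : i < 2 * σ + 5) (hj : j < 2 * σ + 5)
    (h : nodeAddr σ k + i = nodeAddr σ l + j) : k = l ∧ i = j := by
  rcases lt_trichotomy k l with hkl | rfl | hkl
  · have := nodeAddr_add_le (σ := σ) hkl; omega
  · exact ⟨rfl, by omega⟩
  · have := nodeAddr_add_le (σ := σ) hkl; omega

theorem nodeAddr_inj {k l : Fin (d + 2)} (h : nodeAddr σ k = nodeAddr σ l) : k = l :=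
  Fin.ext (nodeAddr_add_inj (i := 0) (j := 0) (by omega) (by omega) (by omega)).1

/-- The nodes occupy disjoint blocks of width 2σ + 5 and the buffers come after the last block. This
is what allows memory to be treated as a function of cells, as in `State.get_put`. -/
theorem Loc.adr_inj {l l' : Loc σ d} (h : l.adr = l'.adr) : l = l' := by
  have key : ∀ (k k' : Fin (d + 2)) (i j : ℕ), nodeAddr σ k + i = nodeAddr σ k' + j →
      i < 2 * σ + 5 → j < 2 * σ + 5 → k = k' ∧ i = j := fun k k' i j h hi hj =>
    ⟨Fin.ext (nodeAddr_add_inj hi hj h).1, (nodeAddr_add_inj hi hj h).2⟩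
  cases l with
  | child k c =>
    have := nodeAddr_fin (σ := σ) k
    cases l' <;> simp only [adr] at h
    case child k' c' =>
      obtain ⟨rfl, h2⟩ := key k k' c c' h (by omega) (by omega)
      rw [Fin.ext h2]
    case mark k' c' =>
      have := (key k k' c (σ + c') (by omega) (by omega) (by omega)).2; omega
    case fld k' n =>
      have := (key k k' c (2 * σ + n) (by omega) (by omega) (by omega)).2; omega
    case buf b p => omega
  | mark k c =>
    have := nodeAddr_fin (σ := σ) k
    cases l' <;> simp only [adr] at h
    case child k' c' =>
      have := (key k k' (σ + c) c' (by omega) (by omega) (by omega)).2; omega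
    case mark k' c' =>
      obtain ⟨rfl, h2⟩ := key k k' (σ + c) (σ + c') (by omega) (by omega) (by omega)
      rw [Fin.ext (a := c) (b := c') (by omega)]
    case fld k' n =>
      have := (key k k' (σ + c) (2 * σ + n) (by omega) (by omega) (by omega)).2; omega
    case buf b p => omega
  | fld k n =>
    have := nodeAddr_fin (σ := σ) k
    cases l' <;> simp only [adr] at h
    case child k' c' =>
      have := (key k k' (2 * σ + n) c' (by omega) (by omega) (by omega)).2; omega
    case mark k' c' =>
      have := (key k k' (2 * σ + n) (σ + c') (by omega) (by omega) (by omega)).2; omega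
    case fld k' n' =>
      obtain ⟨rfl, h2⟩ := key k k' (2 * σ + n) (2 * σ + n') (by omega) (by omega) (by omega)
      rw [Fin.ext (a := n) (b := n') (by omega)]
    case buf b p => omega
  | buf b p =>
    cases l' <;> simp only [adr] at h
    case child k' c' => have := nodeAddr_fin (σ := σ) k'; omega
    case mark k' c' => have := nodeAddr_fin (σ := σ) k'; omega
    case fld k' n' => have := nodeAddr_fin (σ := σ) k'; omega
    case buf b' p' =>
      have hp := p.2
      have hp' := p'.2
      have hb : b = b' := by
        fin_cases b <;> fin_cases b' <;> simp at h ⊢ <;> omega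
      subst hb
      rw [Fin.ext (a := p) (b := p') (by omega)]

theorem Loc.adr_lt (l : Loc σ d) : l.adr < memSize σ d := by
  unfold memSize
  cases l with
  | child k c => have := nodeAddr_fin (σ := σ) k; simp only [adr]; omega
  | mark k c => have := nodeAddr_fin (σ := σ) k; simp only [adr]; omega
  | fld k n => have := nodeAddr_fin (σ := σ) k; simp only [adr]; omega
  | buf b p =>
    have : (b : ℕ) * d ≤ 1 * d := Nat.mul_le_mul_right _ (by omega)
    simp only [adr]; omega

/-- The content of a cell. -/
def State.get (s : State) (l : Loc σ d) : ℕ := s.mem l.adr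

/-- Writing a cell. -/
def State.put (s : State) (l : Loc σ d) (v : ℕ) : State := s.setMem l.adr v

theorem State.get_put (s : State) (l l' : Loc σ d) (v : ℕ) :
    (s.put l v).get l' = if l' = l then v else s.get l' := by
  unfold State.get State.put State.setMem
  by_cases h : l' = l
  · simp [h]
  · rw [if_neg h]
    exact Function.update_of_ne (fun h' => h (Loc.adr_inj h')) _ _

@[simp] theorem State.get_setReg (s : State) (l : Loc σ d) (r v : ℕ) :
    (s.setReg r v).get l = s.get l := rfl

@[simp] theorem State.reg_put (s : State) (l : Loc σ d) (r v : ℕ) :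
    (s.put l v).reg r = s.reg r := rfl

theorem State.reg_setReg (s : State) (r r' v : ℕ) :
    (s.setReg r v).reg r' = if r' = r then v else s.reg r' := by
  unfold State.setReg
  by_cases h : r' = r
  · simp [h]
  · simp [h]

theorem State.setReg_setReg (s : State) (r v w : ℕ) :
    (s.setReg r v).setReg r w = s.setReg r w := by
  simp [State.setReg]

/-! ### Access to the cells -/

/-- The address of the `n`-th field of the node in register `q`. -/
def fldE (q n : ℕ) : Expr := .add (.add (.reg q) (.mul (.const 2) (.reg 1))) (.const n)

/-- The address of the child pointer along the character in register `c` of the node in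
register `q`. -/
def childE (q c : ℕ) : Expr := .add (.reg q) (.reg c)

/-- The address of the mark for the character in register `c` of the node in register `q`. -/
def markE (q c : ℕ) : Expr := .add (.add (.reg q) (.reg 1)) (.reg c)

/-- The address of the cell of the buffer `b` whose number is in register `p`. -/
def bufE (b p : ℕ) : Expr := .add (.add (.reg 9) (.mul (.const b) (.reg 0))) (.reg p)

/-- Loading a field of a node. -/
def ldFld (r q n : ℕ) : Prog := .assign r (.load (fldE q n))
/-- Storing a field of a node. -/
def stFld (q n : ℕ) (e : Expr) : Prog := .store (fldE q n) e
/-- Loading a child pointer. -/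
def ldChild (r q c : ℕ) : Prog := .assign r (.load (childE q c))
/-- Storing a child pointer. -/
def stChild (q c : ℕ) (e : Expr) : Prog := .store (childE q c) e
/-- Storing a mark. -/
def stMark (q c : ℕ) (e : Expr) : Prog := .store (markE q c) e
/-- Loading a cell of a buffer. -/
def ldBuf (r b p : ℕ) : Prog := .assign r (.load (bufE b p))
/-- Storing a cell of a buffer. -/
def stBuf (b p : ℕ) (e : Expr) : Prog := .store (bufE b p) e

/-- Register `r` gets the number of the buffer cell of the position with offset `e` from the left
end of the window. -/
def ldPos (r : ℕ) (e : Expr) : Prog :=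
  .seq (.assign r (.add (.reg 6) e))
    (.assign r (.sub (.reg r) (.mul (.reg 0) (.sub (.const 1) (.sub (.reg 0) (.reg r))))))

/-- The machine is large enough. -/
structure Large (M W σ d : ℕ) : Prop where
  sigma : 0 < σ
  mem : memSize σ d ≤ M
  word : M ≤ W

/-- The registers that hold the constants. -/
structure Ctx (σ d : ℕ) (s : State) : Prop where
  r0 : s.reg 0 = d
  r1 : s.reg 1 = σ
  r9 : s.reg 9 = nodeAddr σ (d + 2)

theorem Ctx.put {s : State} (h : Ctx σ d s) (l : Loc σ d) (v : ℕ) : Ctx σ d (s.put l v) :=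
  ⟨h.r0, h.r1, h.r9⟩

theorem Ctx.setReg {s : State} (h : Ctx σ d s) {r : ℕ} (v : ℕ)
    (hr : r ≠ 0 ∧ r ≠ 1 ∧ r ≠ 9 := by decide) : Ctx σ d (s.setReg r v) := by
  refine ⟨?_, ?_, ?_⟩ <;> rw [State.reg_setReg, if_neg (by omega)]
  exacts [h.r0, h.r1, h.r9]

variable {M W : ℕ} {s : State} {Q : State → Prop}

/-- Enough room for the constants of the programs, the node sizes, the counters (at most d + (d +
1)) and buffer offsets before reduction modulo d. -/
theorem Large.two_lt (hL : Large M W σ d) : 10 + 4 * σ + 2 * d < W := by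
  have h1 := hL.mem
  have h2 := hL.word
  have : 2 * (2 * σ + 5) ≤ (d + 2) * (2 * σ + 5) := Nat.mul_le_mul_right _ (by omega)
  unfold memSize nodeAddr at h1; omega

theorem fldE_spec (hL : Large M W σ d) (hc : Ctx σ d s) {q : ℕ} {k : Fin (d + 2)}
    (hq : s.reg q = nodeAddr σ k) (n : Fin 5) :
    (fldE q n).Safe M W s ∧ (fldE q n).eval s = (Loc.fld k n : Loc σ d).adr ∧
      (fldE q n).eval s < M := by
  have h1 := (Loc.fld k n : Loc σ d).adr_lt
  have h2 := hL.mem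
  have h3 := hL.word
  have h4 := hL.two_lt
  have h5 := n.2
  simp only [Loc.adr] at h1
  simp only [fldE, Expr.Safe, Expr.eval, hq, hc.r1, Loc.adr, true_and]
  omega

theorem childE_spec (hL : Large M W σ d) {q c : ℕ} {k : Fin (d + 2)} {a : Fin σ}
    (hq : s.reg q = nodeAddr σ k) (ha : s.reg c = a) :
    (childE q c).Safe M W s ∧ (childE q c).eval s = (Loc.child k a : Loc σ d).adr ∧
      (childE q c).eval s < M := by
  have h1 := (Loc.child k a : Loc σ d).adr_lt
  have h2 := hL.mem
  have h3 := hL.word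
  simp only [Loc.adr] at h1
  simp only [childE, Expr.Safe, Expr.eval, hq, ha, Loc.adr, true_and]
  omega

theorem markE_spec (hL : Large M W σ d) (hc : Ctx σ d s) {q c : ℕ} {k : Fin (d + 2)} {a : Fin σ}
    (hq : s.reg q = nodeAddr σ k) (ha : s.reg c = a) :
    (markE q c).Safe M W s ∧ (markE q c).eval s = (Loc.mark k a : Loc σ d).adr ∧
      (markE q c).eval s < M := by
  have h1 := (Loc.mark k a : Loc σ d).adr_lt
  have h2 := hL.mem
  have h3 := hL.word
  simp only [Loc.adr] at h1
  simp only [markE, Expr.Safe, Expr.eval, hq, ha, hc.r1, Loc.adr, true_and]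
  omega

theorem bufE_spec (hL : Large M W σ d) (hc : Ctx σ d s) {q : ℕ} {p : Fin d} (b : Fin 2)
    (hq : s.reg q = p) :
    (bufE b q).Safe M W s ∧ (bufE b q).eval s = (Loc.buf b p : Loc σ d).adr ∧
      (bufE b q).eval s < M := by
  have h1 := (Loc.buf b p : Loc σ d).adr_lt
  have h2 := hL.mem
  have h3 := hL.word
  have h4 := hL.two_lt
  have h5 := b.2
  simp only [Loc.adr] at h1
  simp only [bufE, Expr.Safe, Expr.eval, hq, hc.r0, hc.r9, Loc.adr, true_and]
  omega

theorem wpf_ldFld (hL : Large M W σ d) (hc : Ctx σ d s) {r q : ℕ} {k : Fin (d + 2)} (n : Fin 5)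
    (hq : s.reg q = nodeAddr σ k) (h : Q (s.setReg r (s.get (Loc.fld k n : Loc σ d)))) :
    wpf M W (ldFld r q n) s Q := by
  obtain ⟨h1, h2, h3⟩ := fldE_spec hL hc hq n
  refine ⟨⟨h1, h3⟩, ?_⟩
  rw [Expr.eval, h2]; exact h

theorem wpf_stFld (hL : Large M W σ d) (hc : Ctx σ d s) {q : ℕ} {e : Expr} {k : Fin (d + 2)}
    (n : Fin 5) (hq : s.reg q = nodeAddr σ k) (he : e.Safe M W s)
    (h : Q (s.put (Loc.fld k n : Loc σ d) (e.eval s))) :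
    wpf M W (stFld q n e) s Q := by
  obtain ⟨h1, h2, h3⟩ := fldE_spec hL hc hq n
  refine ⟨h1, he, h3, ?_⟩
  rw [h2]; exact h

theorem wpf_ldChild (hL : Large M W σ d) {r q c : ℕ} {k : Fin (d + 2)} {a : Fin σ}
    (hq : s.reg q = nodeAddr σ k) (ha : s.reg c = a)
    (h : Q (s.setReg r (s.get (Loc.child k a : Loc σ d)))) :
    wpf M W (ldChild r q c) s Q := by
  obtain ⟨h1, h2, h3⟩ := childE_spec hL hq ha
  refine ⟨⟨h1, h3⟩, ?_⟩
  rw [Expr.eval, h2]; exact h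

theorem wpf_stChild (hL : Large M W σ d) {q c : ℕ} {e : Expr} {k : Fin (d + 2)} {a : Fin σ}
    (hq : s.reg q = nodeAddr σ k) (ha : s.reg c = a) (he : e.Safe M W s)
    (h : Q (s.put (Loc.child k a : Loc σ d) (e.eval s))) :
    wpf M W (stChild q c e) s Q := by
  obtain ⟨h1, h2, h3⟩ := childE_spec hL hq ha
  refine ⟨h1, he, h3, ?_⟩
  rw [h2]; exact h

theorem wpf_stMark (hL : Large M W σ d) (hc : Ctx σ d s) {q c : ℕ} {e : Expr} {k : Fin (d + 2)}
    {a : Fin σ} (hq : s.reg q = nodeAddr σ k) (ha : s.reg c = a) (he : e.Safe M W s)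
    (h : Q (s.put (Loc.mark k a : Loc σ d) (e.eval s))) :
    wpf M W (stMark q c e) s Q := by
  obtain ⟨h1, h2, h3⟩ := markE_spec hL hc hq ha
  refine ⟨h1, he, h3, ?_⟩
  rw [h2]; exact h

theorem wpf_ldBuf (hL : Large M W σ d) (hc : Ctx σ d s) {r q : ℕ} {p : Fin d} (b : Fin 2)
    (hq : s.reg q = p) (h : Q (s.setReg r (s.get (Loc.buf b p : Loc σ d)))) :
    wpf M W (ldBuf r b q) s Q := by
  obtain ⟨h1, h2, h3⟩ := bufE_spec hL hc b hq
  refine ⟨⟨h1, h3⟩, ?_⟩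
  rw [Expr.eval, h2]; exact h

theorem wpf_stBuf (hL : Large M W σ d) (hc : Ctx σ d s) {q : ℕ} {e : Expr} {p : Fin d} (b : Fin 2)
    (hq : s.reg q = p) (he : e.Safe M W s)
    (h : Q (s.put (Loc.buf b p : Loc σ d) (e.eval s))) :
    wpf M W (stBuf b q e) s Q := by
  obtain ⟨h1, h2, h3⟩ := bufE_spec hL hc b hq
  refine ⟨h1, he, h3, ?_⟩
  rw [h2]; exact h

theorem wpf_ldPos [NeZero d] (hL : Large M W σ d) (hc : Ctx σ d s) {r : ℕ} {e : Expr}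
    (hr : r ≠ 0) (h6 : s.reg 6 < d) (he : e.Safe M W s) (hk : e.eval s ≤ d)
    (h : Q (s.setReg r (Fin.ofNat d (s.reg 6 + e.eval s)))) :
    wpf M W (ldPos r e) s Q := by
  have h4 := hL.two_lt
  set a := s.reg 6 + e.eval s with ha
  -- Reduction modulo `d` without division: since `a < 2 * d`, at most one subtraction of `d` is
  -- needed, and the truncated expression 1 - (d - a) is the indicator of d ≤ a.
  have hind : d * (1 - (d - a)) = if d ≤ a then d else 0 := by
    split_ifs with h
    · rw [Nat.sub_eq_zero_of_le h]; simp
    · rw [Nat.sub_eq_zero_of_le (show 1 ≤ d - a by omega)]; simp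
  have hmod : a - d * (1 - (d - a)) = a % d := by
    rw [hind]
    split_ifs with h
    · rw [Nat.mod_eq_sub_mod h, Nat.mod_eq_of_lt (by omega)]
    · rw [Nat.mod_eq_of_lt (by omega)]; rfl
  have h00 : (s.setReg r a).reg 0 = d := by
    rw [State.reg_setReg, if_neg (Ne.symm hr)]; exact hc.r0
  have h0r : (s.setReg r a).reg r = a := by simp [State.reg_setReg]
  refine ⟨⟨trivial, he, ?_⟩, ⟨trivial, ⟨trivial, ⟨?_, trivial, trivial⟩, ?_⟩⟩, ?_⟩
  · change a < W; omega
  · change 1 < W; omega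
  · change (s.setReg r a).reg 0 * (1 - ((s.setReg r a).reg 0 - (s.setReg r a).reg r)) < W
    rw [h00, h0r, hind]
    split_ifs <;> omega
  · change Q ((s.setReg r a).setReg r ((s.setReg r a).reg r - (s.setReg r a).reg 0 *
      (1 - ((s.setReg r a).reg 0 - (s.setReg r a).reg r))))
    rw [h00, h0r, hmod, State.setReg_setReg]
    exact h

end Layout

/-! ### Nodes -/

namespace ENode

variable {α : Type*}

noncomputable instance : DecidableEq (ENode α) := Classical.decEq _

/-- The node belongs to the tree of the palindromes in `P`. -/
def In (P : Finset (List α)) : ENode α → Prop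
  | negOne => True
  | word p => p ∈ P

/-- The length of the node plus one. -/
def size : ENode α → ℕ
  | negOne => 0
  | word p => p.length + 1

/-- The suffix link. -/
def lk [DecidableEq α] : ENode α → ENode α
  | negOne => negOne
  | word [] => negOne
  | word (_ :: p) => word (lps p)

theorem lk_word [DecidableEq α] {p : List α} (h : p ≠ []) : (word p).lk = word (lps p.tail) := by
  cases p with
  | nil => exact absurd rfl h
  | cons a p => rfl

theorem wrap_ne_nil (u : ENode α) (c : α) : u.wrap c ≠ [] := by
  cases u <;> simp [wrap]

theorem length_wrap (u : ENode α) (c : α) : (u.wrap c).length = u.size + 1 := by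
  cases u <;> simp [wrap, size]

/-- Every nonempty palindrome has exactly one parent and one label, so writing one cell of a child
or mark array affects one word only. -/
theorem wrap_inj {u u' : ENode α} {c c' : α} (h : u.wrap c = u'.wrap c') : u = u' ∧ c = c' := by
  cases u <;> cases u' <;> simp_all [wrap]

theorem exists_wrap {p : List α} (hp : p.Palindrome) (hn : p ≠ []) :
    ∃ (u : ENode α) (c : α), p = u.wrap c ∧ u.str.Palindrome := by
  cases hp with
  | nil => exact absurd rfl hn
  | singleton c => exact ⟨negOne, c, rfl, .nil⟩
  | @cons_concat c l hl => exact ⟨word l, c, rfl, hl⟩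

theorem str_infix_wrap (u : ENode α) (c : α) : u.str <:+: u.wrap c := by
  cases u with
  | negOne => simp [str]
  | word p => exact ⟨[c], [c], by simp [str, wrap]⟩

theorem palindrome_wrap_iff {u : ENode α} {c : α} : (u.wrap c).Palindrome ↔ u.str.Palindrome := by
  constructor
  · intro h
    obtain ⟨u', c', h1, h2⟩ := exists_wrap h (wrap_ne_nil u c)
    rw [(wrap_inj h1).1]; exact h2
  · intro h
    cases u with
    | negOne => exact .singleton c
    | word p => exact .cons_concat c h

theorem in_insert [DecidableEq α] {P : Finset (List α)} {v : List α} {u : ENode α} :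
    u.In (insert v P) ↔ u = word v ∨ u.In P := by
  cases u <;> simp [In]

end ENode

/-- Properties of the set of all palindromic substrings. -/
structure Closed {α : Type*} [DecidableEq α] (P : Finset (List α)) : Prop where
  nil_mem : [] ∈ P
  lps_mem : ∀ p ∈ P, lps p.tail ∈ P
  wrap_mem : ∀ (u : ENode α) (c : α), u.wrap c ∈ P → u.In P

theorem closed_palsF {α : Type*} [DecidableEq α] (x : List α) : Closed (palsF x) where
  nil_mem := nil_mem_palsF x
  lps_mem _ := lps_tail_mem_palsF
  wrap_mem u c h := by
    cases u with
    | negOne => trivial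
    | word p =>
      exact palsF_of_infix h (ENode.palindrome_wrap_iff.1 (mem_palsF.1 h).1)
        (ENode.str_infix_wrap (.word p) c)

theorem Closed.lk_in {α : Type*} [DecidableEq α] {P : Finset (List α)} (h : Closed P)
    {u : ENode α} (hu : u.In P) : u.lk.In P := by
  cases u with
  | negOne => trivial
  | word p =>
    cases p with
    | nil => trivial
    | cons a p => exact h.lps_mem _ hu

/-! ### The tree in memory -/

section Tree

variable {σ d : ℕ}

/-- The list of free nodes, linked by the fields of the suffix links. -/
def FreeChain (s : State) : List (Fin (d + 2)) → ℕ → Prop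
  -- The end of the list carries no marker; a node is taken only when counting shows that the list
  -- is nonempty.
  | [], _ => True
  | k :: l, h => h = nodeAddr σ k ∧ FreeChain s l (s.get (Loc.fld k 1 : Loc σ d))

/-- The memory holds the tree of the palindromes in `P`, with counters `cnt`. -/
structure TreeInv (s : State) (P : Finset (List (Fin σ))) (slot : ENode (Fin σ) → Fin (d + 2))
    (free : List (Fin (d + 2))) (cnt : List (Fin σ) → ℕ) : Prop where
  inj : ∀ u v : ENode (Fin σ), u.In P → v.In P → slot u = slot v → u = v
  fresh : ∀ k ∈ free, ∀ u : ENode (Fin σ), u.In P → slot u ≠ k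
  nodup : free.Nodup
  -- Of the d + 2 node objects one is always taken by the (-1)-node, which is not a member of `P`.
  card : free.length + P.card = d + 1
  chain : FreeChain (σ := σ) s free (s.reg 8)
  reg3 : s.reg 3 = nodeAddr σ (slot .negOne)
  reg4 : s.reg 4 = nodeAddr σ (slot (.word []))
  len : ∀ u : ENode (Fin σ), u.In P → s.get (Loc.fld (slot u) 0 : Loc σ d) = u.size
  link : ∀ u : ENode (Fin σ), u.In P →
    s.get (Loc.fld (slot u) 1 : Loc σ d) = nodeAddr σ (slot u.lk)
  child : ∀ u : ENode (Fin σ), u.In P → ∀ c, s.get (Loc.child (slot u) c : Loc σ d) =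
    if u.wrap c ∈ P then nodeAddr σ (slot (.word (u.wrap c))) else 0
  -- The marks are the complement of the child pointers; this is all that is needed to represent the
  -- minimal absent palindromic words.
  mark : ∀ u : ENode (Fin σ), u.In P → ∀ c, s.get (Loc.mark (slot u) c : Loc σ d) =
    if u.wrap c ∈ P then 0 else 1
  parent : ∀ (u : ENode (Fin σ)) (c : Fin σ), u.wrap c ∈ P →
    s.get (Loc.fld (slot (.word (u.wrap c))) 2 : Loc σ d) = nodeAddr σ (slot u)
  label : ∀ (u : ENode (Fin σ)) (c : Fin σ), u.wrap c ∈ P →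
    s.get (Loc.fld (slot (.word (u.wrap c))) 3 : Loc σ d) = c
  count : ∀ p ∈ P, s.get (Loc.fld (slot (.word p)) 4 : Loc σ d) = cnt p
  -- Free nodes keep their arrays in the state of a node without children, so taking one costs O(1)
  -- and not O(σ).
  freeChild : ∀ k ∈ free, ∀ c, s.get (Loc.child k c : Loc σ d) = 0
  freeMark : ∀ k ∈ free, ∀ c, s.get (Loc.mark k c : Loc σ d) = 1

theorem FreeChain.congr {s s' : State} : ∀ {l : List (Fin (d + 2))} {h : ℕ},
    FreeChain (σ := σ) s l h →
    (∀ k ∈ l, s'.get (Loc.fld k 1 : Loc σ d) = s.get (Loc.fld k 1 : Loc σ d)) →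
    FreeChain (σ := σ) s' l h
  | [], _, _, _ => trivial
  | k :: l, _, hc, hs => by
    refine ⟨hc.1, ?_⟩
    rw [hs k (by simp)]
    exact hc.2.congr fun k' hk' => hs k' (by simp [hk'])

variable {s s' : State} {P : Finset (List (Fin σ))} {slot : ENode (Fin σ) → Fin (d + 2)}
  {free : List (Fin (d + 2))} {cnt cnt' : List (Fin σ) → ℕ}

/-- The tree only depends on some cells and registers. -/
theorem TreeInv.congr (h : TreeInv s P slot free cnt) (h3 : s'.reg 3 = s.reg 3)
    (h4 : s'.reg 4 = s.reg 4) (h8 : s'.reg 8 = s.reg 8)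
    (hc : ∀ k c, s'.get (Loc.child k c : Loc σ d) = s.get (Loc.child k c : Loc σ d))
    (hm : ∀ k c, s'.get (Loc.mark k c : Loc σ d) = s.get (Loc.mark k c : Loc σ d))
    (hf : ∀ k n, n ≠ 4 → s'.get (Loc.fld k n : Loc σ d) = s.get (Loc.fld k n : Loc σ d))
    (hn : ∀ p ∈ P, s'.get (Loc.fld (slot (.word p)) 4 : Loc σ d) = cnt' p) :
    TreeInv s' P slot free cnt' where
  inj := h.inj
  fresh := h.fresh
  nodup := h.nodup
  card := h.card
  chain := by rw [h8]; exact h.chain.congr fun k _ => hf k 1 (by decide)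
  reg3 := by rw [h3, h.reg3]
  reg4 := by rw [h4, h.reg4]
  len u hu := by rw [hf _ _ (by decide), h.len u hu]
  link u hu := by rw [hf _ _ (by decide), h.link u hu]
  child u hu c := by rw [hc, h.child u hu]
  mark u hu c := by rw [hm, h.mark u hu]
  parent u c hu := by rw [hf _ _ (by decide), h.parent u c hu]
  label u c hu := by rw [hf _ _ (by decide), h.label u c hu]
  count := hn
  freeChild k hk c := by rw [hc, h.freeChild k hk]
  freeMark k hk c := by rw [hm, h.freeMark k hk]

/-- The buffers hold the string `x` and the recorded occurrences `pre`, starting at `off`. -/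
structure BufInv (s : State) (x : List (Fin σ)) (pre : ℕ → List (Fin σ))
    (slot : ENode (Fin σ) → Fin (d + 2)) (off : ℕ) [NeZero d] : Prop where
  le : x.length ≤ d
  chr : ∀ k (hk : k < x.length), s.get (Loc.buf 0 (Fin.ofNat d (off + k)) : Loc σ d) = x[k]
  occ : ∀ k < x.length, s.get (Loc.buf 1 (Fin.ofNat d (off + k)) : Loc σ d) =
    nodeAddr σ (slot (.word (pre k)))

theorem ofNat_add_inj [NeZero d] {off k l : ℕ} (hk : k < d) (hl : l < d)
    (h : Fin.ofNat d (off + k) = Fin.ofNat d (off + l)) : k = l := by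
  have h1 := congrArg Fin.val h
  simp only [Fin.ofNat] at h1
  have h2 : k ≡ l [MOD d] := Nat.ModEq.add_left_cancel' off h1
  rwa [Nat.ModEq, Nat.mod_eq_of_lt hk, Nat.mod_eq_of_lt hl] at h2

theorem BufInv.congr [NeZero d] {x : List (Fin σ)} {pre : ℕ → List (Fin σ)}
    {slot' : ENode (Fin σ) → Fin (d + 2)} {off off' : ℕ}
    (h : BufInv s x pre slot off) (ho : off' % d = off % d)
    (hs : ∀ k < x.length, slot' (.word (pre k)) = slot (.word (pre k)))
    (hb : ∀ b p, s'.get (Loc.buf b p : Loc σ d) = s.get (Loc.buf b p : Loc σ d)) :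
    BufInv s' x pre slot' off' := by
  have he : ∀ k, Fin.ofNat d (off' + k) = Fin.ofNat d (off + k) := fun k => by
    apply Fin.ext
    change (off' + k) % d = (off + k) % d
    rw [Nat.add_mod, ho, ← Nat.add_mod]
  exact ⟨h.le, fun k hk => by rw [hb, he, h.chr k hk], fun k hk => by
    rw [hb, he, h.occ k hk, hs k hk]⟩

end Tree

/-! ### Inserting a node, removing a node, recording an occurrence -/

section Operations

variable {σ d M W : ℕ} {s : State} {P : Finset (List (Fin σ))}
  {slot : ENode (Fin σ) → Fin (d + 2)} {free : List (Fin (d + 2))} {cnt cnt' : List (Fin σ) → ℕ}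
  {Q : State → Prop}

theorem wpf_seq {p q : Prog} (h : wpf M W p s (fun s' => wpf M W q s' Q)) :
    wpf M W (.seq p q) s Q := h

theorem wpf_assign {r : ℕ} {e : Expr} (he : e.Safe M W s) (h : Q (s.setReg r (e.eval s))) :
    wpf M W (.assign r e) s Q := ⟨he, h⟩

theorem Large.three_lt (hL : Large M W σ d) : 3 < W := by have := hL.two_lt; omega

/-- A new node becomes the child, along the character in register 2, of the node in register 12;
its suffix link is in register 18. The new node is put into register 5. -/
def insertNode : Prog :=
  .seq (.assign 16 (.reg 8)) <|
  .seq (ldFld 8 16 1) <|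
  .seq (ldFld 13 12 0) <|
  .seq (stFld 16 0 (.add (.reg 13) (.const 2))) <|
  .seq (stFld 16 1 (.reg 18)) <|
  .seq (stFld 16 2 (.reg 12)) <|
  .seq (stFld 16 3 (.reg 2)) <|
  .seq (stFld 16 4 (.const 0)) <|
  .seq (stChild 12 2 (.reg 16)) <|
  .seq (stMark 12 2 (.const 0)) <|
  .seq (ldFld 13 18 4) <|
  .seq (stFld 18 4 (.add (.reg 13) (.const 1))) <|
  .assign 5 (.reg 16)

theorem wpf_insertNode (hL : Large M W σ d) (hc : Ctx σ d s) {a : Fin σ} {k ku kl : Fin (d + 2)}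
    (hk : s.reg 8 = nodeAddr σ k) (hu : s.reg 12 = nodeAddr σ ku) (hl : s.reg 18 = nodeAddr σ kl)
    (ha : s.reg 2 = a) (hkl : kl ≠ k)
    (hlen : s.get (Loc.fld ku 0 : Loc σ d) + 2 < W) (hcnt : s.get (Loc.fld kl 4 : Loc σ d) + 1 < W)
    (hQ : ∀ s' : State,
      (∀ r, r ≠ 5 → r ≠ 8 → r ≠ 13 → r ≠ 16 → s'.reg r = s.reg r) →
      s'.reg 5 = nodeAddr σ k → s'.reg 8 = s.get (Loc.fld k 1 : Loc σ d) →
      (∀ l : Loc σ d, s'.get l =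
        if l = .fld kl 4 then s.get (Loc.fld kl 4 : Loc σ d) + 1
        else if l = .mark ku a then 0
        else if l = .child ku a then nodeAddr σ k
        else if l = .fld k 4 then 0
        else if l = .fld k 3 then (a : ℕ)
        else if l = .fld k 2 then nodeAddr σ ku
        else if l = .fld k 1 then nodeAddr σ kl
        else if l = .fld k 0 then s.get (Loc.fld ku 0 : Loc σ d) + 2
        else s.get l) → Q s') :
    wpf M W insertNode s Q := by
  have h3 := hL.three_lt
  refine wpf_seq (wpf_assign trivial ?_)
  refine wpf_seq (wpf_ldFld hL (hc.setReg _) (k := k) 1 (by simp [State.reg_setReg, Expr.eval, hk]) ?_)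
  refine wpf_seq (wpf_ldFld hL ((hc.setReg _).setReg _) (k := ku) 0
    (by simp [State.reg_setReg, hu]) ?_)
  have hc' := (((hc.setReg (r := 16) (nodeAddr σ k)).setReg (r := 8)
    (s.get (Loc.fld k 1 : Loc σ d))).setReg (r := 13) (s.get (Loc.fld ku 0 : Loc σ d)))
  simp only [State.get_setReg, Expr.eval, hk]
  set s1 := ((s.setReg 16 (nodeAddr σ k)).setReg 8 (s.get (Loc.fld k 1 : Loc σ d))).setReg 13
    (s.get (Loc.fld ku 0 : Loc σ d)) with hs1
  have e16 : s1.reg 16 = nodeAddr σ k := by simp [hs1, State.reg_setReg]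
  have e13 : s1.reg 13 = s.get (Loc.fld ku 0 : Loc σ d) := by simp [hs1, State.reg_setReg]
  have e12 : s1.reg 12 = nodeAddr σ ku := by simp [hs1, State.reg_setReg, hu]
  have e18 : s1.reg 18 = nodeAddr σ kl := by simp [hs1, State.reg_setReg, hl]
  have e2 : s1.reg 2 = a := by simp [hs1, State.reg_setReg, ha]
  refine wpf_seq (wpf_stFld hL hc' 0 e16 ⟨trivial, by simp only [Expr.Safe]; omega, by
    simp only [Expr.eval, e13]; omega⟩ ?_)
  have hc1 := fun (l : Loc σ d) v => hc'.put l v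
  refine wpf_seq (wpf_stFld hL (hc1 _ _) 1 e16 trivial ?_)
  refine wpf_seq (wpf_stFld hL ((hc1 _ _).put _ _) 2 e16 trivial ?_)
  refine wpf_seq (wpf_stFld hL (((hc1 _ _).put _ _).put _ _) 3 e16 trivial ?_)
  refine wpf_seq (wpf_stFld hL ((((hc1 _ _).put _ _).put _ _).put _ _) 4 e16
    (by simp only [Expr.Safe]; omega) ?_)
  refine wpf_seq (wpf_stChild hL e12 e2 trivial ?_)
  refine wpf_seq (wpf_stMark hL ((((((hc1 _ _).put _ _).put _ _).put _ _).put _ _).put _ _) e12 e2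
    (by simp only [Expr.Safe]; omega) ?_)
  refine wpf_seq (wpf_ldFld hL (((((((hc1 _ _).put _ _).put _ _).put _ _).put _ _).put _ _).put _ _)
    4 e18 ?_)
  simp only [Expr.eval, State.reg_put, e16, e13, e12, e18, e2]
  refine wpf_seq (wpf_stFld hL ((((((((hc1 _ _).put _ _).put _ _).put _ _).put _ _).put _ _).put
    _ _).setReg _) (k := kl) 4 (by simp [State.reg_setReg, e18]) ⟨trivial, by
      simp only [Expr.Safe]; omega, ?_⟩ ?_)
  · simp [Expr.eval, State.reg_setReg, State.get_put, hkl]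
    simpa [hs1] using hcnt
  refine wpf_assign trivial (hQ _ ?_ ?_ ?_ ?_)
  · intro r h5 h8 h13 h16
    simp [State.reg_setReg, hs1, h5, h8, h13, h16]
  · simp [State.reg_setReg, Expr.eval, e16]
  · simp [State.reg_setReg, hs1]
  · intro l
    simp [State.reg_setReg, State.get_put, Expr.eval, hkl, hs1]

/-- The new word is not in `P`, so by closure it has no child in the enlarged set, and the arrays of
the free node are already correct. Besides the fields of the node itself, only its entry in the
arrays of its parent and the counter of its suffix link change. -/
theorem TreeInv.insert_node {k : Fin (d + 2)} (h : TreeInv s P slot (k :: free) cnt) (hP : Closed P)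
    {u : ENode (Fin σ)} {c : Fin σ} {s' : State} (hu : u.In P) (hv : u.wrap c ∉ P)
    (hlk : lps (u.wrap c).tail ∈ P)
    (hreg : ∀ r, r ≠ 5 → r ≠ 8 → r ≠ 13 → r ≠ 16 → s'.reg r = s.reg r)
    (h8 : s'.reg 8 = s.get (Loc.fld k 1 : Loc σ d))
    (hget : ∀ l : Loc σ d, s'.get l =
        if l = .fld (slot (.word (lps (u.wrap c).tail))) 4 then
          s.get (Loc.fld (slot (.word (lps (u.wrap c).tail))) 4 : Loc σ d) + 1
        else if l = .mark (slot u) c then 0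
        else if l = .child (slot u) c then nodeAddr σ k
        else if l = .fld k 4 then 0
        else if l = .fld k 3 then (c : ℕ)
        else if l = .fld k 2 then nodeAddr σ (slot u)
        else if l = .fld k 1 then nodeAddr σ (slot (.word (lps (u.wrap c).tail)))
        else if l = .fld k 0 then s.get (Loc.fld (slot u) 0 : Loc σ d) + 2
        else s.get l)
    (hcv : cnt' (u.wrap c) = 0)
    (hcp : ∀ p ∈ P, cnt' p = cnt p + if lps (u.wrap c).tail = p then 1 else 0) :
    TreeInv s' (insert (u.wrap c) P) (Function.update slot (.word (u.wrap c)) k) free cnt' := by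
  set v := u.wrap c with hvd
  have hvn : v ≠ [] := ENode.wrap_ne_nil u c
  have hne : ∀ u' : ENode (Fin σ), u'.In P → u' ≠ .word v := by
    rintro u' hu' rfl; exact hv hu'
  have hsl : ∀ u' : ENode (Fin σ), u'.In P →
      Function.update slot (.word v) k u' = slot u' := fun u' hu' =>
    Function.update_of_ne (hne u' hu') _ _
  have hsk : ∀ u' : ENode (Fin σ), u'.In P → slot u' ≠ k := h.fresh k (by simp)
  have hsi : ∀ u₁ u₂ : ENode (Fin σ), u₁.In P → u₂.In P → (slot u₁ = slot u₂ ↔ u₁ = u₂) :=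
    fun u₁ u₂ h₁ h₂ => ⟨h.inj u₁ u₂ h₁ h₂, fun e => e ▸ rfl⟩
  have hnd := List.nodup_cons.1 h.nodup
  have hkf : ∀ k' ∈ free, k' ≠ k := by rintro k' hk' rfl; exact hnd.1 hk'
  have hlkin : (ENode.word (lps v.tail)).In P := hlk
  have hlf : ∀ k' ∈ free, slot (.word (lps v.tail)) ≠ k' := fun k' hk' =>
    h.fresh k' (by simp [hk']) _ hlkin
  have huf : ∀ k' ∈ free, slot u ≠ k' := fun k' hk' => h.fresh k' (by simp [hk']) _ hu
  have hwk : ∀ (u' : ENode (Fin σ)) (c' : Fin σ), u'.wrap c' ∈ insert v P → u'.In P := by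
    intro u' c' hw
    rcases Finset.mem_insert.1 hw with hw | hw
    · rw [(ENode.wrap_inj hw).1]; exact hu
    · exact hP.wrap_mem _ _ hw
  refine ⟨?_, ?_, hnd.2, ?_, ?_, ?_, ?_, ?_, ?_, ?_, ?_, ?_, ?_, ?_, ?_, ?_⟩
  · intro u₁ u₂ h₁ h₂ he
    rw [ENode.in_insert] at h₁ h₂
    rcases h₁ with rfl | h₁ <;> rcases h₂ with rfl | h₂
    · rfl
    · rw [Function.update_self, hsl _ h₂] at he; exact absurd he.symm (hsk _ h₂)
    · rw [Function.update_self, hsl _ h₁] at he; exact absurd he (hsk _ h₁)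
    · rw [hsl _ h₁, hsl _ h₂] at he; exact h.inj _ _ h₁ h₂ he
  · intro k' hk' u' hu'
    rw [ENode.in_insert] at hu'
    rcases hu' with rfl | hu'
    · rw [Function.update_self]; exact (hkf k' hk').symm
    · rw [hsl _ hu']; exact h.fresh k' (by simp [hk']) _ hu'
  · rw [Finset.card_insert_of_notMem hv]
    have := h.card
    simp at this; omega
  · rw [h8]
    refine h.chain.2.congr fun k' hk' => ?_
    rw [hget]
    simp [hkf k' hk']
  · rw [hreg 3 (by decide) (by decide) (by decide) (by decide), hsl .negOne trivial, h.reg3]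
  · rw [hreg 4 (by decide) (by decide) (by decide) (by decide), hsl (.word []) hP.nil_mem, h.reg4]
  · intro u' hu'
    rw [ENode.in_insert] at hu'
    rcases hu' with rfl | hu'
    · rw [Function.update_self, hget]
      simp [h.len u hu, ENode.size, hvd, ENode.length_wrap]
    · rw [hsl _ hu', hget]
      simp [hsk _ hu', h.len u' hu']
  · intro u' hu'
    rw [ENode.in_insert] at hu'
    rcases hu' with rfl | hu'
    · rw [Function.update_self, hget, ENode.lk_word hvn, hsl _ hlkin]
      simp
    · rw [hsl _ hu', hsl _ (hP.lk_in hu'), hget]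
      simp [hsk _ hu', h.link u' hu']
  · intro u' hu' c'
    rw [ENode.in_insert] at hu'
    rcases hu' with rfl | hu'
    · have : ¬ (ENode.word v).wrap c' ∈ insert v P := fun hw => hne _ (hwk _ _ hw) rfl
      rw [Function.update_self, hget, if_neg this]
      simp [(hsk u hu).symm, h.freeChild k (by simp)]
    · rw [hsl _ hu', hget]
      by_cases he : u' = u ∧ c' = c
      · obtain ⟨rfl, rfl⟩ := he
        simp [← hvd]
      · have h1 : u'.wrap c' ≠ v := fun hw => he (ENode.wrap_inj hw)
        have h2 : ¬ (slot u' = slot u ∧ c' = c) := by rwa [hsi _ _ hu' hu]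
        simp only [reduceCtorEq, if_false, Loc.child.injEq, h2, h.child u' hu' c',
          Finset.mem_insert, h1, false_or]
        by_cases hw : u'.wrap c' ∈ P
        · rw [if_pos hw, if_pos hw, hsl (.word (u'.wrap c')) hw]
        · rw [if_neg hw, if_neg hw]
  · intro u' hu' c'
    rw [ENode.in_insert] at hu'
    rcases hu' with rfl | hu'
    · have : ¬ (ENode.word v).wrap c' ∈ insert v P := fun hw => hne _ (hwk _ _ hw) rfl
      rw [Function.update_self, hget, if_neg this]
      simp [(hsk u hu).symm, h.freeMark k (by simp)]
    · rw [hsl _ hu', hget]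
      by_cases he : u' = u ∧ c' = c
      · obtain ⟨rfl, rfl⟩ := he
        simp [← hvd]
      · have h1 : u'.wrap c' ≠ v := fun hw => he (ENode.wrap_inj hw)
        have h2 : ¬ (slot u' = slot u ∧ c' = c) := by rwa [hsi _ _ hu' hu]
        simp only [reduceCtorEq, if_false, Loc.mark.injEq, h2, h.mark u' hu' c',
          Finset.mem_insert, h1, false_or]
  · intro u' c' hw
    rw [hsl u' (hwk _ _ hw)]
    rcases Finset.mem_insert.1 hw with hw | hw
    · obtain ⟨rfl, rfl⟩ := ENode.wrap_inj hw
      rw [← hvd, Function.update_self, hget]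
      simp
    · rw [hsl _ (show (ENode.word (u'.wrap c')).In P from hw), hget]
      simp [hsk (.word (u'.wrap c')) hw, h.parent u' c' hw]
  · intro u' c' hw
    rcases Finset.mem_insert.1 hw with hw | hw
    · obtain ⟨rfl, rfl⟩ := ENode.wrap_inj hw
      rw [← hvd, Function.update_self, hget]
      simp
    · rw [hsl _ (show (ENode.word (u'.wrap c')).In P from hw), hget]
      simp [hsk (.word (u'.wrap c')) hw, h.label u' c' hw]
  · intro p hp
    rcases Finset.mem_insert.1 hp with rfl | hp
    · rw [Function.update_self, hget, hcv]
      simp [(hsk _ hlkin).symm]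
    · rw [hsl _ (show (ENode.word p).In P from hp), hget, hcp p hp]
      have h1 := hsi (.word p) (.word (lps v.tail)) hp hlkin
      by_cases he : lps v.tail = p
      · subst he; simp [h.count _ hp]
      · have h2 : slot (.word p) ≠ slot (.word (lps v.tail)) := fun h3 =>
          he (ENode.word.inj (h1.1 h3)).symm
        simp [h2, he, hsk (.word p) hp, h.count _ hp]
  · intro k' hk' c'
    rw [hget]
    simp [(huf k' hk').symm, h.freeChild k' (by simp [hk'])]
  · intro k' hk' c'
    rw [hget]
    simp [(huf k' hk').symm, h.freeMark k' (by simp [hk'])]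

/-- The leaf in register 10 is removed; its suffix link is in register 11. -/
def removeNode : Prog :=
  .seq (ldFld 14 10 2) <|
  .seq (ldFld 15 10 3) <|
  .seq (stChild 14 15 (.const 0)) <|
  .seq (stMark 14 15 (.const 1)) <|
  .seq (ldFld 16 11 4) <|
  .seq (stFld 11 4 (.sub (.reg 16) (.const 1))) <|
  .seq (stFld 10 1 (.reg 8)) <|
  .assign 8 (.reg 10)

theorem wpf_removeNode (hL : Large M W σ d) (hc : Ctx σ d s) {a : Fin σ} {k ku kl : Fin (d + 2)}
    (hk : s.reg 10 = nodeAddr σ k) (hl : s.reg 11 = nodeAddr σ kl)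
    (hu : s.get (Loc.fld k 2 : Loc σ d) = nodeAddr σ ku) (ha : s.get (Loc.fld k 3 : Loc σ d) = a)
    (hQ : ∀ s' : State,
      (∀ r, r ≠ 8 → r ≠ 14 → r ≠ 15 → r ≠ 16 → s'.reg r = s.reg r) →
      s'.reg 8 = nodeAddr σ k →
      (∀ l : Loc σ d, s'.get l =
        if l = .fld k 1 then s.reg 8
        else if l = .fld kl 4 then s.get (Loc.fld kl 4 : Loc σ d) - 1
        else if l = .mark ku a then 1
        else if l = .child ku a then 0
        else s.get l) → Q s') :
    wpf M W removeNode s Q := by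
  have h3 := hL.three_lt
  refine wpf_seq (wpf_ldFld hL hc 2 hk ?_)
  refine wpf_seq (wpf_ldFld hL (hc.setReg _) (k := k) 3 (by simp [State.reg_setReg, hk]) ?_)
  simp only [State.get_setReg, hu, ha]
  have hc1 := (hc.setReg (r := 14) (nodeAddr σ ku)).setReg (r := 15) (a : ℕ)
  refine wpf_seq (wpf_stChild hL (k := ku) (a := a) (by simp [State.reg_setReg])
    (by simp [State.reg_setReg]) (by simp only [Expr.Safe]; omega) ?_)
  refine wpf_seq (wpf_stMark hL (hc1.put _ _) (k := ku) (a := a) (by simp [State.reg_setReg])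
    (by simp [State.reg_setReg]) (by simp only [Expr.Safe]; omega) ?_)
  refine wpf_seq (wpf_ldFld hL ((hc1.put _ _).put _ _) (k := kl) 4
    (by simp [State.reg_setReg, hl]) ?_)
  refine wpf_seq (wpf_stFld hL (((hc1.put _ _).put _ _).setReg _) (k := kl) 4
    (by simp [State.reg_setReg, hl]) ⟨trivial, by simp only [Expr.Safe]; omega⟩ ?_)
  refine wpf_seq (wpf_stFld hL ((((hc1.put _ _).put _ _).setReg _).put _ _) (k := k) 1
    (by simp [State.reg_setReg, hk]) trivial ?_)
  refine wpf_assign trivial (hQ _ ?_ ?_ ?_)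
  · intro r h8 h14 h15 h16
    simp [State.reg_setReg, h8, h14, h15, h16]
  · simp [State.reg_setReg, Expr.eval, hk]
  · intro l
    simp [State.reg_setReg, State.get_put, Expr.eval]

/-- By `hleaf` and `hlink` no remaining parent pointer or suffix link refers to the node, so
unlinking it from its parent suffices; being a leaf, it also has exactly the arrays required of a
free node. -/
theorem TreeInv.erase_node (h : TreeInv s P slot free cnt) (hP : Closed P)
    {u : ENode (Fin σ)} {c : Fin σ} {s' : State} (hv : u.wrap c ∈ P)
    (hleaf : ∀ c', (ENode.word (u.wrap c)).wrap c' ∉ P)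
    (hlink : ∀ q ∈ P, q ≠ [] → lps q.tail ≠ u.wrap c)
    (hreg : ∀ r, r ≠ 8 → r ≠ 14 → r ≠ 15 → r ≠ 16 → s'.reg r = s.reg r)
    (h8 : s'.reg 8 = nodeAddr σ (slot (.word (u.wrap c))))
    (hget : ∀ l : Loc σ d, s'.get l =
        if l = .fld (slot (.word (u.wrap c))) 1 then s.reg 8
        else if l = .fld (slot (.word (lps (u.wrap c).tail))) 4 then
          s.get (Loc.fld (slot (.word (lps (u.wrap c).tail))) 4 : Loc σ d) - 1
        else if l = .mark (slot u) c then 1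
        else if l = .child (slot u) c then 0
        else s.get l)
    (hcp : ∀ p ∈ P, p ≠ u.wrap c → cnt p = cnt' p + if lps (u.wrap c).tail = p then 1 else 0) :
    TreeInv s' (P.erase (u.wrap c)) slot (slot (.word (u.wrap c)) :: free) cnt' := by
  set v := u.wrap c with hvd
  have hvn : v ≠ [] := ENode.wrap_ne_nil u c
  have hu : u.In P := hP.wrap_mem _ _ hv
  have hE : ∀ u' : ENode (Fin σ), u'.In (P.erase v) ↔ u' ≠ .word v ∧ u'.In P := by
    intro u'; cases u' <;> simp [ENode.In]
  have hsi : ∀ u₁ u₂ : ENode (Fin σ), u₁.In P → u₂.In P → (slot u₁ = slot u₂ ↔ u₁ = u₂) :=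
    fun u₁ u₂ h₁ h₂ => ⟨h.inj u₁ u₂ h₁ h₂, fun e => e ▸ rfl⟩
  have hvin : (ENode.word v).In P := hv
  have hlkin : (ENode.word (lps v.tail)).In P := hP.lps_mem _ hv
  have huv : u ≠ .word v := by
    intro he
    have h1 : v.length = u.size + 1 := ENode.length_wrap u c
    have h2 : u.size = v.length + 1 := by rw [he]; rfl
    omega
  have hvf : ∀ k ∈ free, slot (.word v) ≠ k := fun k hk => h.fresh k hk _ hvin
  have huf : ∀ k ∈ free, slot u ≠ k := fun k hk => h.fresh k hk _ hu
  have hnv : ∀ u' : ENode (Fin σ), u'.In (P.erase v) → slot u' ≠ slot (.word v) := by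
    intro u' hu' he
    rw [hE] at hu'
    exact hu'.1 (h.inj _ _ hu'.2 hvin he)
  refine ⟨?_, ?_, ?_, ?_, ?_, ?_, ?_, ?_, ?_, ?_, ?_, ?_, ?_, ?_, ?_, ?_⟩
  · intro u₁ u₂ h₁ h₂
    rw [hE] at h₁ h₂
    exact h.inj _ _ h₁.2 h₂.2
  · intro k hk u' hu'
    rcases List.mem_cons.1 hk with rfl | hk
    · exact hnv u' hu'
    · exact h.fresh k hk _ ((hE u').1 hu').2
  · exact List.nodup_cons.2 ⟨fun hk => hvf _ hk rfl, h.nodup⟩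
  · have h1 := Finset.card_pos.2 ⟨v, hv⟩
    have h2 := h.card
    rw [Finset.card_erase_of_mem hv, List.length_cons]; omega
  · refine ⟨h8, ?_⟩
    rw [hget, if_pos rfl]
    refine h.chain.congr fun k hk => ?_
    rw [hget]
    simp [(hvf k hk).symm]
  · rw [hreg 3 (by decide) (by decide) (by decide) (by decide), h.reg3]
  · rw [hreg 4 (by decide) (by decide) (by decide) (by decide), h.reg4]
  · intro u' hu'
    rw [hget]
    simp [h.len u' ((hE u').1 hu').2]
  · intro u' hu'
    rw [hget]
    simp [h.link u' ((hE u').1 hu').2, hnv u' hu']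
  · intro u' hu' c'
    have hu2 := ((hE u').1 hu').2
    rw [hget]
    by_cases he : u' = u ∧ c' = c
    · obtain ⟨rfl, rfl⟩ := he
      simp [← hvd]
    · have h1 : u'.wrap c' ≠ v := fun hw => he (ENode.wrap_inj hw)
      have h2 : ¬ (slot u' = slot u ∧ c' = c) := by rwa [hsi _ _ hu2 hu]
      simp [h2, h1, h.child u' hu2 c']
  · intro u' hu' c'
    have hu2 := ((hE u').1 hu').2
    rw [hget]
    by_cases he : u' = u ∧ c' = c
    · obtain ⟨rfl, rfl⟩ := he
      simp [← hvd]
    · have h1 : u'.wrap c' ≠ v := fun hw => he (ENode.wrap_inj hw)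
      have h2 : ¬ (slot u' = slot u ∧ c' = c) := by rwa [hsi _ _ hu2 hu]
      simp [h2, h1, h.mark u' hu2 c']
  · intro u' c' hw
    rw [hget]
    simp [h.parent u' c' (Finset.mem_of_mem_erase hw)]
  · intro u' c' hw
    rw [hget]
    simp [h.label u' c' (Finset.mem_of_mem_erase hw)]
  · intro p hp
    have hpv := Finset.ne_of_mem_erase hp
    have hpP := Finset.mem_of_mem_erase hp
    have h1 := hsi (.word p) (.word (lps v.tail)) hpP hlkin
    have h2 := hcp p hpP hpv
    rw [hget]
    by_cases he : lps v.tail = p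
    · rw [if_pos he] at h2
      subst he
      simp [h.count _ hpP]; omega
    · have h3 : slot (.word p) ≠ slot (.word (lps v.tail)) := fun h3 =>
        he (ENode.word.inj (h1.1 h3)).symm
      rw [if_neg he] at h2
      simp [h3, h.count _ hpP]; omega
  · intro k hk c'
    rw [hget]
    rcases List.mem_cons.1 hk with rfl | hk
    · have h1 : slot (.word v) ≠ slot u := fun he => huv ((hsi _ _ hvin hu).1 he).symm
      simp [h1, h.child _ hvin c', hleaf c']
    · simp [(huf k hk).symm, h.freeChild k hk]
  · intro k hk c'
    rw [hget]
    rcases List.mem_cons.1 hk with rfl | hk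
    · have h1 : slot (.word v) ≠ slot u := fun he => huv ((hsi _ _ hvin hu).1 he).symm
      simp [h1, h.mark _ hvin c', hleaf c']
    · simp [(huf k hk).symm, h.freeMark k hk]

/-- The node in register `q` is recorded at the position whose cell number is in register `p`. -/
def setPre (p q : ℕ) : Prog :=
  .seq (ldBuf 17 1 p) <|
  .seq (ldFld 18 17 4) <|
  .seq (stFld 17 4 (.sub (.reg 18) (.const 1))) <|
  .seq (ldFld 18 q 4) <|
  .seq (stFld q 4 (.add (.reg 18) (.const 1))) <|
  stBuf 1 p (.reg q)

/-- The old and the new entry may be the same node. Its counter is then first lowered and afterwards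
raised, which is what the inner case distinction describes. -/
theorem wpf_setPre (hL : Large M W σ d) (hc : Ctx σ d s) {p q : ℕ} {k kw : Fin (d + 2)}
    {b : Fin d} (hp : p ≠ 17 ∧ p ≠ 18) (hq : q ≠ 17 ∧ q ≠ 18)
    (hb : s.reg p = b) (hk : s.reg q = nodeAddr σ k)
    (hw : s.get (Loc.buf 1 b : Loc σ d) = nodeAddr σ kw)
    (hcnt : s.get (Loc.fld k 4 : Loc σ d) + 1 < W)
    (hQ : ∀ s' : State, (∀ r, r ≠ 17 → r ≠ 18 → s'.reg r = s.reg r) →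
      (∀ l : Loc σ d, s'.get l =
        if l = .buf 1 b then nodeAddr σ k
        else if l = .fld k 4 then
          (if k = kw then s.get (Loc.fld k 4 : Loc σ d) - 1 else s.get (Loc.fld k 4 : Loc σ d)) + 1
        else if l = .fld kw 4 then s.get (Loc.fld kw 4 : Loc σ d) - 1
        else s.get l) → Q s') :
    wpf M W (setPre p q) s Q := by
  have h3 := hL.three_lt
  refine wpf_seq (wpf_ldBuf hL hc 1 hb ?_)
  rw [hw]
  refine wpf_seq (wpf_ldFld hL (hc.setReg _) (k := kw) 4 (by simp [State.reg_setReg]) ?_)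
  have hc1 := (hc.setReg (r := 17) (nodeAddr σ kw)).setReg (r := 18)
    (s.get (Loc.fld kw 4 : Loc σ d))
  refine wpf_seq (wpf_stFld hL hc1 (k := kw) 4 (by simp [State.reg_setReg])
    ⟨trivial, by simp only [Expr.Safe]; omega⟩ ?_)
  refine wpf_seq (wpf_ldFld hL (hc1.put _ _) (k := k) 4 (by simp [State.reg_setReg, hq, hk]) ?_)
  simp only [State.get_setReg, State.get_put, Expr.eval, Loc.fld.injEq, and_true]
  refine wpf_seq (wpf_stFld hL ((hc1.put _ _).setReg _) (k := k) 4
    (by simp [State.reg_setReg, hq, hk]) ⟨trivial, by simp only [Expr.Safe]; omega, ?_⟩ ?_)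
  · simp only [Expr.eval, State.reg_setReg, if_true]
    split_ifs with he
    · subst he; omega
    · exact hcnt
  refine wpf_stBuf hL (((hc1.put _ _).setReg _).put _ _) (p := b) 1
    (by simp [State.reg_setReg, hp, hb]) trivial (hQ _ ?_ ?_)
  · intro r h17 h18
    simp [State.reg_setReg, h17, h18]
  · intro l
    simp only [State.reg_setReg, State.get_put, Expr.eval, State.reg_put, State.get_setReg,
      if_true, hq.1, hq.2, if_false, hk]
    by_cases he : k = kw
    · subst he; simp
    · simp [he]

theorem occCount_update {n k : ℕ} (hk : k < n) (pre : ℕ → List (Fin σ)) (v p : List (Fin σ)) :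
    occCount n (Function.update pre k v) p + (if pre k = p then 1 else 0) =
      occCount n pre p + if v = p then 1 else 0 := by
  have h : ∀ f : ℕ → List (Fin σ), occCount n f p =
      (((Finset.range n).erase k).filter (fun i => f i = p)).card + if f k = p then 1 else 0 := by
    intro f
    unfold occCount
    conv_lhs => rw [← Finset.insert_erase (Finset.mem_range.2 hk), Finset.filter_insert]
    split_ifs with h
    · rw [Finset.card_insert_of_notMem (by simp)]
    · rfl
  rw [h, h pre, Function.update_self, Finset.filter_congr (q := fun i => pre i = p)]
  · omega
  · intro i hi
    rw [Function.update_of_ne (Finset.ne_of_mem_erase hi)]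

/-- Recording an occurrence. -/
theorem wpf_setPre_inv [NeZero d] (hL : Large M W σ d) (hc : Ctx σ d s)
    {x : List (Fin σ)} {pre : ℕ → List (Fin σ)} {off j p q : ℕ} {v : List (Fin σ)}
    (hp : p ≠ 17 ∧ p ≠ 18) (hq : q ≠ 17 ∧ q ≠ 18)
    (hT : TreeInv s P slot free (fun w => occCount x.length pre w + linkCount P w))
    (hB : BufInv s x pre slot off) (hj : j < x.length) (hv : v ∈ P) (hw : pre j ∈ P)
    (hpj : s.reg p = Fin.ofNat d (off + j)) (hqv : s.reg q = nodeAddr σ (slot (.word v)))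
    (hcnt : occCount x.length pre v + linkCount P v + 1 < W)
    (hQ : ∀ s' : State, (∀ r, r ≠ 17 → r ≠ 18 → s'.reg r = s.reg r) →
      TreeInv s' P slot free
        (fun w => occCount x.length (Function.update pre j v) w + linkCount P w) →
      BufInv s' x (Function.update pre j v) slot off → Q s') :
    wpf M W (setPre p q) s Q := by
  have hinj : ∀ p q : List (Fin σ), p ∈ P → q ∈ P →
      (slot (.word p) = slot (.word q) ↔ p = q) := fun p q h₁ h₂ =>
    ⟨fun e => ENode.word.inj (hT.inj (.word p) (.word q) h₁ h₂ e), fun e => e ▸ rfl⟩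
  refine wpf_setPre hL hc hp hq hpj hqv (hB.occ j hj) (by rw [hT.count v hv]; exact hcnt) ?_
  intro s' hreg hget
  refine hQ s' hreg ?_ ?_
  · refine hT.congr (hreg 3 (by decide) (by decide)) (hreg 4 (by decide) (by decide))
      (hreg 8 (by decide) (by decide)) ?_ ?_ ?_ ?_
    · intro k c; rw [hget]; simp
    · intro k c; rw [hget]; simp
    · intro k n hn; rw [hget]; simp [hn]
    · intro w hwP
      have hu := occCount_update hj pre v w
      -- The counter of the old entry is positive, so the truncated subtraction is exact.
      have hpos : pre j = w → 0 < occCount x.length pre w := fun h =>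
        Finset.card_pos.2 ⟨j, by simp [hj, h]⟩
      rw [hget, hT.count v hv, hT.count _ hw]
      simp only [reduceCtorEq, if_false, Loc.fld.injEq, and_true, hinj _ _ hwP hv,
        hinj _ _ hwP hw, hinj _ _ hv hw, hT.count w hwP]
      by_cases h1 : w = v
      · subst h1
        by_cases h2 : w = pre j
        · rw [← h2] at hu hpos
          have := hpos rfl
          simp [← h2] at hu ⊢; omega
        · simp [h2, Ne.symm h2] at hu ⊢; omega
      · by_cases h2 : w = pre j
        · subst h2
          have := hpos rfl
          simp [h1, Ne.symm h1] at hu ⊢; omega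
        · simp [h1, h2, Ne.symm h1, Ne.symm h2] at hu ⊢; omega
  · refine ⟨hB.le, ?_, ?_⟩
    · intro k hk; rw [hget]; simpa only [reduceCtorEq, if_false, Loc.buf.injEq, zero_ne_one, false_and] using hB.chr k hk
    · intro k hk
      have hle := hB.le
      rw [hget]
      by_cases h : k = j
      · subst h; simp
      · have : Fin.ofNat d (off + k) ≠ Fin.ofNat d (off + j) := fun he =>
          h (ofNat_add_inj (by omega) (by omega) he)
        simp only [Loc.buf.injEq, true_and, this, if_false, reduceCtorEq,
          Function.update_of_ne h]
        exact hB.occ k hk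

end Operations

/-! ### Palindromic suffixes after appending a character -/

section Matching

variable {α : Type*} {x : List α} {c : α}

/-- The node is the `-1`-node or the node of a palindromic suffix of `x`. -/
def IsSuf (x : List α) : ENode α → Prop
  | .negOne => True
  | .word p => p.Palindrome ∧ p <:+ x

theorem IsSuf.str_palindrome {u : ENode α} (h : IsSuf x u) : u.str.Palindrome := by
  cases u with
  | negOne => exact .nil
  | word p => exact h.1

/-- The index is the place just before the suffix. For the (-1)-node, of size 0, it is the place of
the new letter itself, so the test succeeds and the search must stop there. If the suffix is all of
`x` the truncated index is 0, and the size condition rejects it. -/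
theorem wrap_suffix_iff {u : ENode α} (h : IsSuf x u) : u.wrap c <:+ x ++ [c] ↔
    u.size ≤ x.length ∧ (x ++ [c])[x.length - u.size]? = some c := by
  cases u with
  | negOne => simp [ENode.wrap, ENode.size]
  | word p =>
    obtain ⟨y, rfl⟩ := h.2
    have h1 : (ENode.word p).wrap c = [c] ++ p ++ [c] := by simp [ENode.wrap]
    rw [h1, List.suffix_append_self_iff, List.suffix_append_self_iff,
      List.singleton_suffix_iff_getLast?_eq_some, List.getLast?_eq_getElem?]
    simp only [ENode.size, List.length_append]
    rcases Nat.eq_zero_or_pos y.length with h0 | h0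
    · rw [List.length_eq_zero_iff.1 h0]; simp
    · rw [show y.length + p.length - (p.length + 1) = y.length - 1 by omega, List.append_assoc,
        List.getElem?_append_left (by omega)]
      exact ⟨fun h => ⟨by omega, h⟩, fun h => h.2⟩

theorem IsSuf.eq_of_size {u u' : ENode α} (h : IsSuf x u) (h' : IsSuf x u')
    (hs : u.size = u'.size) : u = u' := by
  cases u with
  | negOne => cases u' with
    | negOne => rfl
    | word q => simp [ENode.size] at hs
  | word p => cases u' with
    | negOne => simp [ENode.size] at hs
    | word q =>
      simp only [ENode.size, Nat.add_right_cancel_iff] at hs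
      rw [(List.suffix_of_suffix_length_le h.2 h'.2 hs.le).eq_of_length hs]

/-- Stripping the outer letters of a palindromic suffix of `x ++ [c]` leaves a palindromic suffix of
`x`, or the (-1)-node for a single letter. Hence all candidates lie on one chain of suffix links. -/
theorem exists_isSuf {q : List α} (hq : q.Palindrome) (hs : q <:+ x ++ [c]) (hn : q ≠ []) :
    ∃ u, q = u.wrap c ∧ IsSuf x u := by
  obtain ⟨u, c', rfl, hu⟩ := ENode.exists_wrap hq hn
  cases u with
  | negOne =>
    rw [ENode.wrap, List.singleton_suffix_append_singleton_iff] at hs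
    exact ⟨.negOne, by rw [hs], trivial⟩
  | word p =>
    have h1 : (ENode.word p).wrap c' = c' :: p ++ [c'] := by simp [ENode.wrap]
    rw [h1] at hs
    have h2 : [c'] <:+ x ++ [c] := (List.suffix_append _ _).trans hs
    rw [List.singleton_suffix_append_singleton_iff] at h2
    subst h2
    rw [List.suffix_append_self_iff] at hs
    exact ⟨.word p, rfl, hu, (List.suffix_cons _ _).trans hs⟩

variable [DecidableEq α]

theorem IsSuf.lk {u : ENode α} (h : IsSuf x u) : IsSuf x u.lk := by
  cases u with
  | negOne => trivial
  | word p =>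
    cases p with
    | nil => trivial
    | cons a p =>
      exact ⟨palindrome_lps p, (lps_suffix p).trans ((List.suffix_cons a p).trans h.2)⟩

theorem ENode.size_lk_lt {u : ENode α} (h : u ≠ .negOne) : u.lk.size < u.size := by
  cases u with
  | negOne => exact absurd rfl h
  | word p =>
    cases p with
    | nil => simp [lk, size]
    | cons a p => have := length_lps_le p; simp [lk, size]; omega

theorem ENode.size_lk_le (u : ENode α) : u.lk.size ≤ u.size := by
  by_cases h : u = .negOne
  · subst h; simp [lk]
  · exact (size_lk_lt h).le

/-- Palindromic suffixes are nested, so a shorter one is a palindromic proper suffix of the longer: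
following links skips none. -/
theorem IsSuf.size_le_lk {u u' : ENode α} (h : IsSuf x u) (h' : IsSuf x u')
    (hs : u'.size < u.size) : u'.size ≤ u.lk.size := by
  cases u with
  | negOne => simp [ENode.size] at hs
  | word p =>
    cases u' with
    | negOne => simp [ENode.size]
    | word q =>
      simp only [ENode.size] at hs
      have hn : p ≠ [] := by rintro rfl; simp at hs
      have h1 := List.suffix_of_suffix_length_le h'.2 h.2 (by omega)
      have h2 := (lps_max h'.1 (h1.of_length_lt (by omega))).length_le
      rw [ENode.lk_word hn]
      simpa [ENode.size] using h2

theorem isSuf_lps (x : List α) : IsSuf x (.word (lps x)) := ⟨palindrome_lps x, lps_suffix x⟩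

theorem IsSuf.size_le_lps {u : ENode α} (h : IsSuf x u) : u.size ≤ (lps x).length + 1 := by
  cases u with
  | negOne => simp [ENode.size]
  | word p => have := (lps_max h.1 h.2).length_le; simpa [ENode.size] using this

/-- Palindromic suffixes of `x ++ [c]` shorter than `n` have at most the length of `u.wrap c`. -/
def Bounds (x : List α) (c : α) (n : ℕ) (u : ENode α) : Prop :=
  ∀ q : List α, q.Palindrome → q <:+ x ++ [c] → q.length < n → q.length ≤ u.size + 1

/-- Start of the first search. The limit |x| + 2 exceeds every suffix length of `x ++ [c]`, so it
excludes nothing. -/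
theorem bounds_lps : Bounds x c (x.length + 2) (.word (lps x)) := by
  intro q hq hs _
  rcases eq_or_ne q [] with rfl | hn
  · simp
  · obtain ⟨u, rfl, hu⟩ := exists_isSuf hq hs hn
    rw [ENode.length_wrap]
    have := hu.size_le_lps
    change _ ≤ (lps x).length + 1 + 1
    omega

/-- Start of the second search. The limit is the length of `u.wrap c`, so exactly the candidates for
its suffix link remain. -/
theorem bounds_lk {u : ENode α} (h : IsSuf x u) : Bounds x c (u.size + 1) u.lk := by
  intro q hq hs hl
  rcases eq_or_ne q [] with rfl | hn
  · simp
  · obtain ⟨u', rfl, hu'⟩ := exists_isSuf hq hs hn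
    rw [ENode.length_wrap] at hl ⊢
    have := h.size_le_lk hu' (by omega)
    omega

/-- A palindromic suffix that attained the bound would have to be `u.wrap c`, which the mismatch
rules out; what remains is shorter, and no palindromic suffix lies between `u` and its link. -/
theorem Bounds.lk {n : ℕ} {u : ENode α} (hb : Bounds x c n u) (h : IsSuf x u)
    (hm : ¬ u.wrap c <:+ x ++ [c]) : Bounds x c n u.lk := by
  intro q hq hs hl
  refine bounds_lk h q hq hs (lt_of_le_of_ne (hb q hq hs hl) ?_)
  intro he
  rcases eq_or_ne q [] with rfl | hn
  · simp at he
  · obtain ⟨u', rfl, hu'⟩ := exists_isSuf hq hs hn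
    rw [ENode.length_wrap] at he
    rw [hu'.eq_of_size h (by omega)] at hs
    exact hm hs

theorem wrap_eq_lps {u : ENode α} (h : IsSuf x u) (hm : u.wrap c <:+ x ++ [c])
    (hb : Bounds x c (x.length + 2) u) : u.wrap c = lps (x ++ [c]) := by
  refine eq_lps (ENode.palindrome_wrap_iff.2 h.str_palindrome) hm fun q hq hs => ?_
  rw [ENode.length_wrap]
  exact hb q hq hs (by have := hs.length_le; simp at this; omega)

theorem wrap_eq_lps_tail {u u' : ENode α} (h : IsSuf x u) (hm : u.wrap c <:+ x ++ [c])
    (hb : Bounds x c (u'.size + 1) u) (hl : u.size < u'.size) (hm' : u'.wrap c <:+ x ++ [c]) :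
    u.wrap c = lps (u'.wrap c).tail := by
  refine eq_lps (ENode.palindrome_wrap_iff.2 h.str_palindrome) ?_ fun q hq hs => ?_
  · refine (List.suffix_of_suffix_length_le hm hm' ?_).of_length_lt ?_ <;>
      simp only [ENode.length_wrap] <;> omega
  · rw [ENode.length_wrap]
    refine hb q hq (hs.trans ((List.tail_suffix _).trans hm')) ?_
    have := hs.length_le
    rw [List.length_tail, ENode.length_wrap] at this
    omega

/-- The potential that pays for the steps along suffix links. -/
def potential (x : List α) : ℕ := (lps x).length + (lps (lps x).tail).length

/-- The second search starts at the link of `u`. Either `u` is the longest palindromic suffix of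
`x`, or it is no longer than that one's link; in both cases the start is paid for by the second
summand of the old potential. The second inequality says that the search can lengthen this summand
by a bounded amount only. -/
theorem potential_concat {u : ENode α} (h : IsSuf x u) (hu : u.wrap c = lps (x ++ [c])) :
    u.lk.size ≤ (lps (lps x).tail).length + 1 ∧
      (lps (u.wrap c).tail).length ≤ u.lk.size + 1 := by
  constructor
  · have h1 : (ENode.word (lps x)).lk.size ≤ (lps (lps x).tail).length + 1 := by
      rcases eq_or_ne (lps x) [] with h0 | h0
      · rw [h0]; simp [ENode.lk, ENode.size]
      · rw [ENode.lk_word h0]; simp [ENode.size]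
    have h2 := h.size_le_lps
    rcases h2.lt_or_eq with h3 | h3
    · have h4 := (isSuf_lps x).size_le_lk h (by simpa [ENode.size] using h3)
      have := u.size_lk_le
      omega
    · have h4 : u = .word (lps x) := h.eq_of_size (isSuf_lps x) (by simpa [ENode.size] using h3)
      rw [h4]; exact h1
  · refine bounds_lk (c := c) h _ (palindrome_lps _) ?_ ?_
    · rw [hu]; exact (lps_tail_suffix _).trans (lps_suffix _)
    · have := lps_tail_length_lt (ENode.wrap_ne_nil u c)
      rwa [ENode.length_wrap] at this

end Matching

/-! ### The invariant -/

section Invariant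

variable {σ d M W : ℕ}

/-- The memory holds the tree of the palindromes in `P` and the buffers for the string `x`. -/
structure Core [NeZero d] (s : State) (P : Finset (List (Fin σ))) (x : List (Fin σ))
    (pre : ℕ → List (Fin σ)) (slot : ENode (Fin σ) → Fin (d + 2)) (free : List (Fin (d + 2)))
    (off : ℕ) : Prop where
  ctx : Ctx σ d s
  tree : TreeInv s P slot free (fun w => occCount x.length pre w + linkCount P w)
  buf : BufInv s x pre slot off

variable [NeZero d] {s s' : State} {P : Finset (List (Fin σ))} {x : List (Fin σ)}
    {pre : ℕ → List (Fin σ)} {slot : ENode (Fin σ) → Fin (d + 2)} {free : List (Fin (d + 2))}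
    {off : ℕ} {Q : State → Prop}

theorem Core.of_mem (h : Core s P x pre slot free off) (hm : s'.mem = s.mem)
    (hr : ∀ r ∈ [0, 1, 3, 4, 8, 9], s'.reg r = s.reg r) : Core s' P x pre slot free off where
  ctx := ⟨by rw [hr 0 (by simp), h.ctx.r0], by rw [hr 1 (by simp), h.ctx.r1],
    by rw [hr 9 (by simp), h.ctx.r9]⟩
  tree := by
    have hg : ∀ l : Loc σ d, s'.get l = s.get l := fun l => by unfold State.get; rw [hm]
    exact h.tree.congr (hr 3 (by simp)) (hr 4 (by simp)) (hr 8 (by simp)) (fun _ _ => hg _)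
      (fun _ _ => hg _) (fun _ _ _ => hg _) fun p hp => by rw [hg, h.tree.count p hp]
  buf := h.buf.congr rfl (fun _ _ => rfl) fun b p => by unfold State.get; rw [hm]

theorem Core.setReg (h : Core s P x pre slot free off) {r : ℕ} (v : ℕ)
    (hr : r ∉ [0, 1, 3, 4, 8, 9] := by decide) : Core (s.setReg r v) P x pre slot free off := by
  refine h.of_mem rfl fun r' hr' => ?_
  rw [State.reg_setReg, if_neg]
  rintro rfl; exact hr hr'

theorem Core.count_lt (hL : Large M W σ d) (h : Core s P x pre slot free off)
    (w : List (Fin σ)) : occCount x.length pre w + linkCount P w + 1 < W := by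
  have h1 : occCount x.length pre w ≤ x.length :=
    (Finset.card_filter_le _ _).trans (by simp)
  have h2 : linkCount P w ≤ P.card := Finset.card_filter_le _ _
  have h3 := h.tree.card
  have h4 := h.buf.le
  have h5 := hL.two_lt
  omega

/-- The memory holds the data structure for the window `x`. -/
def Inv (d : ℕ) [NeZero d] (s : State) (x : List (Fin σ)) : Prop :=
  ∃ (slot : ENode (Fin σ) → Fin (d + 2)) (free : List (Fin (d + 2))) (pre : ℕ → List (Fin σ)),
    Core s (palsF x) x pre slot free (s.reg 6) ∧ PreOk x pre ∧
    s.reg 6 < d ∧ s.reg 7 = x.length ∧ s.reg 5 = nodeAddr σ (slot (.word (lps x)))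

/-! ### Searching along suffix links -/

/-- Register 13 gets the size of the node in register `q`, and register 15 the character that
precedes the corresponding suffix. -/
def probe (q : ℕ) : Prog :=
  .seq (ldFld 13 q 0) <|
  .seq (ldPos 14 (.sub (.reg 7) (.reg 13))) <|
  ldBuf 15 0 14

/-- The suffix cannot be extended. -/
def mismatch : Cond := .not (.and (.not (.lt (.reg 7) (.reg 13))) (.eq (.reg 15) (.reg 2)))

/-- One step along the suffix link, followed by the next probe. -/
def findStep (q : ℕ) : Prog := .seq (ldFld q q 1) (probe q)

/-- Starting with the node in register `q`, follow suffix links until the suffix can be extended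
by the appended character. -/
def findLoop (q : ℕ) : Prog := .seq (probe q) (.while mismatch (findStep q))

/-- The time of one step along a suffix link. -/
def stepTime : ℕ := mismatch.cost + 1 + bnd (findStep 0)

/-- During the search the buffer already contains `x ++ [c]`, while register 7 still holds the
length of `x`. Thus the letter next to the candidate can always be loaded, even for the (-1)-node.
-/
theorem wpf_probe (hL : Large M W σ d) {c : Fin σ} {u : ENode (Fin σ)} {q : ℕ}
    (h : Core s P (x ++ [c]) pre slot free (s.reg 6)) (h6 : s.reg 6 < d)
    (h7 : s.reg 7 = x.length) (hq : s.reg q = nodeAddr σ (slot u)) (hu : u.In P)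
    (hQ : ∀ s' : State, s'.mem = s.mem → (∀ r, r ∉ [13, 14, 15] → s'.reg r = s.reg r) →
      s'.reg 13 = u.size →
      (∃ a : Fin σ, s'.reg 15 = a ∧ (x ++ [c])[x.length - u.size]? = some a) → Q s') :
    wpf M W (probe q) s Q := by
  have hd := h.buf.le
  simp only [List.length_append, List.length_singleton] at hd
  refine wpf_seq (wpf_ldFld hL h.ctx 0 hq ?_)
  rw [h.tree.len u hu]
  have h1 := h.setReg (r := 13) u.size
  have e : (Expr.sub (.reg 7) (.reg 13)).eval (s.setReg 13 u.size) = x.length - u.size := by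
    simp [Expr.eval, State.reg_setReg, h7]
  refine wpf_seq (wpf_ldPos hL h1.ctx (by decide) (by simpa [State.reg_setReg] using h6)
    ⟨trivial, trivial⟩ (by rw [e]; omega) ?_)
  rw [e]
  have h2 := h1.setReg (r := 14) (Fin.ofNat d ((s.setReg 13 u.size).reg 6 + (x.length - u.size)))
  have hlt : x.length - u.size < (x ++ [c]).length := by
    simp only [List.length_append, List.length_singleton]; omega
  refine wpf_ldBuf hL h2.ctx (p := Fin.ofNat d (s.reg 6 + (x.length - u.size))) 0
    (by simp [State.reg_setReg]) ?_
  rw [h2.buf.chr _ hlt]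
  refine hQ _ rfl ?_ ?_ ⟨(x ++ [c])[x.length - u.size], ?_, ?_⟩
  · intro r hr
    simp only [List.mem_cons, List.not_mem_nil, or_false, not_or] at hr
    simp [State.reg_setReg, hr]
  · simp [State.reg_setReg]
  · simp [State.reg_setReg]
  · exact List.getElem?_eq_getElem hlt

/-- The size of the current node is the variant. Since the result has length one more than the final
size, the number of tests is at most `u₀.size + 2 - z.length`. The parameters `n` and `z` cover both
searches: for the longest palindromic suffix and for its suffix link. -/
theorem wp_findLoop (hL : Large M W σ d) {c : Fin σ} {u₀ : ENode (Fin σ)} {n q : ℕ}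
    {z : List (Fin σ)} (hP : Closed P)
    (h : Core s P (x ++ [c]) pre slot free (s.reg 6)) (h6 : s.reg 6 < d)
    (h7 : s.reg 7 = x.length) (h2 : s.reg 2 = c)
    (hq' : q ∉ [0, 1, 2, 3, 4, 6, 7, 8, 9, 13, 14, 15])
    (hq : s.reg q = nodeAddr σ (slot u₀)) (hu₀ : u₀.In P)
    (hs₀ : IsSuf x u₀) (hb₀ : Bounds x c n u₀)
    (hz : ∀ u, IsSuf x u → u.wrap c <:+ x ++ [c] → Bounds x c n u → u.size ≤ u₀.size →
      u.wrap c = z)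
    (hQ : ∀ (s' : State) (u : ENode (Fin σ)), s'.mem = s.mem →
      (∀ r, r ∉ [13, 14, 15, q] → s'.reg r = s.reg r) → s'.reg q = nodeAddr σ (slot u) →
      u.In P → IsSuf x u → u.wrap c <:+ x ++ [c] → u.wrap c = z → Q s') :
    Wp M W (findLoop q) s (bnd (probe q) + stepTime * (u₀.size + 2 - z.length)) Q := by
  simp only [List.mem_cons, List.not_mem_nil, or_false, not_or] at hq'
  let I : ℕ → State → Prop := fun m s' => ∃ u : ENode (Fin σ), m = u.size ∧ s'.mem = s.mem ∧
    (∀ r, r ∉ [13, 14, 15, q] → s'.reg r = s.reg r) ∧ s'.reg q = nodeAddr σ (slot u) ∧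
    u.In P ∧ IsSuf x u ∧ Bounds x c n u ∧ u.size ≤ u₀.size ∧ s'.reg 13 = u.size ∧
    ∃ a : Fin σ, s'.reg 15 = a ∧ (x ++ [c])[x.length - u.size]? = some a
  have hcore : ∀ m s', I m s' → Core s' P (x ++ [c]) pre slot free (s'.reg 6) ∧
      s'.reg 6 < d ∧ s'.reg 7 = x.length ∧ s'.reg 2 = c := by
    rintro m s' ⟨u, -, hm, hr, -⟩
    rw [hr 6 (by simp; omega), hr 7 (by simp; omega), hr 2 (by simp; omega)]
    refine ⟨h.of_mem hm fun r hr' => hr r ?_, h6, h7, h2⟩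
    simp only [List.mem_cons, List.not_mem_nil, or_false, not_or] at hr' ⊢
    omega
  have hhold : ∀ m s', I m s' → (mismatch.Holds s' ↔
      ¬ ∀ u : ENode (Fin σ), s'.reg q = nodeAddr σ (slot u) → u.In P →
        u.wrap c <:+ x ++ [c]) := by
    rintro m s' hI
    obtain ⟨-, -, e7, e2⟩ := hcore m s' hI
    obtain ⟨u, -, hm, hr, hqu, huP, hsu, -, -, h13, a, h15, ha⟩ := hI
    have h3 : (∀ u : ENode (Fin σ), s'.reg q = nodeAddr σ (slot u) → u.In P →
        u.wrap c <:+ x ++ [c]) ↔ u.wrap c <:+ x ++ [c] := by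
      refine ⟨fun h3 => h3 u hqu huP, fun h3 u' hu' huP' => ?_⟩
      have h4 := h.tree.inj _ _ huP' huP (nodeAddr_inj (σ := σ) (by rw [← hu', hqu]))
      rw [h4]; exact h3
    rw [h3, wrap_suffix_iff hsu, ha]
    simp only [mismatch, Cond.Holds, Expr.eval, e7, e2, h13, h15, not_lt, Option.some.injEq,
      Fin.ext_iff]
  have hloop := Wp.while (M := M) (W := W) (b := mismatch) (p := findStep q) (N := bnd (findStep 0))
    (I := I) (fun m s' _ => ⟨⟨trivial, trivial⟩, trivial, trivial⟩) (by
      intro m s' hI hb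
      obtain ⟨hc', e6, e7, e2⟩ := hcore m s' hI
      rw [hhold m s' hI] at hb
      obtain ⟨u, rfl, hm, hr, hqu, huP, hsu, hbu, hle, h13, a, h15, ha⟩ := hI
      have hmm : ¬ u.wrap c <:+ x ++ [c] := by
        intro h3
        refine hb fun u' hu' huP' => ?_
        have h4 := h.tree.inj _ _ huP' huP (nodeAddr_inj (σ := σ) (by rw [← hu', hqu]))
        rw [h4]; exact h3
      -- The (-1)-node never mismatches, so each executed step strictly decreases the size.
      have hun : u ≠ .negOne := by
        rintro rfl
        exact hmm (by rw [wrap_suffix_iff hsu]; simp [ENode.size])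
      have hlt := ENode.size_lk_lt hun
      refine wpf.wp (p := findStep q) (wpf_seq (wpf_ldFld hL hc'.ctx 1 hqu ?_))
      rw [hc'.tree.link u huP]
      have hqn : q ∉ [0, 1, 3, 4, 8, 9] := by
        simp only [List.mem_cons, List.not_mem_nil, or_false, not_or]; omega
      have hc2 := hc'.setReg (nodeAddr σ (slot u.lk)) hqn
      have r6 : (s'.setReg q (nodeAddr σ (slot u.lk))).reg 6 = s'.reg 6 := by
        rw [State.reg_setReg, if_neg (by omega)]
      have r7 : (s'.setReg q (nodeAddr σ (slot u.lk))).reg 7 = s'.reg 7 := by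
        rw [State.reg_setReg, if_neg (by omega)]
      have rq : (s'.setReg q (nodeAddr σ (slot u.lk))).reg q = nodeAddr σ (slot u.lk) := by
        simp [State.reg_setReg]
      refine wpf_probe hL (by rw [r6]; exact hc2) (by rw [r6]; exact e6) (by rw [r7]; exact e7)
        rq (hP.lk_in huP) ?_
      intro s'' hm' hr' h13' h15'
      refine ⟨_, hlt, u.lk, rfl, hm'.trans hm, ?_, ?_, hP.lk_in huP, hsu.lk, hbu.lk hsu hmm,
        by omega, h13', h15'⟩
      · intro r hrn
        simp only [List.mem_cons, List.not_mem_nil, or_false, not_or] at hrn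
        rw [hr' r (by simp; omega), State.reg_setReg, if_neg (by omega), hr r (by simp; omega)]
      · rw [hr' q (by simp; omega), rq])
  refine Wp.seq (Wp.mono (wpf.wp (wpf_probe hL h h6 h7 hq hu₀
    (Q := fun s' => Wp M W (.while mismatch (findStep q)) s' _ Q) ?_)) le_rfl fun _ h => h)
  intro s1 hm1 hr1 h13 h15 hw
  obtain ⟨k, s2, m, hex, hw2, hI, hnb, hmle, hk⟩ := hloop u₀.size s1 ⟨u₀, rfl, hm1,
    (fun r hr => hr1 r (by
      simp only [List.mem_cons, List.not_mem_nil, or_false, not_or] at hr ⊢; omega)),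
    by rw [hr1 q (by simp; omega), hq], hu₀, hs₀, hb₀, le_rfl, h13, h15⟩ hw
  have hI' := hI
  obtain ⟨u, rfl, hm, hr, hqu, huP, hsu, hbu, hle, -⟩ := hI
  rw [hhold _ s2 hI', not_not] at hnb
  have hmu := hnb u hqu huP
  have hwz := hz u hsu hmu hbu hle
  refine ⟨k, s2, hex, ?_, hw2, hQ s2 u hm hr hqu huP hsu hmu hwz⟩
  have hzl : z.length = u.size + 1 := by rw [← hwz, ENode.length_wrap]
  rw [hzl, show u₀.size + 2 - (u.size + 1) = u₀.size - u.size + 1 by omega]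
  exact hk

end Invariant

/-! ### Appending a character -/

section Append

variable {σ d M W : ℕ} [NeZero d] {s : State} {x : List (Fin σ)} {c : Fin σ}
    {pre : ℕ → List (Fin σ)} {slot : ENode (Fin σ) → Fin (d + 2)} {free : List (Fin (d + 2))}
    {Q : State → Prop}

/-- The character in register 2 is written into the buffer; the current longest palindromic suffix
is copied to register 12. -/
def pushChar : Prog :=
  .seq (ldPos 10 (.reg 7)) <|
  .seq (stBuf 0 10 (.reg 2)) <|
  .seq (stBuf 1 10 (.reg 4)) <|
  .seq (ldFld 11 4 4) <|
  .seq (stFld 4 4 (.add (.reg 11) (.const 1))) <|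
  .assign 12 (.reg 5)

/-- Register 18 gets the suffix link of the new node below the node in register 12. -/
def findLink : Prog :=
  .seq (ldFld 13 12 0) <|
  .ite (.eq (.reg 13) (.const 0)) (.assign 18 (.reg 4)) <|
  .seq (ldFld 17 12 1) <|
  .seq (findLoop 17) <|
  ldChild 18 17 2

/-- The longest palindromic suffix, in register 5, is recorded. -/
def recordSuffix : Prog :=
  .seq (ldFld 13 5 0) <|
  .seq (ldPos 14 (.sub (.add (.reg 7) (.const 2)) (.reg 13))) <|
  .seq (setPre 14 5) <|
  .assign 7 (.add (.reg 7) (.const 1))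

/-- Register 5 gets the child of the node in register 12; it is created if necessary. -/
def descend : Prog :=
  .seq (ldChild 16 12 2) <|
  .ite (.eq (.reg 16) (.const 0)) (.seq findLink insertNode) (.assign 5 (.reg 16))

/-- Appending the character in register 2. -/
def appendProg : Prog := .seq pushChar <| .seq (findLoop 12) <| .seq descend recordSuffix

theorem occCount_succ_update (n : ℕ) (pre : ℕ → List (Fin σ)) (v w : List (Fin σ)) :
    occCount (n + 1) (Function.update pre n v) w = occCount n pre w + if v = w then 1 else 0 := by
  unfold occCount
  rw [Finset.range_add_one, Finset.filter_insert, Function.update_self,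
    Finset.filter_congr (q := fun i => pre i = w)]
  · split_ifs
    · rw [Finset.card_insert_of_notMem (by simp)]
    · rfl
  · intro i hi
    rw [Function.update_of_ne (Finset.mem_range.1 hi).ne]

/-- The new position first receives the empty palindrome as a placeholder, counted at the 0-node.
Every position then has an entry, and `setPre` can always replace an old one. -/
theorem wpf_pushChar (hL : Large M W σ d) (h : Core s (palsF x) x pre slot free (s.reg 6))
    (h6 : s.reg 6 < d) (h7 : s.reg 7 = x.length) (h2 : s.reg 2 = c) (hx : x.length + 1 ≤ d)
    (hQ : ∀ s' : State, (∀ r, r ∉ [10, 11, 12] → s'.reg r = s.reg r) → s'.reg 12 = s.reg 5 →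
      Core s' (palsF x) (x ++ [c]) (Function.update pre x.length []) slot free (s'.reg 6) →
      Q s') :
    wpf M W pushChar s Q := by
  have hw3 := hL.three_lt
  refine wpf_seq (wpf_ldPos hL h.ctx (by decide) h6 trivial
    (by simp only [Expr.eval, h7]; omega) ?_)
  simp only [Expr.eval, h7]
  set b := Fin.ofNat d (s.reg 6 + x.length) with hb
  have hc1 := h.ctx.setReg (r := 10) (b : ℕ)
  have hn : (ENode.word ([] : List (Fin σ))).In (palsF x) := nil_mem_palsF x
  have hcnt := h.count_lt hL []
  refine wpf_seq (wpf_stBuf hL hc1 (p := b) 0 (by simp [State.reg_setReg]) trivial ?_)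
  refine wpf_seq (wpf_stBuf hL (hc1.put _ _) (p := b) 1 (by simp [State.reg_setReg]) trivial ?_)
  refine wpf_seq (wpf_ldFld hL ((hc1.put _ _).put _ _) (k := slot (.word [])) 4
    (by simp [State.reg_setReg, h.tree.reg4]) ?_)
  simp only [State.get_setReg, State.get_put, Expr.eval, reduceCtorEq, if_false, h.tree.count [] hn]
  refine wpf_seq (wpf_stFld hL (((hc1.put _ _).put _ _).setReg _) (k := slot (.word [])) 4
    (by simp [State.reg_setReg, h.tree.reg4]) ⟨trivial, by simp only [Expr.Safe]; omega, by
      simpa [Expr.eval, State.reg_setReg] using hcnt⟩ ?_)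
  refine wpf_assign trivial (hQ _ ?_ ?_ ?_)
  · intro r hr
    simp only [List.mem_cons, List.not_mem_nil, or_false, not_or] at hr
    simp [State.reg_setReg, hr]
  · simp [State.reg_setReg, Expr.eval]
  · have hg : ∀ l : Loc σ d, ((((((s.setReg 10 b).put (Loc.buf 0 b : Loc σ d)
        ((s.setReg 10 b).reg 2)).put (Loc.buf 1 b : Loc σ d)
        (((s.setReg 10 b).put (Loc.buf 0 b : Loc σ d) ((s.setReg 10 b).reg 2)).reg 4)).setReg 11
        (occCount x.length pre [] + linkCount (palsF x) [])).put
        (Loc.fld (slot (.word [])) 4 : Loc σ d)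
        (((((s.setReg 10 b).put (Loc.buf 0 b : Loc σ d)
        ((s.setReg 10 b).reg 2)).put (Loc.buf 1 b : Loc σ d)
        (((s.setReg 10 b).put (Loc.buf 0 b : Loc σ d) ((s.setReg 10 b).reg 2)).reg 4)).setReg 11
        (occCount x.length pre [] + linkCount (palsF x) [])).reg 11 + 1))).get l =
        if l = .fld (slot (.word [])) 4 then occCount x.length pre [] + linkCount (palsF x) [] + 1
        else if l = .buf 1 b then nodeAddr σ (slot (.word []))
        else if l = .buf 0 b then (c : ℕ) else s.get l := by
      intro l
      simp only [State.reg_put, State.reg_setReg, State.get_put, State.get_setReg, h.tree.reg4, h2]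
      simp
    refine ⟨(((((hc1.put _ _).put _ _).setReg _).put _ _).setReg _), ?_, ?_⟩
    · refine h.tree.congr (by simp [State.reg_setReg]) (by simp [State.reg_setReg])
        (by simp [State.reg_setReg]) ?_ ?_ ?_ ?_
      · intro k a
        rw [State.get_setReg]; refine (hg _).trans ?_; simp
      · intro k a
        rw [State.get_setReg]; refine (hg _).trans ?_; simp
      · intro k n hn
        rw [State.get_setReg]; refine (hg _).trans ?_; simp [hn]
      · intro p hp
        rw [State.get_setReg]; refine (hg _).trans ?_
        rw [List.length_append, List.length_singleton, occCount_succ_update]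
        by_cases he : p = []
        · subst he; simp; omega
        · have : slot (.word p) ≠ slot (.word []) := fun hs =>
            he (ENode.word.inj (h.tree.inj (.word p) (.word []) hp hn hs))
          simp [this, Ne.symm he, h.tree.count p hp]
    · have hne : ∀ k < x.length, Fin.ofNat d (s.reg 6 + k) ≠ b := fun k hk he =>
        hk.ne (ofNat_add_inj (by omega) (by omega) he)
      have e6 : ∀ v v' v'' (l₁ l₂ l₃ : Loc σ d) (v₁ v₂ v₃ : ℕ),
          ((((((s.setReg 10 v).put l₁ v₁).put l₂ v₂).setReg 11 v').put l₃ v₃).setReg 12 v'').reg 6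
            = s.reg 6 := by
        intros; simp [State.reg_setReg]
      rw [e6]
      refine ⟨by simpa using hx, ?_, ?_⟩
      · intro k hk
        simp only [List.length_append, List.length_singleton] at hk
        rw [State.get_setReg]; refine (hg _).trans ?_
        rcases (show k < x.length ∨ k = x.length by omega) with hk | rfl
        · simp only [reduceCtorEq, if_false, Loc.buf.injEq, hne k hk, and_false,
            List.getElem_append_left hk]
          exact h.buf.chr k hk
        · rw [← hb]; simp
      · intro k hk
        simp only [List.length_append, List.length_singleton] at hk
        rw [State.get_setReg]; refine (hg _).trans ?_
        rcases (show k < x.length ∨ k = x.length by omega) with hk | rfl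
        · simp only [reduceCtorEq, if_false, Loc.buf.injEq, hne k hk, and_false,
            Function.update_of_ne hk.ne]
          exact h.buf.occ k hk
        · rw [← hb]; simp

/-- The time for `findLink` without the steps along suffix links. -/
def findLinkTime : ℕ := bnd (ldFld 13 12 0) + (Cond.eq (.reg 13) (.const 0)).cost + 1 +
  bnd (.assign 18 (.reg 4)) + bnd (ldFld 17 12 1) + bnd (probe 17) + bnd (ldChild 18 17 2)

theorem wp_findLink (hL : Large M W σ d)
    (h : Core s (palsF x) (x ++ [c]) pre slot free (s.reg 6)) (h6 : s.reg 6 < d)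
    (h7 : s.reg 7 = x.length) (h2 : s.reg 2 = c) {u : ENode (Fin σ)}
    (h12 : s.reg 12 = nodeAddr σ (slot u)) (hu : u.In (palsF x)) (hs : IsSuf x u)
    (hm : u.wrap c <:+ x ++ [c])
    (hQ : ∀ s' : State, s'.mem = s.mem → (∀ r, r ∉ [13, 14, 15, 17, 18] → s'.reg r = s.reg r) →
      lps (u.wrap c).tail ∈ palsF x →
      s'.reg 18 = nodeAddr σ (slot (.word (lps (u.wrap c).tail))) → Q s') :
    Wp M W findLink s
      (findLinkTime + stepTime * (u.lk.size + 2 - (lps (u.wrap c).tail).length)) Q := by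
  have hP := closed_palsF x
  refine Wp.mono (Wp.seq (N := bnd (ldFld 13 12 0)) (N' := (Cond.eq (.reg 13) (.const 0)).cost + 1 +
    (bnd (.assign 18 (.reg 4)) + (bnd (ldFld 17 12 1) + ((bnd (probe 17) +
      stepTime * (u.lk.size + 2 - (lps (u.wrap c).tail).length)) + bnd (ldChild 18 17 2)))))
    (Q := Q) (wpf.wp (wpf_ldFld hL h.ctx 0 h12 ?_)))
    (by unfold findLinkTime; omega) fun _ h => h
  rw [h.tree.len u hu]
  have h' := h.setReg (r := 13) u.size
  refine Wp.ite ⟨trivial, by have := hL.three_lt; simp only [Expr.Safe]; omega⟩ ?_ ?_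
  · intro hb
    have h0 : u.size = 0 := by simpa [Cond.Holds, Expr.eval, State.reg_setReg] using hb
    -- The new palindrome is a single letter, whose link is the 0-node. A search would fail here:
    -- the (-1)-node is its own link and would return the letter itself.
    have hun : u = .negOne := by cases u with
      | negOne => rfl
      | word p => simp [ENode.size] at h0
    have hl : lps (u.wrap c).tail = [] := by rw [hun]; rfl
    refine (wpf.wp (p := .assign 18 (.reg 4)) (wpf_assign
      (s := s.setReg 13 u.size) trivial (hQ _ rfl ?_ ?_ ?_))).mono
      (Nat.le_add_right _ _) fun _ h => h
    · intro r hr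
      simp only [List.mem_cons, List.not_mem_nil, or_false, not_or] at hr
      simp [State.reg_setReg, hr]
    · rw [hl]; exact nil_mem_palsF x
    · rw [hl]; simp [State.reg_setReg, Expr.eval, h.tree.reg4]
  · intro hb
    have h0 : u.size ≠ 0 := by simpa [Cond.Holds, Expr.eval, State.reg_setReg] using hb
    have hun : u ≠ .negOne := by rintro rfl; exact h0 rfl
    refine Wp.mono (Wp.seq (wpf.wp (wpf_ldFld hL h'.ctx (k := slot u) 1
      (by simp [State.reg_setReg, h12]) ?_))) (Nat.le_add_left _ _) fun _ h => h
    rw [h'.tree.link u hu]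
    have h'' := h'.setReg (r := 17) (nodeAddr σ (slot u.lk))
    refine Wp.seq (wp_findLoop hL (c := c) (u₀ := u.lk) (n := u.size + 1) hP
      (by simpa [State.reg_setReg] using h'') (by simpa [State.reg_setReg] using h6)
      (by simpa [State.reg_setReg] using h7) (by simpa [State.reg_setReg] using h2)
      (by decide) (by simp [State.reg_setReg]) (hP.lk_in hu) hs.lk (bounds_lk hs) ?_ ?_)
    · intro u' hs' hm' hb' hle
      exact wrap_eq_lps_tail hs' hm' hb' (hle.trans_lt (ENode.size_lk_lt hun)) hm
    · intro s' u' hmem hreg h17 hu' hs' hm' hz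
      have hc' : Core s' (palsF x) (x ++ [c]) pre slot free (s.reg 6) :=
        h''.of_mem hmem fun r hr => hreg r (by
          simp only [List.mem_cons, List.not_mem_nil, or_false] at hr ⊢; omega)
      -- The tree is still that of `x`, but the target is already in it: an append adds only the
      -- longest palindromic suffix, and the target is shorter than that.
      have hmemP : lps (u.wrap c).tail ∈ palsF x := by
        refine mem_palsF.2 ⟨palindrome_lps _, ?_⟩
        have h1 : u.wrap c ∈ palsF (x ++ [c]) := mem_palsF.2
          ⟨ENode.palindrome_wrap_iff.2 hs.str_palindrome, hm.isInfix⟩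
        have h2 := lps_tail_mem_palsF h1
        rw [palsF_concat, Finset.mem_insert] at h2
        rcases h2 with h2 | h2
        · have h3 := lps_max (ENode.palindrome_wrap_iff.2 hs.str_palindrome) hm
          have h4 := lps_tail_length_lt (ENode.wrap_ne_nil u c)
          rw [h2] at h4
          have := h3.length_le
          omega
        · exact (mem_palsF.1 h2).2
      refine wpf.wp (wpf_ldChild hL h17 (a := c)
        (by rw [hreg 2 (by decide)]; simpa [State.reg_setReg] using h2) (hQ _ ?_ ?_ hmemP ?_))
      · exact hmem
      · intro r hr
        simp only [List.mem_cons, List.not_mem_nil, or_false, not_or] at hr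
        rw [State.reg_setReg, if_neg (by omega), hreg r (by simp; omega)]
        simp [State.reg_setReg, hr]
      · rw [hc'.tree.child u' hu', hz, if_pos hmemP]
        simp [State.reg_setReg]

theorem linkCount_insert {P : Finset (List (Fin σ))} {v : List (Fin σ)} (hv : v ∉ P)
    (w : List (Fin σ)) :
    linkCount (insert v P) w = linkCount P w + if lps v.tail = w then 1 else 0 := by
  unfold linkCount
  rw [Finset.filter_insert]
  split_ifs
  · rw [Finset.card_insert_of_notMem (by simp [hv])]
  · rfl

theorem wpf_insertNode_inv (hL : Large M W σ d)
    (h : Core s (palsF x) (x ++ [c]) pre slot free (s.reg 6)) (h2 : s.reg 2 = c)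
    {u : ENode (Fin σ)}
    (h12 : s.reg 12 = nodeAddr σ (slot u)) (hu : u.In (palsF x))
    (hv : u.wrap c = lps (x ++ [c])) (hvn : u.wrap c ∉ palsF x)
    (hl : lps (u.wrap c).tail ∈ palsF x)
    (h18 : s.reg 18 = nodeAddr σ (slot (.word (lps (u.wrap c).tail))))
    (hpre : ∀ k < (x ++ [c]).length, pre k ∈ palsF x)
    (hQ : ∀ (s' : State) (slot' : ENode (Fin σ) → Fin (d + 2)) (free' : List (Fin (d + 2))),
      Core s' (palsF (x ++ [c])) (x ++ [c]) pre slot' free' (s'.reg 6) →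
      s'.reg 6 = s.reg 6 → s'.reg 7 = s.reg 7 →
      s'.reg 5 = nodeAddr σ (slot' (.word (lps (x ++ [c])))) → Q s') :
    wpf M W insertNode s Q := by
  have hd := h.buf.le
  have hcard := card_palsF_le x
  simp only [List.length_append, List.length_singleton] at hd
  -- A free node exists: `x` has at most |x| + 1 ≤ d palindromes, and these together with the free
  -- nodes number d + 1.
  obtain ⟨k, free, rfl⟩ : ∃ k l, free = k :: l := by
    cases free with
    | nil => have := h.tree.card; simp at this; omega
    | cons k l => exact ⟨k, l, rfl⟩
  have hsz : u.size ≤ x.length + 1 := by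
    have h1 : (u.wrap c).length ≤ (x ++ [c]).length := hv ▸ (lps_suffix _).length_le
    rw [ENode.length_wrap] at h1
    simp at h1; omega
  refine wpf_insertNode hL h.ctx h.tree.chain.1 h12 h18 h2 (h.tree.fresh k (by simp) _ hl)
    (by rw [h.tree.len u hu]; have := hL.two_lt; omega)
    (by rw [h.tree.count _ hl]; exact h.count_lt hL _) ?_
  intro s' hreg h5 h8 hget
  refine hQ s' (Function.update slot (.word (u.wrap c)) k) free ⟨⟨?_, ?_, ?_⟩, ?_, ?_⟩ ?_ ?_ ?_
  · rw [hreg 0 (by decide) (by decide) (by decide) (by decide), h.ctx.r0]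
  · rw [hreg 1 (by decide) (by decide) (by decide) (by decide), h.ctx.r1]
  · rw [hreg 9 (by decide) (by decide) (by decide) (by decide), h.ctx.r9]
  · rw [palsF_concat, ← hv]
    refine h.tree.insert_node (closed_palsF x) hu hvn hl hreg h8 hget ?_ ?_
    -- All recorded entries and all link targets are palindromes of `x`, so the counter of the new
    -- palindrome starts at 0.
    · have h0 : occCount (x ++ [c]).length pre (u.wrap c) = 0 := by
        refine Finset.card_eq_zero.2 (Finset.filter_eq_empty_iff.2 fun k hk he => hvn ?_)
        rw [← he]; exact hpre k (Finset.mem_range.1 hk)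
      have h1 : linkCount (palsF x) (u.wrap c) = 0 := by
        refine Finset.card_eq_zero.2 (Finset.filter_eq_empty_iff.2 fun q hq he => hvn ?_)
        rw [← he]; exact lps_tail_mem_palsF hq
      rw [h0, linkCount_insert hvn, h1, if_neg]
      intro he
      rw [he] at hl
      exact hvn hl
    · intro p _
      rw [linkCount_insert hvn]; omega
  · rw [hreg 6 (by decide) (by decide) (by decide) (by decide)]
    refine h.buf.congr rfl ?_ ?_
    · intro k' hk'
      rw [Function.update_of_ne]
      intro he
      exact hvn (ENode.word.inj he ▸ hpre k' hk')
    · intro b p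
      rw [hget]; simp
  · exact hreg 6 (by decide) (by decide) (by decide) (by decide)
  · exact hreg 7 (by decide) (by decide) (by decide) (by decide)
  · rw [← hv, Function.update_self, h5]

/-- The time for `descend` without the steps along suffix links. -/
def descendTime : ℕ := bnd (ldChild 16 12 2) + (Cond.eq (.reg 16) (.const 0)).cost + 1 +
  findLinkTime + bnd insertNode + bnd (.assign 5 (.reg 16))

theorem wp_descend (hL : Large M W σ d)
    (h : Core s (palsF x) (x ++ [c]) pre slot free (s.reg 6)) (h6 : s.reg 6 < d)
    (h7 : s.reg 7 = x.length) (h2 : s.reg 2 = c) {u : ENode (Fin σ)}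
    (h12 : s.reg 12 = nodeAddr σ (slot u)) (hu : u.In (palsF x)) (hs : IsSuf x u)
    (hv : u.wrap c = lps (x ++ [c])) (hpre : ∀ k < (x ++ [c]).length, pre k ∈ palsF x)
    (hQ : ∀ (s' : State) (slot' : ENode (Fin σ) → Fin (d + 2)) (free' : List (Fin (d + 2))),
      Core s' (palsF (x ++ [c])) (x ++ [c]) pre slot' free' (s'.reg 6) →
      s'.reg 6 = s.reg 6 → s'.reg 7 = s.reg 7 →
      s'.reg 5 = nodeAddr σ (slot' (.word (lps (x ++ [c])))) → Q s') :
    Wp M W descend s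
      (descendTime + stepTime * (u.lk.size + 2 - (lps (u.wrap c).tail).length)) Q := by
  refine Wp.mono (Wp.seq (N := bnd (ldChild 16 12 2)) (N' := (Cond.eq (.reg 16) (.const 0)).cost + 1 +
    ((findLinkTime + stepTime * (u.lk.size + 2 - (lps (u.wrap c).tail).length)) + bnd insertNode +
      bnd (.assign 5 (.reg 16))))
    (Q := Q) (wpf.wp (wpf_ldChild hL h12 h2 ?_)))
    (by unfold descendTime; omega) fun _ h => h
  rw [h.tree.child u hu]
  set v := u.wrap c with hvd
  set a := if v ∈ palsF x then nodeAddr σ (slot (.word v)) else 0 with ha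
  have h' := h.setReg (r := 16) a
  have hb : (Cond.eq (.reg 16) (.const 0)).Holds (s.setReg 16 a) ↔ v ∉ palsF x := by
    simp only [Cond.Holds, Expr.eval, State.reg_setReg, if_true, ha]
    split_ifs with hm
    · have := nodeAddr_pos (σ := σ) (slot (.word v))
      simp [hm]; omega
    · simp [hm]
  refine Wp.ite ⟨trivial, by have := hL.three_lt; simp only [Expr.Safe]; omega⟩ ?_ ?_
  · intro hb'
    rw [hb] at hb'
    refine Wp.mono (Wp.seq (wp_findLink hL (c := c) (u := u)
      (by simpa [State.reg_setReg] using h') (by simpa [State.reg_setReg] using h6)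
      (by simpa [State.reg_setReg] using h7) (by simpa [State.reg_setReg] using h2)
      (by simpa [State.reg_setReg] using h12) hu hs
      (show v <:+ _ by rw [hv]; exact lps_suffix _) ?_))
      (Nat.le_add_right _ _) fun _ h => h
    intro s' hmem hreg hl h18
    have hr : ∀ r, r ∉ [13, 14, 15, 16, 17, 18] → s'.reg r = s.reg r := by
      intro r hr
      simp only [List.mem_cons, List.not_mem_nil, or_false, not_or] at hr
      rw [hreg r (by simp; omega)]
      simp [State.reg_setReg, hr]
    have hc' : Core s' (palsF x) (x ++ [c]) pre slot free (s'.reg 6) := by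
      rw [hr 6 (by decide)]
      exact h.of_mem hmem fun r hr' => hr r (by
        simp only [List.mem_cons, List.not_mem_nil, or_false] at hr' ⊢; omega)
    refine wpf.wp (wpf_insertNode_inv hL hc' (by rw [hr 2 (by decide), h2])
      (by rw [hr 12 (by decide), h12]) hu hv hb' hl h18 hpre ?_)
    intro s'' slot' free' hc'' e6 e7 e5
    exact hQ s'' slot' free' hc'' (by rw [e6, hr 6 (by decide)]) (by rw [e7, hr 7 (by decide)]) e5
  · intro hb'
    rw [hb, not_not] at hb'
    refine (wpf.wp (p := .assign 5 (.reg 16)) (wpf_assign trivial (hQ _ slot free ?_ ?_ ?_ ?_))).mono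
      (Nat.le_add_left _ _) fun _ h => h
    · rw [palsF_concat, ← hv, Finset.insert_eq_of_mem hb']
      have := h'.setReg (r := 5) ((Expr.reg 16).eval (s.setReg 16 a))
      simpa [State.reg_setReg] using this
    · simp [State.reg_setReg]
    · simp [State.reg_setReg]
    · simp [State.reg_setReg, Expr.eval, ha, hb', ← hv]

theorem wpf_recordSuffix (hL : Large M W σ d)
    (h : Core s (palsF (x ++ [c])) (x ++ [c]) (Function.update pre x.length []) slot free
      (s.reg 6)) (h6 : s.reg 6 < d) (h7 : s.reg 7 = x.length)
    (h5 : s.reg 5 = nodeAddr σ (slot (.word (lps (x ++ [c]))))) (hpre : PreOk x pre)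
    (hQ : ∀ s' : State, Inv d s' (x ++ [c]) → Q s') :
    wpf M W recordSuffix s Q := by
  have hd := h.buf.le
  have hw := hL.two_lt
  set v := lps (x ++ [c]) with hv
  have hvP : v ∈ palsF (x ++ [c]) := mem_palsF.2 ⟨palindrome_lps _, (lps_suffix _).isInfix⟩
  have hvl : v.length ≤ x.length + 1 := by simpa [hv] using length_lps_le (x ++ [c])
  have hv0 : 0 < v.length := List.length_pos_iff.2 (lps_ne_nil (by simp))
  simp only [List.length_append, List.length_singleton] at hd
  refine wpf_seq (wpf_ldFld hL h.ctx 0 h5 ?_)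
  rw [h.tree.len (.word v) hvP]
  set z := (ENode.word v).size with hz
  have hzv : z = v.length + 1 := rfl
  have h1 := h.setReg (r := 13) z
  have e : (Expr.sub (.add (.reg 7) (.const 2)) (.reg 13)).eval (s.setReg 13 z) =
      x.length + 1 - v.length := by
    simp [Expr.eval, State.reg_setReg, h7, hzv]
  refine wpf_seq (wpf_ldPos hL h1.ctx (by decide) (by simpa [State.reg_setReg] using h6)
    ⟨⟨trivial, by simp only [Expr.Safe]; omega, by
      simp [Expr.eval, State.reg_setReg, h7]; omega⟩, trivial⟩ (by rw [e]; omega) ?_)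
  rw [e]
  have h2 := h1.setReg (r := 14) (Fin.ofNat d ((s.setReg 13 z).reg 6 + (x.length + 1 - v.length)))
  refine wpf_seq (wpf_setPre_inv hL h2.ctx (off := s.reg 6) (j := x.length + 1 - v.length)
    (v := v) (by decide) (by decide) h2.tree h2.buf
    (by simp only [List.length_append, List.length_singleton]; omega) hvP ?_
    (by simp [State.reg_setReg]) (by simpa [State.reg_setReg] using h5) (h.count_lt hL v) ?_)
  · by_cases he : x.length + 1 - v.length = x.length
    · rw [he, Function.update_self]; exact nil_mem_palsF _
    · rw [Function.update_of_ne he, palsF_concat]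
      exact Finset.mem_insert_of_mem (hpre.mem_palsF (by omega))
  · intro s' hreg hT hB
    have hr : ∀ r, r ∉ [13, 14, 17, 18] → s'.reg r = s.reg r := by
      intro r hr
      simp only [List.mem_cons, List.not_mem_nil, or_false, not_or] at hr
      rw [hreg r hr.2.2.1 hr.2.2.2]
      simp [State.reg_setReg, hr]
    have hc : Core s' (palsF (x ++ [c])) (x ++ [c]) (preAppend x c pre) slot free (s.reg 6) :=
      ⟨⟨by rw [hr 0 (by decide), h.ctx.r0], by rw [hr 1 (by decide), h.ctx.r1],
        by rw [hr 9 (by decide), h.ctx.r9]⟩, hT, hB⟩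
    refine wpf_assign ⟨trivial, by simp only [Expr.Safe]; omega, by
      simp only [Expr.eval, hr 7 (by decide), h7]; omega⟩ (hQ _ ?_)
    refine ⟨slot, free, preAppend x c pre, ?_, preOk_preAppend hpre c, ?_, ?_, ?_⟩
    · have := hc.setReg (r := 7) ((Expr.add (.reg 7) (.const 1)).eval s')
      simpa [State.reg_setReg, hr 6 (by decide)] using this
    · simpa [State.reg_setReg, hr 6 (by decide)] using h6
    · simp [State.reg_setReg, Expr.eval, hr 7 (by decide), h7]
    · simp [State.reg_setReg, hr 5 (by decide), h5, hv]

/-- The time for `appendProg` without the steps along suffix links. -/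
def appendTime : ℕ := bnd pushChar + bnd (probe 12) + descendTime + bnd recordSuffix

/-- The two searches make together at most |s| + |s'| + 6 tests minus the lengths of the two
palindromes found, and these lengths add up to the new potential. -/
theorem wp_append (hL : Large M W σ d) (h : Inv d s x) (h2 : s.reg 2 = c)
    (hx : x.length + 1 ≤ d) :
    potential (x ++ [c]) ≤ potential x + 4 ∧
    Wp M W appendProg s (appendTime + stepTime * (potential x + 6 - potential (x ++ [c])))
      (fun s' => Inv d s' (x ++ [c])) := by
  obtain ⟨slot, free, pre, hc, hpre, h6, h7, h5⟩ := h
  have hne : lps (x ++ [c]) ≠ [] := lps_ne_nil (by simp)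
  obtain ⟨u, hu, hsu⟩ := exists_isSuf (palindrome_lps (x ++ [c])) (lps_suffix _) hne
  have hpot := potential_concat hsu hu.symm
  have hlen := ENode.length_wrap u c
  have hsz := hsu.size_le_lps
  have hp1 : potential (x ++ [c]) = u.size + 1 + (lps (u.wrap c).tail).length := by
    rw [potential, hu, hlen]
  have hp0 : potential x = (lps x).length + (lps (lps x).tail).length := rfl
  refine ⟨by omega, ?_⟩
  refine Wp.mono (Wp.seq (N := bnd pushChar) (N' := (bnd (probe 12) +
    stepTime * ((ENode.word (lps x)).size + 2 - (u.wrap c).length)) + (descendTime +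
      stepTime * (u.lk.size + 2 - (lps (u.wrap c).tail).length) + bnd recordSuffix))
    (wpf.wp (wpf_pushChar hL hc h6 h7 h2 hx ?_))) ?_ fun _ h => h
  · intro s1 hr1 h12 hc1
    have hlpsP : (ENode.word (lps x)).In (palsF x) :=
      mem_palsF.2 ⟨palindrome_lps _, (lps_suffix _).isInfix⟩
    refine Wp.seq (wp_findLoop hL (c := c) (u₀ := .word (lps x)) (n := x.length + 2)
      (z := u.wrap c) (closed_palsF x)
      hc1 (by rw [hr1 6 (by decide)]; exact h6) (by rw [hr1 7 (by decide)]; exact h7)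
      (by rw [hr1 2 (by decide)]; exact h2) (by decide) (by rw [h12, h5]) hlpsP (isSuf_lps x)
      bounds_lps ?_ ?_)
    · intro u' hs' hm' hb' _
      rw [wrap_eq_lps hs' hm' hb', hu]
    · intro s2 u' hmem hr2 h12' hu' hs' hm' hz
      obtain ⟨rfl, -⟩ := ENode.wrap_inj hz
      have hr : ∀ r, r ∉ [10, 11, 12, 13, 14, 15] → s2.reg r = s.reg r := by
        intro r hr
        simp only [List.mem_cons, List.not_mem_nil, or_false, not_or] at hr
        rw [hr2 r (by simp; omega), hr1 r (by simp; omega)]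
      have hc2 : Core s2 (palsF x) (x ++ [c]) (Function.update pre x.length []) slot free
          (s2.reg 6) := by
        rw [hr2 6 (by decide)]
        exact hc1.of_mem hmem fun r hr' => hr2 r (by
          simp only [List.mem_cons, List.not_mem_nil, or_false] at hr' ⊢; omega)
      refine Wp.seq (wp_descend hL hc2 (by rw [hr 6 (by decide)]; exact h6)
        (by rw [hr 7 (by decide)]; exact h7) (by rw [hr 2 (by decide)]; exact h2) h12' hu' hs'
        hu.symm ?_ ?_)
      · intro k hk
        simp only [List.length_append, List.length_singleton] at hk
        by_cases he : k = x.length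
        · subst he; rw [Function.update_self]; exact nil_mem_palsF x
        · rw [Function.update_of_ne he]; exact hpre.mem_palsF (by omega)
      · intro s3 slot' free' hc3 e6 e7 e5
        exact wpf.wp (wpf_recordSuffix hL hc3 (by rw [e6, hr 6 (by decide)]; exact h6)
          (by rw [e7, hr 7 (by decide)]; exact h7) e5 hpre fun _ h => h)
  · have e : (ENode.word (lps x)).size = (lps x).length + 1 := rfl
    have : stepTime * ((ENode.word (lps x)).size + 2 - (u.wrap c).length) +
        stepTime * (u.lk.size + 2 - (lps (u.wrap c).tail).length) ≤
        stepTime * (potential x + 6 - potential (x ++ [c])) := by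
      rw [← Nat.mul_add]
      exact Nat.mul_le_mul_left _ (by omega)
    unfold appendTime; omega

end Append

/-! ### Deleting the first character -/

section Delete

variable {σ d M W : ℕ} [NeZero d] {s : State} {a : Fin σ} {y : List (Fin σ)}
    {pre : ℕ → List (Fin σ)} {slot : ENode (Fin σ) → Fin (d + 2)} {free : List (Fin (d + 2))}
    {Q : State → Prop}

/-- Registers 10 and 11 get the longest palindromic prefix and its suffix link, register 5 the
longest palindromic suffix that remains; the counter of the prefix is decreased. -/
def dropFirst : Prog :=
  .seq (ldBuf 10 1 6) <|
  .seq (ldFld 11 10 1) <|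
  .seq (ldFld 12 5 0) <|
  .seq (.ite (.eq (.reg 12) (.add (.reg 7) (.const 1))) (ldFld 5 5 1) .skip) <|
  .seq (ldFld 13 10 4) <|
  stFld 10 4 (.sub (.reg 13) (.const 1))

/-- The node in register 11 is recorded where it ends the node in register 10, unless a longer
palindrome is recorded there. -/
def moveOcc : Prog :=
  .seq (ldFld 14 11 0) <|
  .ite (.lt (.const 1) (.reg 14))
    (.seq (ldFld 12 10 0) <|
     .seq (ldPos 15 (.sub (.reg 12) (.reg 14))) <|
     .seq (ldBuf 16 1 15) <|
     .seq (ldFld 17 16 0) <|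
     .ite (.lt (.reg 17) (.reg 14)) (setPre 15 11) .skip) .skip

/-- The node in register 10 is removed if its counter is zero. -/
def cleanUp : Prog :=
  .seq (ldFld 13 10 4) <|
  .ite (.eq (.reg 13) (.const 0)) removeNode .skip

/-- The start of the window moves by one, and the window becomes shorter by one. -/
def shiftWindow : Prog := .seq (ldPos 6 (.const 1)) (.assign 7 (.sub (.reg 7) (.const 1)))

/-- Deleting the first character. -/
def deleteProg : Prog := .seq dropFirst <| .seq moveOcc <| .seq cleanUp shiftWindow

theorem occCount_succ (n : ℕ) (pre : ℕ → List (Fin σ)) (w : List (Fin σ)) :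
    occCount (n + 1) pre w =
      occCount n (fun k => pre (k + 1)) w + if pre 0 = w then 1 else 0 := by
  unfold occCount
  rw [Finset.card_filter, Finset.card_filter, Finset.sum_range_succ']

theorem wpf_dropFirst (hL : Large M W σ d) (h : Core s (palsF (a :: y)) (a :: y) pre slot free
      (s.reg 6)) (hpre : PreOk (a :: y) pre)
    (h6 : s.reg 6 < d) (h7 : s.reg 7 = (a :: y).length)
    (h5 : s.reg 5 = nodeAddr σ (slot (.word (lps (a :: y)))))
    (hQ : ∀ s' : State, (∀ r, r ∉ [5, 10, 11, 12, 13] → s'.reg r = s.reg r) →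
      s'.reg 10 = nodeAddr σ (slot (.word (lpp (a :: y)))) →
      s'.reg 11 = nodeAddr σ (slot (.word (lps (lpp (a :: y)).tail))) →
      s'.reg 5 = nodeAddr σ (slot (.word (lps y))) →
      Core s' (palsF (a :: y)) y (fun k => pre (k + 1)) slot free (s.reg 6 + 1) → Q s') :
    wpf M W dropFirst s Q := by
  set x := a :: y with hx
  have hxl : x.length = y.length + 1 := by simp [hx]
  have hw := hL.two_lt
  have hd := h.buf.le
  set v := lpp x with hv
  have hvn : v ≠ [] := lpp_ne_nil (by simp [hx])
  have hp0 : pre 0 = v := hpre.zero (by simp [hx])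
  have hvP : v ∈ palsF x := mem_palsF.2 ⟨palindrome_lpp x, (lpp_prefix x).isInfix⟩
  have hsP : lps x ∈ palsF x := mem_palsF.2 ⟨palindrome_lps x, (lps_suffix x).isInfix⟩
  have hbuf : s.get (Loc.buf 1 ⟨s.reg 6, h6⟩ : Loc σ d) = nodeAddr σ (slot (.word v)) := by
    have h1 := h.buf.occ 0 (by omega)
    rw [hp0] at h1
    rw [← h1]
    congr 2
    apply Fin.ext
    change s.reg 6 = (s.reg 6 + 0) % d
    rw [Nat.add_zero, Nat.mod_eq_of_lt h6]
  refine wpf_seq (wpf_ldBuf hL h.ctx (p := ⟨s.reg 6, h6⟩) 1 rfl ?_)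
  rw [hbuf]
  have h1 := h.setReg (r := 10) (nodeAddr σ (slot (.word v)))
  refine wpf_seq (wpf_ldFld hL h1.ctx (k := slot (.word v)) 1 (by simp [State.reg_setReg]) ?_)
  rw [h1.tree.link (.word v) hvP, ENode.lk_word hvn]
  have h2 := h1.setReg (r := 11) (nodeAddr σ (slot (.word (lps v.tail))))
  refine wpf_seq (wpf_ldFld hL h2.ctx (k := slot (.word (lps x))) 0
    (by simp [State.reg_setReg, h5]) ?_)
  rw [h2.tree.len (.word (lps x)) hsP]
  have h3 := h2.setReg (r := 12) (ENode.word (lps x)).size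
  set s3 := ((s.setReg 10 (nodeAddr σ (slot (.word v)))).setReg 11
    (nodeAddr σ (slot (.word (lps v.tail))))).setReg 12 (ENode.word (lps x)).size with hs3
  have r7 : s3.reg 7 = x.length := by simp [hs3, State.reg_setReg, h7]
  have key : ∀ s4 : State, s4.mem = s.mem → (∀ r, r ≠ 5 → s4.reg r = s3.reg r) →
      s4.reg 5 = nodeAddr σ (slot (.word (lps y))) →
      wpf M W (.seq (ldFld 13 10 4) (stFld 10 4 (.sub (.reg 13) (.const 1)))) s4 Q := by
    intro s4 hm4 hr4 h45
    have h4 : Core s4 (palsF x) x pre slot free (s.reg 6) := h3.of_mem hm4 fun r hr => hr4 r (by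
      simp only [List.mem_cons, List.not_mem_nil, or_false] at hr; omega)
    have r10 : s4.reg 10 = nodeAddr σ (slot (.word v)) := by
      rw [hr4 10 (by decide)]; simp [hs3, State.reg_setReg]
    refine wpf_seq (wpf_ldFld hL h4.ctx 4 r10 ?_)
    rw [h4.tree.count v hvP]
    have h5 := h4.setReg (r := 13) (occCount x.length pre v + linkCount (palsF x) v)
    refine wpf_stFld hL h5.ctx (k := slot (.word v)) 4 (by simp [State.reg_setReg, r10])
      ⟨trivial, by simp only [Expr.Safe]; omega⟩ (hQ _ ?_ ?_ ?_ ?_ ?_)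
    · intro r hr
      simp only [List.mem_cons, List.not_mem_nil, or_false, not_or] at hr
      simp [State.reg_setReg, hr, hr4, hs3]
    · simp [State.reg_setReg, r10]
    · simp [State.reg_setReg, hr4, hs3]
    · simp [State.reg_setReg, h45]
    · refine ⟨h5.ctx.put _ _, ?_, ?_⟩
      · refine h5.tree.congr rfl rfl rfl ?_ ?_ ?_ ?_
        · intro k c; rw [State.get_put]; simp
        · intro k c; rw [State.get_put]; simp
        · intro k n hn; rw [State.get_put]; simp [hn]
        · intro p hp
          have hcnt := occCount_succ y.length pre p
          rw [← hxl, hp0] at hcnt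
          rw [State.get_put]
          by_cases he : v = p
          · subst he
            simp [Expr.eval, State.reg_setReg] at hcnt ⊢; omega
          · have : slot (.word p) ≠ slot (.word v) := fun hs =>
              he (ENode.word.inj (h4.tree.inj (.word p) (.word v) hp hvP hs)).symm
            simp [this, he, h4.tree.count p hp] at hcnt ⊢; omega
      · have hb := h5.buf
        refine ⟨by omega, ?_, ?_⟩
        · intro k hk
          rw [State.get_put, if_neg (by simp), show s.reg 6 + 1 + k = s.reg 6 + (k + 1) by omega,
            hb.chr (k + 1) (by omega)]
          rfl
        · intro k hk
          rw [State.get_put, if_neg (by simp), show s.reg 6 + 1 + k = s.reg 6 + (k + 1) by omega,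
            hb.occ (k + 1) (by omega)]
  -- Deleting the first letter changes the longest palindromic suffix only if it is the whole
  -- window; then its link takes over. Stored sizes are lengths plus one, hence the `+ 1`.
  have hcond : (Cond.eq (.reg 12) (.add (.reg 7) (.const 1))).Holds s3 ↔
      (lps x).length = x.length := by
    simp [Cond.Holds, Expr.eval, h7, hs3, State.reg_setReg, ENode.size]
  refine wpf_seq ⟨⟨trivial, trivial, by simp only [Expr.Safe]; omega, by
    simp only [Expr.eval, r7]; omega⟩, fun hb => ?_, fun hb => ?_⟩
  · rw [hcond] at hb
    have he : lps x = x := (lps_suffix x).eq_of_length hb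
    refine wpf_ldFld hL h3.ctx (k := slot (.word (lps x))) 1
      (by simp [hs3, State.reg_setReg, h5]) ?_
    rw [h3.tree.link (.word (lps x)) hsP]
    refine key _ rfl ?_ ?_
    · intro r hr; simp [State.reg_setReg, hr]
    · rw [he, ENode.lk_word (by simp [hx])]; simp [State.reg_setReg, hx]
  · rw [hcond] at hb
    refine key _ rfl (fun _ _ => rfl) ?_
    have he : lps x = lps y := by
      by_cases hp : x.Palindrome
      · exact absurd (by rw [lps_of_palindrome hp]) hb
      · rw [hx] at hp ⊢; rw [lps, if_neg hp]
    rw [← he]; simp [hs3, State.reg_setReg, h5]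

/-- In this form the new record is the shifted old one with at most one entry replaced, to which
`wpf_setPre_inv` applies. -/
theorem preDelete_eq {x : List (Fin σ)} {pre : ℕ → List (Fin σ)} (hx : x ≠ []) :
    preDelete x pre = if lps (lpp x).tail ≠ [] ∧
      (pre ((lpp x).length - (lps (lpp x).tail).length)).length < (lps (lpp x).tail).length then
        Function.update (fun k => pre (k + 1))
          ((lpp x).length - (lps (lpp x).tail).length - 1) (lps (lpp x).tail)
      else fun k => pre (k + 1) := by
  have hlt := lps_tail_length_lt (lpp_ne_nil hx)
  funext k
  unfold preDelete
  split_ifs with h1 h2 h2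
  · rw [show (lpp x).length - (lps (lpp x).tail).length - 1 = k by omega, Function.update_self]
  · exact absurd ⟨h1.1, h1.2.1⟩ h2
  · rw [Function.update_of_ne]
    intro hk
    exact h1 ⟨h2.1, h2.2, by omega⟩
  · rfl

theorem wpf_moveOcc (hL : Large M W σ d)
    (h : Core s (palsF (a :: y)) y (fun k => pre (k + 1)) slot free (s.reg 6 + 1))
    (hpre : PreOk (a :: y) pre) (hy : y.length < d) (h6 : s.reg 6 < d)
    (h10 : s.reg 10 = nodeAddr σ (slot (.word (lpp (a :: y)))))
    (h11 : s.reg 11 = nodeAddr σ (slot (.word (lps (lpp (a :: y)).tail))))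
    (hQ : ∀ s' : State, (∀ r, r ∉ [12, 14, 15, 16, 17, 18] → s'.reg r = s.reg r) →
      Core s' (palsF (a :: y)) y (preDelete (a :: y) pre) slot free (s.reg 6 + 1) → Q s') :
    wpf M W moveOcc s Q := by
  set x := a :: y with hx
  have hxl : x.length = y.length + 1 := by simp [hx]
  have hw := hL.two_lt
  have hxn : x ≠ [] := by simp [hx]
  rw [preDelete_eq hxn] at hQ
  set v := lpp x with hv
  set u := lps v.tail with hu
  have hvP : v ∈ palsF x := mem_palsF.2 ⟨palindrome_lpp x, (lpp_prefix x).isInfix⟩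
  have huP : u ∈ palsF x := lps_tail_mem_palsF hvP
  have hlt : u.length < v.length := lps_tail_length_lt (lpp_ne_nil hxn)
  have hvx : v.length ≤ x.length := (lpp_prefix x).length_le
  refine wpf_seq (wpf_ldFld hL h.ctx 0 h11 ?_)
  rw [h.tree.len (.word u) huP]
  have h1 := h.setReg (r := 14) (ENode.word u).size
  refine ⟨⟨by simp only [Expr.Safe]; omega, trivial⟩, fun hb => ?_, fun hb => ?_⟩
  · have hu0 : 0 < u.length := by
      simpa [Cond.Holds, Expr.eval, State.reg_setReg, ENode.size] using hb
    have hun : u ≠ [] := List.length_pos_iff.1 hu0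
    refine wpf_seq (wpf_ldFld hL h1.ctx (k := slot (.word v)) 0
      (by simp [State.reg_setReg, h10]) ?_)
    rw [h1.tree.len (.word v) hvP]
    have h2 := h1.setReg (r := 12) (ENode.word v).size
    have e : (Expr.sub (.reg 12) (.reg 14)).eval ((s.setReg 14 (ENode.word u).size).setReg 12
        (ENode.word v).size) = v.length - u.length := by
      simp [Expr.eval, State.reg_setReg, ENode.size]
    refine wpf_seq (wpf_ldPos hL h2.ctx (by decide) (by simpa [State.reg_setReg] using h6)
      ⟨trivial, trivial⟩ (by rw [e]; omega) ?_)
    rw [e]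
    have e6 : ((s.setReg 14 (ENode.word u).size).setReg 12 (ENode.word v).size).reg 6 =
        s.reg 6 := by simp [State.reg_setReg]
    rw [e6]
    -- The buffer already starts one place further right, so the offset |v| - |u| in the old window
    -- is one less in the new one.
    set j := v.length - u.length - 1 with hj
    have ej : s.reg 6 + (v.length - u.length) = s.reg 6 + 1 + j := by omega
    rw [ej]
    have h3 := h2.setReg (r := 15) (Fin.ofNat d (s.reg 6 + 1 + j) : Fin d)
    have hjy : j < y.length := by omega
    refine wpf_seq (wpf_ldBuf hL h3.ctx (p := Fin.ofNat d (s.reg 6 + 1 + j)) 1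
      (by simp [State.reg_setReg]) ?_)
    rw [h3.buf.occ j hjy]
    have hjv : j + 1 = v.length - u.length := by omega
    have hwP : pre (j + 1) ∈ palsF x := hpre.mem_palsF (by omega)
    have h4 := h3.setReg (r := 16) (nodeAddr σ (slot (.word (pre (j + 1)))))
    refine wpf_seq (wpf_ldFld hL h4.ctx (k := slot (.word (pre (j + 1)))) 0
      (by simp [State.reg_setReg]) ?_)
    rw [h4.tree.len (.word (pre (j + 1))) hwP]
    have h5 := h4.setReg (r := 17) (ENode.word (pre (j + 1))).size
    refine ⟨⟨trivial, trivial⟩, fun hb' => ?_, fun hb' => ?_⟩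
    · have hc : (pre (v.length - u.length)).length < u.length := by
        rw [← hjv]
        simpa [Cond.Holds, Expr.eval, State.reg_setReg, ENode.size] using hb'
      rw [if_pos ⟨hun, hc⟩] at hQ
      refine wpf_setPre_inv hL h5.ctx (off := s.reg 6 + 1) (j := j) (v := u) (by decide)
        (by decide) h5.tree h5.buf hjy huP hwP (by simp [State.reg_setReg])
        (by simpa [State.reg_setReg] using h11) (h.count_lt hL u) ?_
      intro s' hr hT hB
      have hr' : ∀ r, r ∉ [12, 14, 15, 16, 17, 18] → s'.reg r = s.reg r := by
        intro r hr'
        simp only [List.mem_cons, List.not_mem_nil, or_false, not_or] at hr'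
        rw [hr r (by omega) (by omega)]
        simp [State.reg_setReg, hr']
      exact hQ s' hr' ⟨⟨by rw [hr' 0 (by decide), h.ctx.r0], by rw [hr' 1 (by decide), h.ctx.r1],
        by rw [hr' 9 (by decide), h.ctx.r9]⟩, hT, hB⟩
    · have hc : ¬ (pre (v.length - u.length)).length < u.length := by
        rw [← hjv]
        simpa [Cond.Holds, Expr.eval, State.reg_setReg, ENode.size] using hb'
      rw [if_neg fun h => hc h.2] at hQ
      refine hQ _ ?_ h5
      intro r hr
      simp only [List.mem_cons, List.not_mem_nil, or_false, not_or] at hr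
      simp [State.reg_setReg, hr]
  · have hu0 : u = [] := by
      simpa [Cond.Holds, Expr.eval, State.reg_setReg, ENode.size] using hb
    rw [if_neg fun h => h.1 hu0] at hQ
    refine hQ _ ?_ h1
    intro r hr
    simp only [List.mem_cons, List.not_mem_nil, or_false, not_or] at hr
    simp [State.reg_setReg, hr]

/-- Only the occurrence of the prefix at position 0 is lost: the entry that may be moved and the
shorter one it replaces are both shorter than the prefix. -/
theorem occCount_preDelete (hpre : PreOk (a :: y) pre) :
    occCount y.length (preDelete (a :: y) pre) (lpp (a :: y)) + 1 =
      occCount (a :: y).length pre (lpp (a :: y)) := by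
  set x := a :: y with hx
  have hxn : x ≠ [] := by simp [hx]
  have hxl : x.length = y.length + 1 := by simp [hx]
  have hlt := lps_tail_length_lt (lpp_ne_nil hxn)
  have hvx : (lpp x).length ≤ x.length := (lpp_prefix x).length_le
  rw [preDelete_eq hxn, hxl, occCount_succ, hpre.zero hxn, if_pos rfl]
  split_ifs with hc
  · have hu0 := List.length_pos_iff.2 hc.1
    have h1 := occCount_update (n := y.length)
      (k := (lpp x).length - (lps (lpp x).tail).length - 1) (by omega) (fun k => pre (k + 1))
      (lps (lpp x).tail) (lpp x)
    rw [show (lpp x).length - (lps (lpp x).tail).length - 1 + 1 =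
      (lpp x).length - (lps (lpp x).tail).length by omega, if_neg, if_neg] at h1
    · omega
    · intro he; rw [he] at hlt; omega
    · intro he; rw [he] at hc; omega
  · rfl

theorem wpf_cleanUp (hL : Large M W σ d) {off : ℕ}
    (h : Core s (palsF (a :: y)) y (preDelete (a :: y) pre) slot free off)
    (hpre : PreOk (a :: y) pre)
    (h10 : s.reg 10 = nodeAddr σ (slot (.word (lpp (a :: y)))))
    (h11 : s.reg 11 = nodeAddr σ (slot (.word (lps (lpp (a :: y)).tail))))
    (hQ : ∀ (s' : State) (free' : List (Fin (d + 2))),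
      (∀ r, r ∉ [8, 13, 14, 15, 16] → s'.reg r = s.reg r) →
      Core s' (palsF y) y (preDelete (a :: y) pre) slot free' off → Q s') :
    wpf M W cleanUp s Q := by
  have hxl : (a :: y).length = y.length + 1 := by simp
  have hins : palsF (a :: y) = insert (lpp (a :: y)) (palsF y) := rfl
  have hiff := lpp_mem_palsF_iff hpre
  have hocc := occCount_preDelete hpre
  have hvn : lpp (a :: y) ≠ [] := lpp_ne_nil (by simp)
  have hvp := palindrome_lpp (a :: y)
  set x := a :: y with hx
  set v := lpp x with hv
  set pre' := preDelete x pre with hpre'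
  have hvP : v ∈ palsF x := by rw [hins]; exact Finset.mem_insert_self _ _
  refine wpf_seq (wpf_ldFld hL h.ctx 4 h10 ?_)
  rw [h.tree.count v hvP]
  have h1 := h.setReg (r := 13) (occCount y.length pre' v + linkCount (palsF x) v)
  set s1 := s.setReg 13 (occCount y.length pre' v + linkCount (palsF x) v) with hs1
  -- The counter no longer includes position 0, so the threshold 1 of `lpp_mem_palsF_iff` becomes a
  -- test for zero.
  have hcond : (Cond.eq (.reg 13) (.const 0)).Holds s1 ↔ v ∉ palsF y := by
    rw [hiff, ← hocc]
    simp only [Cond.Holds, Expr.eval, hs1, State.reg_setReg, if_true]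
    omega
  have hr1 : ∀ r, r ≠ 13 → s1.reg r = s.reg r := by
    intro r hr; simp [hs1, State.reg_setReg, hr]
  refine ⟨⟨trivial, by have := hL.three_lt; simp only [Expr.Safe]; omega⟩,
    fun hb => ?_, fun hb => ?_⟩
  · rw [hcond] at hb
    obtain ⟨u, c, hvu, -⟩ := ENode.exists_wrap hvp hvn
    have hwP : u.wrap c ∈ palsF x := hvu ▸ hvP
    -- A longer palindrome of the old window is different from `v`, hence still present, and would
    -- contain an occurrence of `v`. This excludes children of `v` and suffix links into it.
    have hnot : ∀ q ∈ palsF x, v <:+: q → v.length < q.length → False := by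
      intro q hq hi hlt
      rw [hins, Finset.mem_insert] at hq
      rcases hq with rfl | hq
      · exact lt_irrefl _ hlt
      · exact hb (palsF_of_infix hq hvp hi)
    refine wpf_removeNode hL h1.ctx (k := slot (.word v)) (kl := slot (.word (lps v.tail)))
      (ku := slot u) (a := c) (by rw [hr1 10 (by decide), h10]) (by rw [hr1 11 (by decide), h11])
      (by have := h1.tree.parent u c hwP; rwa [← hvu] at this)
      (by have := h1.tree.label u c hwP; rwa [← hvu] at this) ?_
    intro s2 hr2 h8 hget
    have hr : ∀ r, r ∉ [8, 13, 14, 15, 16] → s2.reg r = s.reg r := by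
      intro r hr
      simp only [List.mem_cons, List.not_mem_nil, or_false, not_or] at hr
      rw [hr2 r (by omega) (by omega) (by omega) (by omega), hr1 r (by omega)]
    have her : palsF y = (palsF x).erase (u.wrap c) := by
      rw [hins, ← hvu, Finset.erase_insert hb]
    refine hQ s2 (slot (.word (u.wrap c)) :: free) hr ⟨⟨?_, ?_, ?_⟩, ?_, ?_⟩
    · rw [hr 0 (by decide), h.ctx.r0]
    · rw [hr 1 (by decide), h.ctx.r1]
    · rw [hr 9 (by decide), h.ctx.r9]
    · rw [her]
      refine h1.tree.erase_node (closed_palsF x) hwP ?_ ?_ hr2 ?_ ?_ ?_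
      · intro c' hc'
        rw [← hvu] at hc'
        refine hnot _ hc' (ENode.str_infix_wrap (.word v) c') ?_
        rw [ENode.length_wrap]; simp only [ENode.size]; omega
      · intro q hq hqn he
        rw [← hvu] at he
        have := lps_tail_length_lt hqn
        rw [he] at this
        exact hnot q hq (he ▸ (lps_tail_suffix q).isInfix) this
      · rw [← hvu]; exact h8
      · rw [← hvu]; exact hget
      · intro p _ _
        rw [← her, ← hvu, hins, linkCount_insert hb]; omega
    · exact h.buf.congr rfl (fun _ _ => rfl) fun b p => by rw [hget]; simp [hs1]
  · rw [hcond, not_not] at hb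
    refine hQ _ free ?_ ?_
    · intro r hr
      simp only [List.mem_cons, List.not_mem_nil, or_false, not_or] at hr
      exact hr1 r (by omega)
    · rw [hins, Finset.insert_eq_of_mem hb] at h1
      exact h1

theorem wpf_shiftWindow (hL : Large M W σ d)
    (h : Core s (palsF y) y pre slot free (s.reg 6 + 1))
    (hpre : PreOk y pre) (h6 : s.reg 6 < d) (h7 : s.reg 7 = y.length + 1)
    (h5 : s.reg 5 = nodeAddr σ (slot (.word (lps y))))
    (hQ : ∀ s' : State, Inv d s' y → Q s') : wpf M W shiftWindow s Q := by
  have hw := hL.two_lt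
  have hd : 0 < d := Nat.pos_of_ne_zero (NeZero.ne d)
  refine wpf_seq (wpf_ldPos hL h.ctx (by decide) h6 (by simp only [Expr.Safe]; omega)
    (by simp only [Expr.eval]; omega) ?_)
  have h1 := h.setReg (r := 6) (Fin.ofNat d (s.reg 6 + 1) : Fin d)
  refine wpf_assign ⟨trivial, by simp only [Expr.Safe]; omega⟩ (hQ _ ?_)
  have h2 := h1.setReg (r := 7) (y.length)
  refine ⟨slot, free, pre, ?_, hpre, ?_, ?_, ?_⟩
  · have e : ∀ v, ((s.setReg 6 (Fin.ofNat d (s.reg 6 + 1) : Fin d)).setReg 7 v).reg 6 =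
        (s.reg 6 + 1) % d := fun v => by simp [State.reg_setReg, Fin.ofNat]
    have e7 : (Expr.sub (.reg 7) (.const 1)).eval
        (s.setReg 6 (Fin.ofNat d (s.reg 6 + (Expr.const 1).eval s) : Fin d)) = y.length := by
      simp [Expr.eval, State.reg_setReg, h7]
    rw [e7]
    simp only [Expr.eval]
    rw [e]
    exact ⟨h2.ctx, h2.tree, h2.buf.congr (Nat.mod_mod _ _) (fun _ _ => rfl) fun _ _ => rfl⟩
  · rw [State.reg_setReg, if_neg (by decide), State.reg_setReg, if_pos rfl]
    exact Fin.isLt _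
  · simp [State.reg_setReg, Expr.eval, h7]
  · simp [State.reg_setReg, h5]

/-- If the window is a palindrome, its length dominates the new second summand, and its link is the
new first summand. Otherwise the longest palindromic suffix does not change. -/
theorem potential_tail (a : Fin σ) (y : List (Fin σ)) : potential y ≤ potential (a :: y) := by
  unfold potential
  by_cases hp : (a :: y).Palindrome
  · rw [lps_of_palindrome hp, List.tail_cons, List.length_cons]
    have h1 := length_lps_le (lps y).tail
    have h2 := length_lps_le y
    rw [List.length_tail] at h1
    omega
  · rw [lps, if_neg hp]

theorem wp_delete (hL : Large M W σ d) (h : Inv d s (a :: y)) :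
    Wp M W deleteProg s (bnd deleteProg) (fun s' => Inv d s' y) := by
  obtain ⟨slot, free, pre, hc, hpre, h6, h7, h5⟩ := h
  have hd := hc.buf.le
  have hxl : (a :: y).length = y.length + 1 := rfl
  refine wpf.wp (wpf_seq (wpf_dropFirst hL hc hpre h6 h7 h5 ?_))
  intro s1 hr1 h10 h11 h15 hc1
  have e1 : s1.reg 6 = s.reg 6 := hr1 6 (by decide)
  refine wpf_seq (wpf_moveOcc hL (by rw [e1]; exact hc1) hpre (by omega) (by rw [e1]; exact h6)
    h10 h11 ?_)
  intro s2 hr2 hc2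
  rw [e1] at hc2
  refine wpf_seq (wpf_cleanUp hL hc2 hpre (by rw [hr2 10 (by decide), h10])
    (by rw [hr2 11 (by decide), h11]) ?_)
  intro s3 free' hr3 hc3
  have e3 : s3.reg 6 = s.reg 6 := by rw [hr3 6 (by decide), hr2 6 (by decide), e1]
  exact wpf_shiftWindow hL (by rw [e3]; exact hc3) (preOk_preDelete hpre) (by rw [e3]; exact h6)
    (by rw [hr3 7 (by decide), hr2 7 (by decide), hr1 7 (by decide), h7, hxl])
    (by rw [hr3 5 (by decide), hr2 5 (by decide), h15]) fun _ h => h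

end Delete

/-! ### Initialisation -/

section Init

variable {σ d M W : ℕ} {s : State} {Q : State → Prop}

/-- The size of a node object. -/
def nodeSizeE : Expr := .add (.mul (.const 2) (.reg 1)) (.const 5)

/-- One child pointer and one mark of the node in register 10 are initialised. -/
def clearStep : Prog :=
  .seq (stChild 10 11 (.const 0)) <|
  .seq (stMark 10 11 (.const 1)) <|
  .assign 11 (.add (.reg 11) (.const 1))

/-- The arrays of the node in register 10 are initialised. -/
def clearNode : Prog := .seq (.assign 11 (.const 0)) (.while (.lt (.reg 11) (.reg 1)) clearStep)

/-- The node in register 10 is linked to the next one. -/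
def linkNode : Prog :=
  .seq (stFld 10 1 (.add (.reg 10) nodeSizeE)) (.assign 10 (.add (.reg 10) nodeSizeE))

/-- All nodes are initialised and linked. -/
def clearAll : Prog := .while (.lt (.reg 10) (.reg 9)) (.seq clearNode linkNode)

/-- The registers that hold the constants are set. -/
def setConstants : Prog :=
  .seq (.assign 3 (.const 1)) <|
  .seq (.assign 4 (.add (.const 1) nodeSizeE)) <|
  .seq (.assign 9 (.add (.const 1) (.mul (.add (.reg 0) (.const 2)) nodeSizeE))) <|
  .assign 10 (.const 1)

/-- The tree of the empty string. -/
def setRoots : Prog :=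
  .seq (stFld 3 0 (.const 0)) <|
  .seq (stFld 3 1 (.reg 3)) <|
  .seq (stFld 4 0 (.const 1)) <|
  .seq (stFld 4 1 (.reg 3)) <|
  .seq (stFld 4 4 (.const 1)) <|
  .seq (.assign 8 (.add (.reg 4) nodeSizeE)) <|
  .seq (.assign 6 (.const 0)) <|
  .seq (.assign 7 (.const 0)) <|
  .assign 5 (.reg 4)

/-- The data structure for the empty string is built. -/
def setUp : Prog := .seq setConstants <| .seq clearAll setRoots

/-- Initialisation with the one-letter string. -/
def initProg : Prog := .seq setUp appendProg

theorem nodeSizeE_spec (hL : Large M W σ d) (h1 : s.reg 1 = σ) :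
    nodeSizeE.Safe M W s ∧ nodeSizeE.eval s = 2 * σ + 5 := by
  have := hL.two_lt
  simp only [nodeSizeE, Expr.Safe, Expr.eval, h1, true_and, and_true]
  omega

/-- The time for `clearNode`. -/
def clearTime (σ : ℕ) : ℕ := 2 + ((Cond.lt (.reg 11) (.reg 1)).cost + 1 + bnd clearStep) * (σ + 1)

theorem wp_clearNode (hL : Large M W σ d) (hc : Ctx σ d s) {k : Fin (d + 2)}
    (h10 : s.reg 10 = nodeAddr σ k)
    (hQ : ∀ s' : State, (∀ r, r ≠ 11 → s'.reg r = s.reg r) →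
      (∀ c, s'.get (Loc.child k c : Loc σ d) = 0) → (∀ c, s'.get (Loc.mark k c : Loc σ d) = 1) →
      (∀ k' c, k' ≠ k → s'.get (Loc.child k' c : Loc σ d) = s.get (Loc.child k' c : Loc σ d) ∧
        s'.get (Loc.mark k' c : Loc σ d) = s.get (Loc.mark k' c : Loc σ d)) →
      (∀ k' n, s'.get (Loc.fld k' n : Loc σ d) = s.get (Loc.fld k' n : Loc σ d)) → Q s') :
    Wp M W clearNode s (clearTime σ) Q := by
  have hw := hL.two_lt
  let I : ℕ → State → Prop := fun m s' => m ≤ σ ∧ s'.reg 11 = σ - m ∧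
    (∀ r, r ≠ 11 → s'.reg r = s.reg r) ∧
    (∀ c : Fin σ, (c : ℕ) < σ - m → s'.get (Loc.child k c : Loc σ d) = 0 ∧
      s'.get (Loc.mark k c : Loc σ d) = 1) ∧
    (∀ k' c, k' ≠ k → s'.get (Loc.child k' c : Loc σ d) = s.get (Loc.child k' c : Loc σ d) ∧
        s'.get (Loc.mark k' c : Loc σ d) = s.get (Loc.mark k' c : Loc σ d)) ∧
    (∀ k' n, s'.get (Loc.fld k' n : Loc σ d) = s.get (Loc.fld k' n : Loc σ d))
  have hloop := Wp.while (M := M) (W := W) (b := .lt (.reg 11) (.reg 1)) (p := clearStep)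
    (N := bnd clearStep) (I := I) (fun m s' _ => ⟨trivial, trivial⟩) (by
      rintro m s' ⟨hm, h11, hr, hdone, hk', hf⟩ hb
      have r1 : s'.reg 1 = σ := by rw [hr 1 (by decide), hc.r1]
      have r10 : s'.reg 10 = nodeAddr σ k := by rw [hr 10 (by decide), h10]
      have hc' : Ctx σ d s' := ⟨by rw [hr 0 (by decide), hc.r0], r1,
        by rw [hr 9 (by decide), hc.r9]⟩
      have hm0 : σ - m < σ := by simpa [Cond.Holds, Expr.eval, h11, r1] using hb
      have h11' : s'.reg 11 = ((⟨σ - m, hm0⟩ : Fin σ) : ℕ) := h11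
      set a : Fin σ := ⟨σ - m, hm0⟩ with ha
      refine wpf.wp (wpf_seq (wpf_stChild hL r10 h11' (by simp only [Expr.Safe]; omega) ?_))
      refine wpf_seq (wpf_stMark hL (hc'.put _ _) (a := a) r10 h11'
        (by simp only [Expr.Safe]; omega) ?_)
      refine wpf_assign ⟨trivial, by simp only [Expr.Safe]; omega, by
        simp only [Expr.eval, State.reg_put, h11]; omega⟩ ?_
      refine ⟨m - 1, by omega, by omega, ?_, ?_, ?_, ?_, ?_⟩
      · simp only [Expr.eval, State.reg_put, h11, State.reg_setReg, if_true]; omega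
      · intro r hr'
        simp [State.reg_setReg, hr', hr]
      · intro c hcm
        by_cases he : c = a
        · subst he
          simp [State.get_put, Expr.eval]
        · have h2 : (c : ℕ) ≠ σ - m := fun h => he (Fin.ext h)
          simp [State.get_put, he, hdone c (by omega)]
      · intro k' c hne
        simp [State.get_put, hne, hk' k' c hne]
      · intro k' n
        simp [State.get_put, hf])
  refine Wp.seq (N := 2) (wpf.wp (p := .assign 11 (.const 0)) (wpf_assign
    (by simp only [Expr.Safe]; omega) ?_))
  intro hw1
  obtain ⟨n, s2, m, hex, hw2, ⟨hm, h11, hr, hdone, hk', hf⟩, hnb, -, hn⟩ := hloop σ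
    (s.setReg 11 ((Expr.const 0).eval s))
    ⟨le_rfl, by simp [State.reg_setReg, Expr.eval], fun r hr => by simp [State.reg_setReg, hr],
      fun c hc => absurd hc (by simp), fun _ _ _ => ⟨rfl, rfl⟩, fun _ _ => rfl⟩ hw1
  have hm0 : ¬ σ - m < σ := by
    simpa [Cond.Holds, Expr.eval, h11, hr 1 (by decide), hc.r1] using hnb
  have hσ := hL.sigma
  refine ⟨n, s2, hex, hn.trans (Nat.mul_le_mul_left _ (by omega)), hw2,
    hQ s2 hr (fun c => (hdone c (by have := c.2; omega)).1)
      (fun c => (hdone c (by have := c.2; omega)).2) hk' hf⟩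

/-- The time for `clearAll`. -/
def clearAllTime (σ d : ℕ) : ℕ :=
  ((Cond.lt (.reg 10) (.reg 9)).cost + 1 + (clearTime σ + bnd linkNode)) * (d + 3)

theorem nodeAddr_succ (k : ℕ) : nodeAddr σ k + (2 * σ + 5) = nodeAddr σ (k + 1) := by
  unfold nodeAddr; ring

theorem Large.nodeAddr_last_lt [NeZero d] (hL : Large M W σ d) : nodeAddr σ (d + 2) < W := by
  have h1 := hL.mem
  have h2 := hL.word
  have h3 : 0 < d := Nat.pos_of_ne_zero (NeZero.ne d)
  unfold memSize at h1; omega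

/-- Each node is linked to the next in memory. The link of the last one points to the start of the
buffers, which is harmless since `FreeChain` does not constrain what follows its last node. -/
theorem wp_clearAll [NeZero d] (hL : Large M W σ d) (hc : Ctx σ d s) (h10 : s.reg 10 = nodeAddr σ 0)
    (hQ : ∀ s' : State, (∀ r, r ≠ 10 → r ≠ 11 → s'.reg r = s.reg r) →
      (∀ k c, s'.get (Loc.child k c : Loc σ d) = 0) →
      (∀ k c, s'.get (Loc.mark k c : Loc σ d) = 1) →
      (∀ k, s'.get (Loc.fld k 1 : Loc σ d) = nodeAddr σ (k + 1)) → Q s') :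
    Wp M W clearAll s (clearAllTime σ d) Q := by
  have hw := hL.two_lt
  let I : ℕ → State → Prop := fun m s' => m ≤ d + 2 ∧ s'.reg 10 = nodeAddr σ (d + 2 - m) ∧
    (∀ r, r ≠ 10 → r ≠ 11 → s'.reg r = s.reg r) ∧
    (∀ k : Fin (d + 2), (k : ℕ) < d + 2 - m → (∀ c, s'.get (Loc.child k c : Loc σ d) = 0 ∧
      s'.get (Loc.mark k c : Loc σ d) = 1) ∧
      s'.get (Loc.fld k 1 : Loc σ d) = nodeAddr σ (k + 1))
  have hctx : ∀ m s', I m s' → Ctx σ d s' := fun m s' ⟨_, _, hr, _⟩ =>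
    ⟨by rw [hr 0 (by decide) (by decide), hc.r0], by rw [hr 1 (by decide) (by decide), hc.r1],
        by rw [hr 9 (by decide) (by decide), hc.r9]⟩
  have hcond : ∀ m s', I m s' → ((Cond.lt (.reg 10) (.reg 9)).Holds s' ↔ 0 < m) := by
    intro m s' hI
    obtain ⟨hm, h10', -⟩ := id hI
    simp only [Cond.Holds, Expr.eval, h10', (hctx m s' hI).r9]
    constructor
    · intro h
      by_contra h0
      rw [show m = 0 by omega] at h
      exact lt_irrefl _ h
    · intro h
      have := nodeAddr_add_le (σ := σ) (show d + 2 - m < d + 2 by omega)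
      omega
  have hloop := Wp.while (M := M) (W := W) (b := .lt (.reg 10) (.reg 9))
    (p := .seq clearNode linkNode) (N := clearTime σ + bnd linkNode) (I := I)
    (fun m s' _ => ⟨trivial, trivial⟩) (by
      intro m s' hI hb
      have hc' := hctx m s' hI
      rw [hcond m s' hI] at hb
      obtain ⟨hm, h10', hr, hdone⟩ := hI
      set k : Fin (d + 2) := ⟨d + 2 - m, by omega⟩ with hk
      refine Wp.seq (wp_clearNode hL hc' (k := k) h10' ?_)
      intro s2 hr2 hch hmk hk' hf
      have hc2 : Ctx σ d s2 := ⟨by rw [hr2 0 (by decide), hc'.r0],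
        by rw [hr2 1 (by decide), hc'.r1], by rw [hr2 9 (by decide), hc'.r9]⟩
      have e10 : s2.reg 10 = nodeAddr σ k := by rw [hr2 10 (by decide), h10']
      obtain ⟨hs1, hs2⟩ := nodeSizeE_spec (s := s2) hL hc2.r1
      have hlt : nodeAddr σ k + (2 * σ + 5) < W :=
        (nodeAddr_fin k).trans_lt hL.nodeAddr_last_lt
      refine wpf.wp (wpf_seq (wpf_stFld hL hc2 (k := k) 1 e10 ⟨trivial, hs1, by
        rw [hs2]; simp only [Expr.eval, e10]; exact hlt⟩ ?_))
      have ev : (Expr.add (.reg 10) nodeSizeE).eval s2 = nodeAddr σ (k + 1) := by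
        change s2.reg 10 + nodeSizeE.eval s2 = _
        rw [hs2, e10, nodeAddr_succ]
      rw [ev]
      obtain ⟨hs1', hs2'⟩ := nodeSizeE_spec
        (s := s2.put (Loc.fld k 1 : Loc σ d) (nodeAddr σ (k + 1))) hL hc2.r1
      have ev' : (Expr.add (.reg 10) nodeSizeE).eval
          (s2.put (Loc.fld k 1 : Loc σ d) (nodeAddr σ (k + 1))) = nodeAddr σ (k + 1) := by
        change s2.reg 10 + nodeSizeE.eval _ = _
        rw [hs2', e10, nodeAddr_succ]
      refine wpf_assign ⟨trivial, hs1', by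
        rw [hs2']; simp only [Expr.eval, State.reg_put, e10]; exact hlt⟩ ?_
      rw [ev']
      refine ⟨m - 1, by omega, by omega, ?_, ?_, ?_⟩
      · simp only [State.reg_setReg, if_true, hk]
        congr 1; omega
      · intro r h1 h2
        simp [State.reg_setReg, h1, hr2 r h2, hr r h1 h2]
      · intro k₁ hk₁
        by_cases he : k₁ = k
        · subst he
          simp [State.get_put, hch, hmk]
        · have h2 : (k₁ : ℕ) ≠ d + 2 - m := fun h => he (Fin.ext h)
          obtain ⟨h3, h4⟩ := hdone k₁ (by omega)
          refine ⟨fun c => ?_, ?_⟩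
          · simp [State.get_put, hk' k₁ c he, h3 c]
          · simp [State.get_put, he, hf, h4])
  intro hws
  obtain ⟨n, s2, m, hex, hw2, hI, hnb, -, hn⟩ := hloop (d + 2) s
    ⟨le_rfl, by simpa using h10, fun _ _ _ => rfl, fun k hk => absurd hk (by simp)⟩ hws
  rw [hcond m s2 hI] at hnb
  obtain ⟨-, -, hr, hdone⟩ := hI
  have hm0 : m = 0 := by omega
  subst hm0
  exact ⟨n, s2, hex, hn, hw2, hQ s2 hr (fun k c => ((hdone k k.2).1 c).1)
    (fun k c => ((hdone k k.2).1 c).2) fun k => (hdone k k.2).2⟩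

theorem exists_freeChain (h : ∀ k : Fin (d + 2), 2 ≤ (k : ℕ) →
    s.get (Loc.fld k 1 : Loc σ d) = nodeAddr σ (k + 1)) :
    ∀ n k : ℕ, k + n = d + 2 → 2 ≤ k → ∃ l : List (Fin (d + 2)), l.length = n ∧ l.Nodup ∧
      (∀ i ∈ l, k ≤ (i : ℕ)) ∧ FreeChain (σ := σ) s l (nodeAddr σ k) := by
  intro n
  induction n with
  | zero => exact fun k _ _ => ⟨[], rfl, List.nodup_nil, by simp, trivial⟩
  | succ n ih =>
    intro k hk h2
    obtain ⟨l, hl, hn, hi, hf⟩ := ih (k + 1) (by omega) (by omega)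
    refine ⟨⟨k, by omega⟩ :: l, by simp [hl], List.nodup_cons.2 ⟨fun hm => ?_, hn⟩, ?_, rfl, ?_⟩
    · have := hi _ hm
      simp at this
    · intro i hi'
      rcases List.mem_cons.1 hi' with rfl | hi'
      · simp
      · exact (Nat.le_succ k).trans (hi i hi')
    · rw [h ⟨k, by omega⟩ h2]; exact hf

/-- The time for `setUp`. -/
def setUpTime (σ d : ℕ) : ℕ := bnd setConstants + clearAllTime σ d + bnd setRoots

/-- Although windows are nonempty, the invariant is established for the empty string, so that the
first letter is handled by an ordinary append. The buffers keep their arbitrary contents because no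
position is in use yet. -/
theorem wp_setUp [NeZero d] (hL : Large M W σ d) (h0 : s.reg 0 = d) (h1 : s.reg 1 = σ)
    (hQ : ∀ s' : State, s'.reg 2 = s.reg 2 → Inv d s' ([] : List (Fin σ)) → Q s') :
    Wp M W setUp s (setUpTime σ d) Q := by
  have hw := hL.two_lt
  have hMW := hL.nodeAddr_last_lt
  have e1 : nodeAddr σ 1 = 1 + (2 * σ + 5) := by unfold nodeAddr; ring
  refine Wp.mono (Wp.seq (N := bnd setConstants) (N' := clearAllTime σ d + bnd setRoots) (Q := Q)
    (wpf.wp (wpf_seq (wpf_assign (by simp only [Expr.Safe]; omega) ?_))))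
    (by unfold setUpTime; omega) fun _ h => h
  obtain ⟨hs, he⟩ := nodeSizeE_spec (s := s.setReg 3 ((Expr.const 1).eval s)) hL
    (by simp [State.reg_setReg, h1])
  refine wpf_seq (wpf_assign ⟨by simp only [Expr.Safe]; omega, hs, by
    rw [he]; simp only [Expr.eval]; omega⟩ ?_)
  have ev : (Expr.add (.const 1) nodeSizeE).eval (s.setReg 3 ((Expr.const 1).eval s)) =
      nodeAddr σ 1 := by
    change 1 + nodeSizeE.eval _ = _
    rw [he, e1]
  rw [ev]
  obtain ⟨hs, he⟩ := nodeSizeE_spec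
    (s := (s.setReg 3 ((Expr.const 1).eval s)).setReg 4 (nodeAddr σ 1)) hL
    (by simp [State.reg_setReg, h1])
  have ev2 : (Expr.add (.reg 0) (.const 2)).eval
      ((s.setReg 3 ((Expr.const 1).eval s)).setReg 4 (nodeAddr σ 1)) = d + 2 := by
    simp [Expr.eval, State.reg_setReg, h0]
  have ev3 : (Expr.mul (.add (.reg 0) (.const 2)) nodeSizeE).eval
      ((s.setReg 3 ((Expr.const 1).eval s)).setReg 4 (nodeAddr σ 1)) = (d + 2) * (2 * σ + 5) := by
    change (Expr.add (.reg 0) (.const 2)).eval _ * nodeSizeE.eval _ = _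
    rw [ev2, he]
  have ev4 : (Expr.add (.const 1) (.mul (.add (.reg 0) (.const 2)) nodeSizeE)).eval
      ((s.setReg 3 ((Expr.const 1).eval s)).setReg 4 (nodeAddr σ 1)) = nodeAddr σ (d + 2) := by
    change 1 + (Expr.mul (.add (.reg 0) (.const 2)) nodeSizeE).eval _ = _
    rw [ev3]; rfl
  have hlt : (d + 2) * (2 * σ + 5) < W := by unfold nodeAddr at hMW; omega
  refine wpf_seq (wpf_assign ⟨by simp only [Expr.Safe]; omega, ⟨⟨trivial,
    by simp only [Expr.Safe]; omega, ev2.trans_lt (by omega)⟩, hs, ev3.trans_lt hlt⟩,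
    ev4.trans_lt hMW⟩ ?_)
  rw [ev4]
  refine wpf_assign (by simp only [Expr.Safe]; omega) ?_
  refine Wp.seq (wp_clearAll hL ⟨by simp [State.reg_setReg, h0], by simp [State.reg_setReg, h1],
    by simp [State.reg_setReg]⟩ (by simp [State.reg_setReg, Expr.eval, nodeAddr]) ?_)
  intro s2 hr hch hmk hnext
  have r0 : s2.reg 0 = d := by
    rw [hr 0 (by decide) (by decide)]; simp [State.reg_setReg, h0]
  have r1 : s2.reg 1 = σ := by
    rw [hr 1 (by decide) (by decide)]; simp [State.reg_setReg, h1]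
  have r2 : s2.reg 2 = s.reg 2 := by
    rw [hr 2 (by decide) (by decide)]; simp [State.reg_setReg]
  have r9 : s2.reg 9 = nodeAddr σ (d + 2) := by
    rw [hr 9 (by decide) (by decide)]; simp [State.reg_setReg]
  have r3 : s2.reg 3 = nodeAddr σ (0 : Fin (d + 2)) := by
    rw [hr 3 (by decide) (by decide)]; simp [State.reg_setReg, Expr.eval, nodeAddr]
  have r4 : s2.reg 4 = nodeAddr σ (1 : Fin (d + 2)) := by
    rw [hr 4 (by decide) (by decide)]; simp [State.reg_setReg]
  have hc : Ctx σ d s2 := ⟨r0, r1, r9⟩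
  refine wpf.wp (wpf_seq (wpf_stFld hL hc 0 r3 (by simp only [Expr.Safe]; omega) ?_))
  refine wpf_seq (wpf_stFld hL (hc.put _ _) (k := 0) 1 r3 trivial ?_)
  refine wpf_seq (wpf_stFld hL ((hc.put _ _).put _ _) (k := 1) 0 r4
    (by simp only [Expr.Safe]; omega) ?_)
  refine wpf_seq (wpf_stFld hL (((hc.put _ _).put _ _).put _ _) (k := 1) 1 r4 trivial ?_)
  refine wpf_seq (wpf_stFld hL ((((hc.put _ _).put _ _).put _ _).put _ _) (k := 1) 4 r4
    (by simp only [Expr.Safe]; omega) ?_)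
  simp only [Expr.eval, State.reg_put, r3]
  set s3 := ((((s2.put (Loc.fld 0 0 : Loc σ d) 0).put (Loc.fld 0 1 : Loc σ d)
    (nodeAddr σ (0 : Fin (d + 2)))).put (Loc.fld 1 0 : Loc σ d) 1).put (Loc.fld 1 1 : Loc σ d)
    (nodeAddr σ (0 : Fin (d + 2)))).put (Loc.fld 1 4 : Loc σ d) 1 with hs3
  have hreg3 : ∀ r, s3.reg r = s2.reg r := fun r => rfl
  obtain ⟨hs, he⟩ := nodeSizeE_spec (s := s3) hL r1
  have e2 : nodeAddr σ 1 + (2 * σ + 5) = nodeAddr σ 2 := nodeAddr_succ 1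
  have e2' := nodeAddr_add_le (σ := σ) (show 1 < d + 2 by omega)
  have ev5 : (Expr.add (.reg 4) nodeSizeE).eval s3 = nodeAddr σ 2 := by
    rw [Expr.eval, he, ← e2]
    simp only [Expr.eval, hreg3, r4]; simp
  refine wpf_seq (wpf_assign ⟨trivial, hs, by
    change (Expr.add (.reg 4) nodeSizeE).eval s3 < W
    rw [ev5]; omega⟩ ?_)
  rw [ev5]
  refine wpf_seq (wpf_assign (by simp only [Expr.Safe]; omega) ?_)
  refine wpf_seq (wpf_assign (by simp only [Expr.Safe]; omega) ?_)
  refine wpf_assign trivial (hQ _ (by simp [State.reg_setReg, hreg3, r2]) ?_)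
  simp only [Expr.eval]
  set s4 := (((s3.setReg 8 (nodeAddr σ 2)).setReg 6 0).setReg 7 0).setReg 5
    ((((s3.setReg 8 (nodeAddr σ 2)).setReg 6 0).setReg 7 0).reg 4) with hs4
  have hget : ∀ l : Loc σ d, s4.get l =
      if l = .fld 1 4 then 1 else if l = .fld 1 1 then nodeAddr σ (0 : Fin (d + 2))
      else if l = .fld 1 0 then 1 else if l = .fld 0 1 then nodeAddr σ (0 : Fin (d + 2))
      else if l = .fld 0 0 then 0 else s2.get l := by
    intro l
    simp only [hs4, hs3, State.get_setReg, State.get_put]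
  have hreg : ∀ r, r ∉ [5, 6, 7, 8] → s4.reg r = s2.reg r := by
    intro r hr'
    simp only [List.mem_cons, List.not_mem_nil, or_false, not_or] at hr'
    simp [hs4, State.reg_setReg, hr', hreg3]
  obtain ⟨free, hfl, hfn, hfi, hff⟩ := exists_freeChain (σ := σ) (s := s4) (fun k hk => by
    have k0 : k ≠ 0 := by rintro rfl; simp at hk
    have k1 : k ≠ 1 := by rintro rfl; simp at hk
    rw [hget]; simp [k0, k1, hnext]) d 2 (by omega) le_rfl
  have hf0 : ∀ k ∈ free, k ≠ 0 := by rintro k hk rfl; have := hfi _ hk; simp at this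
  have hf1 : ∀ k ∈ free, k ≠ 1 := by rintro k hk rfl; have := hfi _ hk; simp at this
  have hwn : ∀ (u : ENode (Fin σ)) (c : Fin σ), u.wrap c ∉ palsF ([] : List (Fin σ)) := by
    intro u c h
    exact ENode.wrap_ne_nil u c (by simpa [palsF] using h)
  have hP : ∀ p ∈ palsF ([] : List (Fin σ)), p = [] := by simp [palsF]
  -- Only the two auxiliary nodes belong to the tree, so the slots of all other words are
  -- irrelevant.
  let slot : ENode (Fin σ) → Fin (d + 2) := fun u => if u = .negOne then 0 else 1
  have sl0 : slot .negOne = 0 := if_pos rfl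
  have sl1 : ∀ p, slot (.word p) = 1 := fun p => if_neg (by simp)
  refine ⟨slot, free, fun _ => [], ⟨⟨?_, ?_, ?_⟩, ?_, ?_⟩, preOk_nil _, ?_, ?_, ?_⟩
  · rw [hreg 0 (by decide), r0]
  · rw [hreg 1 (by decide), r1]
  · rw [hreg 9 (by decide), r9]
  · refine ⟨?_, ?_, hfn, ?_, ?_, ?_, ?_, ?_, ?_, ?_, ?_, ?_, ?_, ?_, ?_, ?_⟩
    · intro u v hu hv hs
      cases u <;> cases v
      · rfl
      · rw [sl0, sl1] at hs; simp at hs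
      · rw [sl0, sl1] at hs; simp at hs
      · rw [hP _ hu, hP _ hv]
    · intro k hk u _ hs
      cases u
      · exact hf0 k hk (by rw [← hs, sl0])
      · exact hf1 k hk (by rw [← hs, sl1])
    · simp [palsF, hfl]
    · have : s4.reg 8 = nodeAddr σ 2 := by simp [hs4, State.reg_setReg]
      rw [this]; exact hff
    · rw [hreg 3 (by decide), r3, sl0]
    · rw [hreg 4 (by decide), r4, sl1]
    · intro u hu
      rw [hget]
      cases u with
      | negOne => rw [sl0]; simp [ENode.size]
      | word p => rw [sl1, hP _ hu]; simp [ENode.size]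
    · intro u hu
      rw [hget]
      cases u with
      | negOne => rw [sl0]; simp [ENode.lk, sl0]
      | word p => rw [sl1, hP _ hu]; simp [ENode.lk, sl0]
    · intro u _ c
      rw [hget, if_neg (hwn u c)]; simp [hch]
    · intro u _ c
      rw [hget, if_neg (hwn u c)]; simp [hmk]
    · intro u c hu; exact absurd hu (hwn u c)
    · intro u c hu; exact absurd hu (hwn u c)
    -- The counter of the 0-node starts at 1: since `lps [].tail = []`, `linkCount` counts the empty
    -- word as linked to itself.
    · intro p hp
      rw [hget, sl1, hP p hp]
      simp [occCount, linkCount, palsF, Finset.filter_singleton, lps]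
    · intro k hk c; rw [hget]; simp [hch]
    · intro k hk c; rw [hget]; simp [hmk]
  · exact ⟨Nat.zero_le _, fun k hk => absurd hk (by simp), fun k hk => absurd hk (by simp)⟩
  · have : s4.reg 6 = 0 := by simp [hs4, State.reg_setReg]
    rw [this]; exact Nat.pos_of_ne_zero (NeZero.ne d)
  · simp [hs4, State.reg_setReg]
  · rw [lps, sl1, ← r4]; simp [hs4, State.reg_setReg, hreg3]

end Init

/-! ### Reading off the eertree and the minimal absent palindromic words -/

section Readout

variable {σ d M W : ℕ} {s : State} {x : List (Fin σ)}
  {slot : ENode (Fin σ) → Fin (d + 2)} {free : List (Fin (d + 2))} {cnt : List (Fin σ) → ℕ}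

theorem mem_eertreeNodes {u : ENode (Fin σ)} : u ∈ eertreeNodes x ↔ u.In (palsF x) := by
  cases u with
  | negOne => exact Iff.rfl
  | word p => exact mem_palsF.symm

/-- Both auxiliary nodes carry the empty string; the length equation is what separates their
children, the one-letter words and the words cc. -/
theorem isEdge_iff {u v : ENode (Fin σ)} {c : Fin σ} (hv : v.In (palsF x)) :
    IsEdge u c v ↔ v = .word (u.wrap c) ∧ u.str.Palindrome := by
  cases v with
  | negOne =>
    refine ⟨fun h => ?_, fun h => by simp at h⟩
    have := h.1
    cases u <;> simp [ENode.len] at this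
    omega
  | word q =>
    have hq := (mem_palsF.1 hv).1
    constructor
    · rintro ⟨h1, h2, h3⟩
      obtain ⟨u', c', rfl, hu'⟩ := ENode.exists_wrap hq (by rintro rfl; simp [ENode.str] at h3)
      cases u <;> cases u' <;>
        simp_all [ENode.len, ENode.str, ENode.wrap, inner]
    · rintro ⟨h1, h2⟩
      obtain rfl := ENode.word.inj h1
      cases u with
      | negOne => simp [IsEdge, ENode.len, ENode.str, ENode.wrap, inner]
      | word p => simp [IsEdge, ENode.len, ENode.str, ENode.wrap, inner]; omega

theorem isSuffixLink_iff {u v : ENode (Fin σ)} (h : IsSuffixLink u v) : v = u.lk := by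
  cases u with
  | negOne => exact h
  | word p =>
    cases p with
    | nil => exact h
    | cons a p =>
      obtain ⟨q, rfl, ⟨h1, h2, h3⟩, h4⟩ := h
      have h5 : q <:+ p := (List.suffix_cons_iff.1 h2).resolve_left h3
      rw [ENode.lk, eq_lps h1 h5]
      intro r hr hrp
      refine h4 r hr (hrp.trans (List.suffix_cons a p)) ?_
      rintro rfl
      have := hrp.length_le
      simp at this

theorem TreeInv.storesEertree (hM : memSize σ d ≤ M) (h : TreeInv s (palsF x) slot free cnt) :
    StoresEertree M s x := by
  refine ⟨fun u => nodeAddr σ (slot u), ?_, ?_, h.reg3, h.reg4, ?_, ?_, ?_, ?_⟩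
  · intro u hu v hv he
    exact h.inj u v (mem_eertreeNodes.1 hu) (mem_eertreeNodes.1 hv) (nodeAddr_inj he)
  · intro u _
    have h1 := nodeAddr_pos (σ := σ) (slot u)
    have h2 := nodeAddr_fin (σ := σ) (slot u)
    unfold memSize at hM
    dsimp only
    omega
  · intro u hu c v hv he
    rw [mem_eertreeNodes] at hu hv
    obtain ⟨rfl, -⟩ := (isEdge_iff hv).1 he
    have h1 := h.child u hu c
    rw [if_pos (show u.wrap c ∈ palsF x from hv)] at h1
    exact ⟨h1, h.parent u c hv, h.label u c hv⟩
  · intro u hu c hne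
    have hu' := mem_eertreeNodes.1 hu
    have h1 := h.child u hu' c
    rw [if_neg] at h1
    · exact h1
    · intro hw
      refine hne ⟨.word (u.wrap c), mem_eertreeNodes.2 hw, ?_⟩
      exact (isEdge_iff (x := x) (v := .word (u.wrap c)) hw).2
        ⟨rfl, ENode.palindrome_wrap_iff.1 (mem_palsF.1 hw).1⟩
  · intro u hu
    have h1 : s.mem (nodeAddr σ (slot u) + 2 * σ) = u.size := h.len u (mem_eertreeNodes.1 hu)
    rw [h1]
    cases u <;> simp [ENode.size, ENode.len]
  · intro u hu v _ he
    rw [isSuffixLink_iff he]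
    exact h.link u (mem_eertreeNodes.1 hu)

/-- Every palindrome of the window is reached because its parent is again in the tree and smaller;
nothing else is reached because every other child pointer is null. -/
theorem TreeInv.readsNode (h : TreeInv s (palsF x) slot free cnt) {a : ℕ} {u : ENode (Fin σ)} :
    ReadsNode s a u ↔ u.In (palsF x) ∧ a = nodeAddr σ (slot u) := by
  constructor
  · intro hr
    induction hr with
    | negOne => exact ⟨trivial, h.reg3⟩
    | zero => exact ⟨nil_mem_palsF x, h.reg4⟩
    | @child a u c _ hc ih =>
      obtain ⟨hu, rfl⟩ := ih
      have h1 : s.mem (nodeAddr σ (slot u) + c) =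
        if u.wrap c ∈ palsF x then nodeAddr σ (slot (.word (u.wrap c))) else 0 := h.child u hu c
      rw [h1] at hc ⊢
      by_cases hw : u.wrap c ∈ palsF x
      · rw [if_pos hw]; exact ⟨hw, rfl⟩
      · exact absurd (if_neg hw) hc
  · rintro ⟨hu, rfl⟩
    suffices H : ∀ (n : ℕ) (u : ENode (Fin σ)), u.size = n → u.In (palsF x) →
        ReadsNode s (nodeAddr σ (slot u)) u from H _ u rfl hu
    intro n
    induction n using Nat.strong_induction_on with
    | _ n ih =>
      rintro u rfl hu
      cases u with
      | negOne => rw [← h.reg3]; exact .negOne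
      | word p =>
        rcases eq_or_ne p [] with rfl | hp
        · rw [← h.reg4]; exact .zero
        · obtain ⟨u, c, rfl, -⟩ := ENode.exists_wrap (mem_palsF.1 hu).1 hp
          have hu' : u.In (palsF x) := (closed_palsF x).wrap_mem u c hu
          have h1 := ih u.size (by simp only [ENode.size, ENode.length_wrap]; omega) u rfl hu'
          have h2 := h.child u hu' c
          rw [if_pos (show u.wrap c ∈ palsF x from hu)] at h2
          have h3 : s.mem (nodeAddr σ (slot u) + c) = nodeAddr σ (slot (.word (u.wrap c))) := h2
          rw [← h3]
          exact .child c h1 (by rw [h3]; exact (nodeAddr_pos _).ne')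

theorem inner_wrap (u : ENode (Fin σ)) (c : Fin σ) : inner (u.wrap c) = u.str := by
  cases u <;> simp [inner, ENode.wrap, ENode.str]

/-- A minimal absent palindromic word is nonempty, so it is `u.wrap c` for a unique pair, and its
inner part occurs, so `u` is a node. Its absence means precisely that `u` lacks the child along `c`,
which is when the mark is 1. -/
theorem TreeInv.storedWords (h : TreeInv s (palsF x) slot free cnt) :
    storedWords σ s = mapws x := by
  ext w
  constructor
  · rintro ⟨a, u, c, hr, hm, rfl⟩
    obtain ⟨hu, rfl⟩ := h.readsNode.1 hr
    have h1 : s.mem (nodeAddr σ (slot u) + σ + c) = if u.wrap c ∈ palsF x then 0 else 1 :=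
      h.mark u hu c
    have hu' : u.str ∈ palsF x := by
      cases u with
      | negOne => exact nil_mem_palsF x
      | word p => exact hu
    rw [mem_palsF] at hu'
    have hpal : (u.wrap c).Palindrome := ENode.palindrome_wrap_iff.2 hu'.1
    refine ⟨hpal, fun hi => ?_, by rw [inner_wrap]; exact hu'.2⟩
    rw [if_pos (mem_palsF.2 ⟨hpal, hi⟩)] at h1
    omega
  · rintro ⟨hp, hn, hi⟩
    obtain ⟨u, c, rfl, hu⟩ := ENode.exists_wrap hp (by rintro rfl; exact hn List.nil_infix)
    rw [inner_wrap] at hi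
    have hu' : u.In (palsF x) := by
      cases u with
      | negOne => trivial
      | word p => exact mem_palsF.2 ⟨hu, hi⟩
    refine ⟨_, u, c, h.readsNode.2 ⟨hu', rfl⟩, ?_, rfl⟩
    have h1 := h.mark u hu' c
    rw [if_neg fun hw => hn (mem_palsF.1 hw).2] at h1
    exact h1

end Readout

/-! ### Windows -/

section Windows

variable {σ : ℕ} {S : List (Fin σ)}

theorem charAt_eq {k : ℕ} (hk : k < S.length) : charAt S k = S[k] := by
  simp [charAt, hk]

theorem substr_append {i j : ℕ} (hij : i ≤ j + 1) (hj : j + 1 < S.length) :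
    substr S i (j + 1) = substr S i j ++ [S[j + 1]] := by
  unfold substr
  rw [show j + 1 + 1 - i = (j + 1 - i) + 1 by omega, List.take_succ_eq_append_getElem
    (by rw [List.length_drop]; omega), List.getElem_drop]
  congr 3
  omega

theorem substr_cons {i j : ℕ} (hij : i ≤ j) (hj : j < S.length) :
    substr S i j = S[i]'(by omega) :: substr S (i + 1) j := by
  unfold substr
  rw [List.drop_eq_getElem_cons (by omega), show j + 1 - i = (j + 1 - (i + 1)) + 1 by omega,
    List.take_succ_cons]

theorem length_substr {i j : ℕ} (hij : i ≤ j) (hj : j < S.length) :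
    (substr S i j).length = j - i + 1 := by
  unfold substr
  rw [List.length_take, List.length_drop]; omega

theorem substr_zero_zero (h : 0 < S.length) : substr S 0 0 = [S[0]] := by
  rw [substr_cons le_rfl h]; simp [substr]

/-- Each operation moves exactly one end of the window by one, so the number of operations is at
most twice the length of the string. -/
theorem IsWindowSequence.add_eq {n T : ℕ} {i j : ℕ → ℕ} (h : IsWindowSequence n T i j) :
    ∀ t ≤ T, i t + j t = t := by
  intro t
  induction t with
  | zero => intro _; rw [h.start.1, h.start.2]
  | succ t ih =>
    intro ht
    have := ih (by omega)
    rcases h.step t (by omega) with h1 | h1 <;> omega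

end Windows

/-! ### The sliding-window algorithm -/

/-- Iterating a nondeterministic step that keeps an invariant. -/
theorem exists_run {α : Type*} {T : ℕ} {I : ℕ → α → Prop} {R : ℕ → α → ℕ → α → Prop} {a : α}
    (k₀ : ℕ) (h₀ : I 0 a)
    (hstep : ∀ t < T, ∀ s, I t s → ∃ k s', R t s k s' ∧ I (t + 1) s') :
    ∃ (run : ℕ → α) (τ : ℕ → ℕ), run 0 = a ∧ τ 0 = k₀ ∧ (∀ t ≤ T, I t (run t)) ∧
      ∀ t < T, R t (run t) (τ (t + 1)) (run (t + 1)) := by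
  have h : ∀ t s, ∃ k s', t < T → I t s → R t s k s' ∧ I (t + 1) s' := by
    intro t s
    by_cases hc : t < T ∧ I t s
    · obtain ⟨k, s', h'⟩ := hstep t hc.1 s hc.2
      exact ⟨k, s', fun _ _ => h'⟩
    · exact ⟨0, s, fun h1 h2 => absurd ⟨h1, h2⟩ hc⟩
  choose f g hfg using h
  let run : ℕ → α := fun t => Nat.rec a (fun t s => g t s) t
  have hI : ∀ t ≤ T, I t (run t) := by
    intro t
    induction t with
    | zero => exact fun _ => h₀
    | succ t ih => exact fun ht => (hfg t (run t) (by omega) (ih (by omega))).2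
  exact ⟨run, fun t => Nat.casesOn t k₀ fun t => f t (run t), rfl, rfl, hI,
    fun t ht => (hfg t (run t) ht (hI t ht.le)).1⟩

/-- The algorithm. -/
def slidingAlgorithm : WindowAlgorithm := ⟨initProg, appendProg, deleteProg⟩

/-- The amortized time of an operation. -/
def opTime : ℕ := appendTime + stepTime * 6 + bnd deleteProg

theorem potential_le {σ : ℕ} (x : List (Fin σ)) : potential x ≤ 2 * x.length := by
  have h1 := length_lps_le x
  have h2 := length_lps_le (lps x).tail
  rw [List.length_tail] at h2
  unfold potential; omega

/-- The amortised inequality, common to both operations: true time plus the new potential, weighted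
by the cost of a link step, is at most the old weighted potential plus a constant. -/
theorem wp_step {σ d M W : ℕ} [NeZero d] {s : State} (hL : Large M W σ d) {x x' : List (Fin σ)}
    {p : Prog} (h : (∃ c : Fin σ, p = appendProg ∧ s.reg 2 = c ∧ x' = x ++ [c] ∧ x'.length ≤ d) ∨
      (∃ a : Fin σ, p = deleteProg ∧ x = a :: x')) (hI : Inv d s x) (hw : s.Words W) :
    ∃ k s', Exec M W p s k s' ∧ s'.Words W ∧ Inv d s' x' ∧
      k + stepTime * potential x' ≤ stepTime * potential x + opTime := by
  rcases h with ⟨c, rfl, h2, rfl, hl⟩ | ⟨a, rfl, rfl⟩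
  · obtain ⟨h1, h3⟩ := wp_append hL hI h2 (by simpa using hl)
    obtain ⟨k, s', h4, h5, h6, h7⟩ := h3 hw
    refine ⟨k, s', h4, h6, h7, ?_⟩
    have h8 : stepTime * (potential x + 6 - potential (x ++ [c])) +
        stepTime * potential (x ++ [c]) = stepTime * potential x + stepTime * 6 := by
      rw [← Nat.mul_add, ← Nat.mul_add]
      congr 1; omega
    unfold opTime; omega
  · obtain ⟨k, s', h4, h5, h6, h7⟩ := wp_delete hL hI hw
    refine ⟨k, s', h4, h6, h7, ?_⟩
    have := Nat.mul_le_mul_left stepTime (potential_tail a x')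
    unfold opTime; omega

theorem Inv.setReg_two {σ d : ℕ} [NeZero d] {s : State} {x : List (Fin σ)} (h : Inv d s x)
    (v : ℕ) : Inv d (s.setReg 2 v) x := by
  obtain ⟨slot, free, pre, hc, hpre, h6, h7, h5⟩ := h
  refine ⟨slot, free, pre, ?_, hpre, ?_, ?_, ?_⟩
  · have := hc.setReg (r := 2) v
    simpa [State.reg_setReg] using this
  · simpa [State.reg_setReg] using h6
  · simpa [State.reg_setReg] using h7
  · simpa [State.reg_setReg] using h5

theorem wp_init {σ d M W : ℕ} [NeZero d] {s : State} (hL : Large M W σ d) {c : Fin σ}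
    (h0 : s.reg 0 = d) (h1 : s.reg 1 = σ) (h2 : s.reg 2 = c) (hd : 1 ≤ d) :
    Wp M W initProg s (setUpTime σ d + (appendTime + stepTime * 6))
      (fun s' => Inv d s' [c]) := by
  refine Wp.seq (wp_setUp hL h0 h1 ?_)
  intro s1 hs1 hI
  refine (wp_append hL hI (hs1.trans h2) (by simpa using hd)).2.mono ?_ fun _ h => h
  refine Nat.add_le_add_left (Nat.mul_le_mul_left _ ?_) _
  have := potential_le ([] : List (Fin σ))
  simp at this; omega

/-- The 24 is the sum of all coefficients of 1, d, σ and dσ in the expanded size, each of these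
being at most dσ. -/
theorem memSize_le {σ d : ℕ} (hσ : 0 < σ) (hd : 0 < d) : memSize σ d ≤ 24 * (d * σ) := by
  have h1 : d ≤ d * σ := Nat.le_mul_of_pos_right d hσ
  have h2 : σ ≤ d * σ := Nat.le_mul_of_pos_left σ hd
  have h3 : (d + 2) * (2 * σ + 5) = 2 * (d * σ) + 5 * d + 4 * σ + 10 := by ring
  unfold memSize nodeAddr
  omega

/-- A constant for the time of the initialisation. -/
def initConst : ℕ := bnd setConstants + bnd setRoots +
  4 * ((Cond.lt (.reg 10) (.reg 9)).cost + 1 + bnd linkNode + 2 +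
    2 * ((Cond.lt (.reg 11) (.reg 1)).cost + 1 + bnd clearStep))

theorem setUpTime_le {σ d : ℕ} (hσ : 0 < σ) (hd : 0 < d) :
    setUpTime σ d ≤ initConst * (d * σ) := by
  set A := (Cond.lt (.reg 10) (.reg 9)).cost + 1 + bnd linkNode + 2 with hA
  set B := (Cond.lt (.reg 11) (.reg 1)).cost + 1 + bnd clearStep with hB
  have h0 : 1 ≤ d * σ := Nat.mul_pos hd hσ
  have h1 : clearAllTime σ d = (A + B * (σ + 1)) * (d + 3) := by
    unfold clearAllTime clearTime
    rw [hA, hB]; ring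
  have h2 : A + B * (σ + 1) ≤ (A + 2 * B) * σ := by
    have h3 : A * 1 ≤ A * σ := Nat.mul_le_mul_left _ hσ
    have h4 : B * (σ + 1) ≤ B * (2 * σ) := Nat.mul_le_mul_left _ (by omega)
    calc A + B * (σ + 1) ≤ A * σ + B * (2 * σ) := by omega
      _ = _ := by ring
  -- The estimates σ + 1 ≤ 2σ and d + 3 ≤ 4d account for the factors 2 and 4 in `initConst`.
  have h3 : (A + B * (σ + 1)) * (d + 3) ≤ (A + 2 * B) * σ * (4 * d) :=
    Nat.mul_le_mul h2 (by omega)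
  have h4 : (bnd setConstants + bnd setRoots) * 1 ≤
      (bnd setConstants + bnd setRoots) * (d * σ) := Nat.mul_le_mul_left _ h0
  have h5 : initConst * (d * σ) = (bnd setConstants + bnd setRoots) * (d * σ) +
      (A + 2 * B) * σ * (4 * d) := by
    unfold initConst
    rw [← hA, ← hB]; ring
  unfold setUpTime
  rw [h1, h5]; omega

end SlidingMAPW

/-! ### Correctness on the whole window sequence, total time and the absolute constant -/

open SlidingMAPW in
theorem slidingAlgorithm_correct {σ d : ℕ} {S : List (Fin σ)} {T : ℕ} {i j : ℕ → ℕ}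
    (hS : 0 < S.length) (hwin : IsWindowSequence S.length T i j)
    (hlen : ∀ t ≤ T, j t - i t + 1 ≤ d) {M W : ℕ} (hM : memSize σ d ≤ M) (hMW : M ≤ W)
    {s₀ : State} (hs₀ : s₀.Words W) :
    ∃ (run : ℕ → State) (τ : ℕ → ℕ), slidingAlgorithm.Runs M W d S T i j s₀ run τ ∧
      (∀ t ≤ T, StoresEertree M (run t) (substr S (i t) (j t)) ∧
        storedWords σ (run t) = mapws (substr S (i t) (j t))) ∧
      ∑ t ∈ Finset.range (T + 1), τ t ≤
        setUpTime σ d + opTime * (T + 1) + stepTime * 2 := by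
  have hσ : 0 < σ := (S[0]'hS).pos
  have hd : 0 < d := by have := hlen 0 (Nat.zero_le _); omega
  have : NeZero d := ⟨hd.ne'⟩
  have hL : Large M W σ d := ⟨hσ, hM, hMW⟩
  have hW := hL.two_lt
  have hx0 : substr S (i 0) (j 0) = [S[0]] := by
    rw [hwin.start.1, hwin.start.2, substr_zero_zero hS]
  have hc0 := charAt_eq hS
  obtain ⟨k₀, a, hex, hk₀, hwa, hIa⟩ := wp_init hL
    (s := ((s₀.setReg 0 d).setReg 1 σ).setReg 2 (charAt S 0)) (c := S[0])
    (by simp [State.reg_setReg]) (by simp [State.reg_setReg])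
    (by simp [State.reg_setReg, hc0]) hd
    (((hs₀.setReg (by omega)).setReg (by omega)).setReg (by
      rw [hc0]; have := (S[0]).2; omega))
  obtain ⟨run, τ, hr0, hτ0, hI, hR⟩ := exists_run (T := T)
    (I := fun t s => Inv d s (substr S (i t) (j t)) ∧ s.Words W)
    (R := fun t s k s' =>
      (i (t + 1) = i t → j (t + 1) = j t + 1 →
        Exec M W appendProg (s.setReg 2 (charAt S (j (t + 1)))) k s') ∧
      (i (t + 1) = i t + 1 → j (t + 1) = j t → Exec M W deleteProg s k s') ∧
      k + stepTime * potential (substr S (i (t + 1)) (j (t + 1))) ≤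
        stepTime * potential (substr S (i t) (j t)) + opTime) k₀
    (by rw [hx0]; exact ⟨hIa, hwa⟩) (by
      rintro t ht s ⟨hI, hw⟩
      have hin := hwin.inside t ht.le
      have hin' := hwin.inside (t + 1) ht
      rcases hwin.step t ht with ⟨hi, hj⟩ | ⟨hi, hj⟩
      · obtain ⟨k, s', h1, h2, h3, h4⟩ := wp_step hL (p := deleteProg)
          (x' := substr S (i (t + 1)) (j (t + 1)))
          (Or.inr ⟨S[i t], rfl, by rw [hi, hj]; exact substr_cons hin.1 hin.2⟩) hI hw
        exact ⟨k, s', ⟨fun h => by omega, fun _ _ => h1, h4⟩, h3, h2⟩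
      · have hjn : j t + 1 < S.length := by omega
        have hc := charAt_eq hjn
        have hx' : substr S (i (t + 1)) (j (t + 1)) =
            substr S (i t) (j t) ++ [S[j t + 1]] := by
          rw [hi, hj]; exact substr_append (by omega) hjn
        obtain ⟨k, s', h1, h2, h3, h4⟩ := wp_step hL (p := appendProg)
          (s := s.setReg 2 (charAt S (j (t + 1)))) (x' := substr S (i (t + 1)) (j (t + 1)))
          (Or.inl ⟨S[j t + 1], rfl, by rw [hj, hc]; simp [State.reg_setReg], hx', by
            rw [length_substr hin'.1 hin'.2]; exact hlen (t + 1) ht⟩) (hI.setReg_two _)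
          (hw.setReg (by rw [hj, hc]; have := (S[j t + 1]).2; omega))
        exact ⟨k, s', ⟨fun _ _ => h1, fun h => by omega, h4⟩, h3, h2⟩)
  refine ⟨run, τ, ⟨?_, fun t ht => (hR t ht).1, fun t ht => (hR t ht).2.1⟩, ?_, ?_⟩
  · rw [hr0, hτ0]; exact hex
  · intro t ht
    obtain ⟨slot, free, pre, hc, -⟩ := (hI t ht).1
    exact ⟨hc.tree.storesEertree hM, hc.tree.storedWords⟩
  -- The amortised inequalities telescope. The first window is a single letter, so its potential is
  -- at most 2, which gives the summand `stepTime * 2`.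
  · have hsum : ∀ t ≤ T, ∑ t ∈ Finset.range (t + 1), τ t +
        stepTime * potential (substr S (i t) (j t)) ≤
          k₀ + stepTime * potential (substr S (i 0) (j 0)) + opTime * t := by
      intro t
      induction t with
      | zero => intro _; simp [hτ0]
      | succ t ih =>
        intro ht
        have h1 := ih (by omega)
        have h2 := (hR t ht).2.2
        rw [Finset.sum_range_succ, Nat.mul_succ]
        omega
    have h1 := hsum T le_rfl
    have h2 := potential_le (substr S (i 0) (j 0))
    rw [hx0] at h1 h2
    have h3 := Nat.mul_le_mul_left stepTime h2
    have h4 : appendTime + stepTime * 6 ≤ opTime := by unfold opTime; omega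
    rw [Nat.mul_succ]
    simp only [List.length_singleton, Nat.mul_one] at h3
    omega

theorem mainTheorem5 :
    ∃ (A : SlidingMAPW.WindowAlgorithm) (C : ℕ),
      ∀ (σ d : ℕ) (S : List (Fin σ)) (T : ℕ) (i j : ℕ → ℕ),
        0 < S.length →
        SlidingMAPW.IsWindowSequence S.length T i j →
        (∀ t ≤ T, j t - i t + 1 ≤ d) →
        ∀ (W : ℕ), C * (S.length + d * σ) ≤ W →
        ∀ s₀ : SlidingMAPW.State, s₀.Words W →
        ∃ (run : ℕ → SlidingMAPW.State) (τ : ℕ → ℕ),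
          A.Runs (C * (d * σ)) W d S T i j s₀ run τ ∧
          (∀ t ≤ T,
            SlidingMAPW.StoresEertree (C * (d * σ)) (run t)
              (SlidingMAPW.substr S (i t) (j t)) ∧
            SlidingMAPW.storedWords σ (run t) =
              SlidingMAPW.mapws (SlidingMAPW.substr S (i t) (j t))) ∧
          ∑ t ∈ Finset.range (T + 1), τ t ≤ C * (S.length + d * σ) := by
  open SlidingMAPW in
  -- In the constant, 24 covers the memory, `initConst` the initialisation, `2 * opTime` the at most
  -- 2n time points, and `2 * stepTime` the potential of the first window.
  refine ⟨slidingAlgorithm, 24 + initConst + 2 * opTime + 2 * stepTime, ?_⟩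
  intro σ d S T i j hS hwin hlen W hW s₀ hs₀
  have hσ : 0 < σ := (S[0]'hS).pos
  have hd : 0 < d := by have := hlen 0 (Nat.zero_le _); omega
  set C := 24 + initConst + 2 * opTime + 2 * stepTime with hC
  have hM : memSize σ d ≤ C * (d * σ) :=
    (memSize_le hσ hd).trans (Nat.mul_le_mul_right _ (by omega))
  obtain ⟨run, τ, h1, h2, h3⟩ := slidingAlgorithm_correct hS hwin hlen hM
    ((Nat.mul_le_mul_left C (Nat.le_add_left _ _)).trans hW) hs₀
  refine ⟨run, τ, h1, h2, h3.trans ?_⟩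
  have hT : T + 1 ≤ 2 * S.length := by
    have h4 := hwin.add_eq T le_rfl
    have h5 := hwin.inside T le_rfl
    omega
  have h4 := setUpTime_le hσ hd
  have h5 : opTime * (T + 1) ≤ opTime * (2 * S.length) := Nat.mul_le_mul_left _ hT
  have h6 : stepTime * 2 * 1 ≤ stepTime * 2 * S.length := Nat.mul_le_mul_left _ hS
  calc setUpTime σ d + opTime * (T + 1) + stepTime * 2
      ≤ initConst * (d * σ) + opTime * (2 * S.length) + stepTime * 2 * S.length := by omega
    _ ≤ initConst * (S.length + d * σ) + opTime * (2 * (S.length + d * σ)) +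
        stepTime * 2 * (S.length + d * σ) := by gcongr <;> omega
    _ ≤ C * (S.length + d * σ) := by
      rw [hC]
      have : 0 ≤ 24 * (S.length + d * σ) := Nat.zero_le _
      nlinarith
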